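/- Let $\frac34<H<1$ and $T\ge 1$. Let $W=\{W(t,x):t\in[0,T],\,x\in\mathbb R\}$ be a fractional-white noise on a probability space, i.e. a centred Gaussian field with $$\mathbb E[W(t,x)W(s,y)]=\tfrac12\left(t^{2H}+s^{2H}-|t-s|^{2H}\right)\cdot\tfrac12\left(|x|+|y|-|x-y|\right),$$ and let $u$ be the mild solution of the stochastic wave equation $\partial_t^2u=\partial_x^2u+\dot W$ on $[0,T]\times\mathbb R$ with $u(0,\cdot)=\partial_tu(0,\cdot)=0$, that is, the Wiener integral $u(t,x)=\int_0^t\int_{\mathbb R}\frac12\mathbf 1_{\{|x-y|<t-s\}}\,W(\mathrm ds,\mathrm dy)$. Fix $x\in\mathbb R$ and put $$V_N=\frac1N\sum_{i=0}^{N-1}\left(\left(u\left(\tfrac{i+1}N,x\right)-u\left(\tfrac iN,x\right)\right)^2-\mathbb E\left[\left(u\left(\tfrac{i+1}N,x\right)-u\left(\tfrac iN,x\right)\right)^2\right]\right).$$ Then $k:=\lim_{N\to\infty}N^4\,\mathbb E[V_N^2]$ exists and $0<k<\infty$, and $V_N/\sqrt{\mathbb E[V_N^2]}$ converges in distribution,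 as $N\to\infty$, to a non-Gaussian random variable $X$ in the second Wiener chaos of $W$ (the closed linear span in $L^2$ of the variables $\xi^2-1$, where $\xi$ is in the $L^2$-closed linear span of the field $W$ and $\mathbb E[\xi^2]=1$). The moment generating function of $X$ is finite near $0$, and for every integer $m\ge3$ the $m$-th cumulant of $X$ is $$\kappa_m(X)=2^{2m-1}\left(\tfrac H4\right)^m(2H-1)^m\,k^{-m/2}\,(m-1)!\int_{[0,1]^m}\prod_{i=1}^m|x_i-x_{i+1}|^{2H-2}\min(x_i,x_{i+1})\;\mathrm dx_1\cdots\mathrm dx_m,\qquad x_{m+1}:=x_1,$$ where the integral is absolutely convergent. -/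

import Mathlib

open MeasureTheory ProbabilityTheory Filter Topology
open scoped ENNReal

noncomputable section

namespace WaveQV

/-- Covariance of the fractional Brownian motion with Hurst parameter `H`, for `s, t ≥ 0`. -/
def fbmCov (H t s : ℝ) : ℝ :=
  (t ^ (2 * H) + s ^ (2 * H) - |t - s| ^ (2 * H)) / 2

/-- Covariance of the two-sided Brownian motion; it equals `min x y` for `x, y ≥ 0`. -/
def bmCov (x y : ℝ) : ℝ :=
  (|x| + |y| - |x - y|) / 2

/-- `W` is a fractional-white noise on `[0, T] × ℝ`: a centred Gaussian field which is
fractional with Hurst parameter `H` in time and white in space. -/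
structure IsFractionalWhiteNoise {Ω : Type*} [MeasurableSpace Ω] (P : Measure Ω) (H T : ℝ)
    (W : ℝ → ℝ → Ω → ℝ) : Prop where
  gaussian : IsGaussianProcess (fun p : Set.Icc (0 : ℝ) T × ℝ => W p.1 p.2) P
  centred : ∀ t ∈ Set.Icc (0 : ℝ) T, ∀ x : ℝ, ∫ ω, W t x ω ∂P = 0
  covariance : ∀ t ∈ Set.Icc (0 : ℝ) T, ∀ s ∈ Set.Icc (0 : ℝ) T, ∀ x y : ℝ,
    ∫ ω, W t x ω * W s y ω ∂P = fbmCov H t s * bmCov x y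

/-- An elementary integrand on `[0, T] × ℝ`: the linear combination
`∑ i, coef i • 1_{(t₀ i, t₁ i] × (y₀ i, y₁ i]}` of indicators of rectangles. -/
structure Elementary (T : ℝ) where
  n : ℕ
  coef : Fin n → ℝ
  t₀ : Fin n → ℝ
  t₁ : Fin n → ℝ
  y₀ : Fin n → ℝ
  y₁ : Fin n → ℝ
  zero_le : ∀ i, 0 ≤ t₀ i
  t_le : ∀ i, t₀ i ≤ t₁ i
  le_T : ∀ i, t₁ i ≤ T
  y_le : ∀ i, y₀ i ≤ y₁ i

/-- The function on `[0, T] × ℝ` given by an elementary integrand. -/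
def Elementary.toFun {T : ℝ} (f : Elementary T) (s y : ℝ) : ℝ :=
  ∑ i, f.coef i * (Set.Ioc (f.t₀ i) (f.t₁ i)).indicator 1 s *
    (Set.Ioc (f.y₀ i) (f.y₁ i)).indicator 1 y

/-- The Wiener integral of an elementary integrand: each rectangle is replaced by the rectangular
increment of the field `W` over it. -/
def Elementary.integral {Ω : Type*} {T : ℝ} (f : Elementary T) (W : ℝ → ℝ → Ω → ℝ) (ω : Ω) : ℝ :=
  ∑ i, f.coef i * (W (f.t₁ i) (f.y₁ i) ω - W (f.t₁ i) (f.y₀ i) ω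
    - W (f.t₀ i) (f.y₁ i) ω + W (f.t₀ i) (f.y₀ i) ω)

/-- The squared norm `H (2H - 1) ∫₀ᵀ ∫₀ᵀ ∫_ℝ |f(s,y)| |f(r,y)| |s - r|^(2H-2) dy dr ds` of the usual
space of functions integrable with respect to fractional-white noise, `1/2 < H < 1`. Without the
absolute values of `f` it is the variance of the Wiener integral of `f`. -/
def noiseNormSq (H T : ℝ) (f : ℝ → ℝ → ℝ) : ℝ≥0∞ :=
  ENNReal.ofReal (H * (2 * H - 1)) *
    ∫⁻ s in Set.Icc (0 : ℝ) T, ∫⁻ r in Set.Icc (0 : ℝ) T, ∫⁻ y,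
      ENNReal.ofReal (|f s y| * |f r y| * |s - r| ^ (2 * H - 2))

/-- `Z` is (a version of) the Wiener integral `∫₀ᵀ ∫_ℝ f(s,y) W(ds,dy)`, `1/2 < H < 1`: the `L²`-limit
of the integrals of elementary integrands which approximate `f`. -/
def IsWienerIntegral {Ω : Type*} [MeasurableSpace Ω] (P : Measure Ω) (H T : ℝ)
    (W : ℝ → ℝ → Ω → ℝ) (f : ℝ → ℝ → ℝ) (Z : Ω → ℝ) : Prop :=
  MemLp Z 2 P ∧ ∃ g : ℕ → Elementary T,
    Tendsto (fun n => noiseNormSq H T (fun s y => (g n).toFun s y - f s y)) atTop (𝓝 0) ∧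
    Tendsto (fun n => eLpNorm (fun ω => (g n).integral W ω - Z ω) 2 P) atTop (𝓝 0)

/-- The fundamental solution `G₁(t, x) = 1/2 · 1_{|x| < t}` of the one-dimensional wave equation. -/
def waveKernel (t x : ℝ) : ℝ :=
  if |x| < t then 1 / 2 else 0

/-- `u` is the mild solution on `[0, T] × ℝ` of `∂²u/∂t² = ∂²u/∂x² + Ẇ` with zero initial
conditions, `u(t,x) = ∫₀ᵗ ∫_ℝ G₁(t-s, x-y) W(ds,dy)`. The integrand vanishes for `s ≥ t`. -/
def IsMildSolution {Ω : Type*} [MeasurableSpace Ω] (P : Measure Ω) (H T : ℝ)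
    (W u : ℝ → ℝ → Ω → ℝ) : Prop :=
  ∀ t ∈ Set.Icc (0 : ℝ) T, ∀ x : ℝ,
    IsWienerIntegral P H T W (fun s y => waveKernel (t - s) (x - y)) (u t x)

/-- The centred quadratic variation `V_N` of `u` in time, at the space point `x`. -/
def quadVar {Ω : Type*} [MeasurableSpace Ω] (P : Measure Ω) (u : ℝ → ℝ → Ω → ℝ) (x : ℝ)
    (N : ℕ) (ω : Ω) : ℝ :=
  (1 / (N : ℝ)) * ∑ i ∈ Finset.range N,
    ((u (((i : ℝ) + 1) / N) x ω - u ((i : ℝ) / N) x ω) ^ 2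
      - ∫ ω', (u (((i : ℝ) + 1) / N) x ω' - u ((i : ℝ) / N) x ω') ^ 2 ∂P)

/-- The first chaos (Gaussian Hilbert space) of `W`: the closed linear span in `L²` of the variables
`W(t, y)`, `0 ≤ t ≤ T`. -/
def firstChaos {Ω : Type*} [MeasurableSpace Ω] (P : Measure Ω) (T : ℝ)
    (W : ℝ → ℝ → Ω → ℝ) : Submodule ℝ (Lp ℝ 2 P) :=
  (Submodule.span ℝ {ξ : Lp ℝ 2 P |
    ∃ t ∈ Set.Icc (0 : ℝ) T, ∃ y : ℝ, ξ =ᵐ[P] W t y}).topologicalClosure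

/-- The second Wiener chaos of `W`: the closed linear span in `L²` of the variables `H₂(ξ) = ξ² - 1`,
where `ξ` is in the first chaos and has unit variance. -/
def secondChaos {Ω : Type*} [MeasurableSpace Ω] (P : Measure Ω) (T : ℝ)
    (W : ℝ → ℝ → Ω → ℝ) : Submodule ℝ (Lp ℝ 2 P) :=
  (Submodule.span ℝ {Y : Lp ℝ 2 P |
    ∃ ξ ∈ firstChaos P T W, ‖ξ‖ = 1 ∧ Y =ᵐ[P] fun ω => ξ ω ^ 2 - 1}).topologicalClosure

/-- The `m`-th cumulant of `X`: the `m`-th derivative at `0` of `t ↦ log E[exp(t X)]`. It is only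
used for variables whose moment generating function is finite near `0`. -/
def cumulant {Ω : Type*} [MeasurableSpace Ω] (X : Ω → ℝ) (P : Measure Ω) (m : ℕ) : ℝ :=
  iteratedDeriv m (cgf X P) 0

/-- The cyclic product `∏ |x_i - x_{i+1}|^(2H-2) min(x_i, x_{i+1})`, indices modulo `m`. -/
def cyclicKernel (H : ℝ) (m : ℕ) (x : Fin m → ℝ) : ℝ :=
  ∏ i, |x i - x (finRotate m i)| ^ (2 * H - 2) * min (x i) (x (finRotate m i))

end WaveQV

end

/-! The increment of u over [a, b] is the Wiener integral of half the indicator of the band a ≤ s +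
|x - y| < b. In the variables p = s + |x - y|, q = r + |x - y| the noise kernel |s - r|^(2H-2)
becomes |p - q|^(2H-2), and the conditions s, r ≥ 0 become |x - y| ≤ min(p, q). Hence the covariance
of two increments is the integral over the product of their time intervals of K(p, q) = H(2H-1)/2 ·
|p - q|^(2H-2) min(p, q), which is `waveCov` (`lintegral_bandFun_mul`, `inner_increment`). The
isometry of the Wiener integral used here rests on a Cauchy-Schwarz inequality for the noise
(`energy_le`), which holds because |s - r|^(-α) is a superposition of products of interval
indicators.

Put S_N = N² V_N (`quadSum`). By the Wick formula, ⟨S_N, S_M⟩ is twice the squared L² norm on the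
unit square of K averaged over cells of size 1/N × 1/M. The averages are dominated by a multiple of
|x - y|^(2H-2), which is square integrable because H > 3/4. So these inner products converge to one
number 2‖K‖² as N and M tend to infinity independently, and S_N is Cauchy in L². Its limit ζ lies in
the second chaos, k = ‖ζ‖² = 2‖K‖² > 0, and X = ζ/‖ζ‖; convergence in law comes from convergence in
L².

For the cumulants, S_N is diagonalised: if l_a are the eigenvalues of the Gram matrix of the
increments, the moment generating function of S_N is the product of exp(-tNl_a)(1 - 2tNl_a)^(-1/2),
and its logarithm is the series of (2t)^m/(2m) · Σ_a (Nl_a)^m over m ≥ 2 (`mgf_sum_sq`,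
`hasSum_log_prod`). The power sums are traces of powers of the averaged kernel, that is, cyclic
integrals (`sum_eigenvalues_pow`), and converge to the cyclic integrals of K
(`tendsto_integral_cycle`). Uniform exponential moments carry the series over to ζ
(`hasSum_cgf_of_tendsto_Lp`). Since K > 0 almost everywhere, the third cumulant is positive, so X is
not Gaussian. -/

namespace WaveQV

/-! ### Gaussian spaces: moments, independence, quadratic forms -/

section Gaussian

variable {Ω : Type*} [MeasurableSpace Ω] {P : Measure Ω}

/-- A space of square-integrable variables, all of which are centred Gaussian. -/
def IsGaussianSpace (P : Measure Ω) (G : Submodule ℝ (Lp ℝ 2 P)) : Prop :=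
  ∀ ξ ∈ G, P.map ξ = gaussianReal 0 (‖ξ‖₊ ^ 2)

/-- The moment generating function is exp(v t²/2), and its fourth derivative at 0 is 3v². -/
lemma integral_pow_four_gaussianReal (v : NNReal) :
    ∫ x, x ^ 4 ∂(gaussianReal 0 v) = 3 * (v : ℝ) ^ 2 := by
  have h0 : (0 : ℝ) ∈ interior (integrableExpSet id (gaussianReal 0 v)) := by
    rw [integrableExpSet_id_gaussianReal]; simp
  have h := iteratedDeriv_mgf_zero h0 4
  have e : ∫ x, x ^ 4 ∂(gaussianReal 0 v) = ∫ x, (id ^ 4 : ℝ → ℝ) x ∂(gaussianReal 0 v) := by simp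
  rw [e, ← h, mgf_id_gaussianReal]
  have hd (t : ℝ) : HasDerivAt (fun t : ℝ => Real.exp (0 * t + v * t ^ 2 / 2))
      (v * t * Real.exp (0 * t + v * t ^ 2 / 2)) t := by
    have := ((((hasDerivAt_id t).const_mul (0 : ℝ)).add
      (((hasDerivAt_id t).pow 2).const_mul (v : ℝ) |>.div_const 2))).exp
    convert! this using 1
    simp; ring
  have d1 : deriv (fun t : ℝ => Real.exp (0 * t + v * t ^ 2 / 2)) =
      fun t => v * t * Real.exp (0 * t + v * t ^ 2 / 2) := by
    ext t; exact (hd t).deriv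
  have d2 : deriv (fun t : ℝ => v * t * Real.exp (0 * t + v * t ^ 2 / 2)) =
      fun t => (v + v ^ 2 * t ^ 2) * Real.exp (0 * t + v * t ^ 2 / 2) := by
    ext t
    have := ((hasDerivAt_id t).const_mul (v : ℝ)).mul (hd t)
    rw [HasDerivAt.deriv (f' := v * 1 * Real.exp (0 * t + v * t ^ 2 / 2) +
      v * t * (v * t * Real.exp (0 * t + v * t ^ 2 / 2)))]
    · ring
    · exact this
  have d3 : deriv (fun t : ℝ => (v + v ^ 2 * t ^ 2) * Real.exp (0 * t + v * t ^ 2 / 2)) =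
      fun t => (3 * v ^ 2 * t + v ^ 3 * t ^ 3) * Real.exp (0 * t + v * t ^ 2 / 2) := by
    ext t
    have h1 : HasDerivAt (fun t : ℝ => (v + v ^ 2 * t ^ 2 : ℝ)) (v ^ 2 * (2 * t)) t := by
      simpa using (((hasDerivAt_id t).pow 2).const_mul ((v : ℝ) ^ 2)).const_add (v : ℝ)
    exact (h1.mul (hd t)).deriv.trans (by ring)
  have d4 : deriv (fun t : ℝ => (3 * v ^ 2 * t + v ^ 3 * t ^ 3) *
      Real.exp (0 * t + v * t ^ 2 / 2)) 0 = 3 * (v : ℝ) ^ 2 := by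
    have h1 : HasDerivAt (fun t : ℝ => (3 * v ^ 2 * t + v ^ 3 * t ^ 3 : ℝ))
        (3 * v ^ 2) 0 := by
      have := ((hasDerivAt_id (0 : ℝ)).const_mul (3 * (v : ℝ) ^ 2)).add
        (((hasDerivAt_id (0 : ℝ)).pow 3).const_mul ((v : ℝ) ^ 3))
      convert! this using 1
      simp
    exact (h1.mul (hd 0)).deriv.trans (by simp)
  simp only [iteratedDeriv_succ, iteratedDeriv_zero, d1, d2, d3, d4]

/-- For v ≠ 0 the density times exp(t x²) is again an unnormalised Gaussian, of rate 1/(2v) - t,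
which `ht` makes positive. -/
lemma integrable_exp_sq_gaussianReal (v : NNReal) {t : ℝ} (ht : 2 * t * v < 1) :
    Integrable (fun x => Real.exp (t * x ^ 2)) (gaussianReal 0 v) ∧
      ∫ x, Real.exp (t * x ^ 2) ∂(gaussianReal 0 v) = (√(1 - 2 * t * v))⁻¹ := by
  by_cases hv : v = 0
  · subst hv
    simp only [gaussianReal_zero_var]
    constructor
    · exact integrable_dirac (by simp)
    · simp
  have hv' : (0 : ℝ) < v := by positivity
  have hb : 0 < 1 / (2 * v) - t := by
    rw [sub_pos, lt_div_iff₀ (by positivity)]; linarith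
  have key (x : ℝ) : gaussianPDFReal 0 v x * Real.exp (t * x ^ 2) =
      (√(2 * Real.pi * v))⁻¹ * Real.exp (-(1 / (2 * v) - t) * x ^ 2) := by
    rw [gaussianPDFReal_def, mul_assoc, ← Real.exp_add]
    congr 2
    field_simp
    ring
  constructor
  · rw [gaussianReal_of_var_ne_zero _ hv]
    rw [integrable_withDensity_iff_integrable_smul₀' (measurable_gaussianPDF 0 v).aemeasurable
      (by simp [gaussianPDF_lt_top])]
    simp only [toReal_gaussianPDF, smul_eq_mul, key]
    exact (integrable_exp_neg_mul_sq hb).const_mul _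
  · rw [integral_gaussianReal_eq_integral_smul hv]
    simp only [smul_eq_mul, key]
    rw [integral_const_mul, integral_gaussian, ← Real.sqrt_inv, ← Real.sqrt_inv,
      ← Real.sqrt_mul (by positivity)]
    congr 1
    have : (1 - 2 * t * v) ≠ 0 := by linarith
    have h2 : 1 / (2 * (v : ℝ)) - t = (1 - 2 * t * v) / (2 * v) := by field_simp
    rw [h2]
    field_simp

namespace IsGaussianSpace

variable {G : Submodule ℝ (Lp ℝ 2 P)}

lemma hasGaussianLaw (hG : IsGaussianSpace P G) {ξ : Lp ℝ 2 P} (hξ : ξ ∈ G) :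
    HasGaussianLaw ξ P where
  isGaussian_map := by rw [hG ξ hξ]; infer_instance

lemma integral_eq_zero (hG : IsGaussianSpace P G) {ξ : Lp ℝ 2 P} (hξ : ξ ∈ G) :
    ∫ ω, ξ ω ∂P = 0 := by
  have h : ∫ x, id x ∂(P.map ξ) = ∫ ω, ξ ω ∂P :=
    integral_map (Lp.stronglyMeasurable ξ).measurable.aemeasurable
      aestronglyMeasurable_id
  rw [← h, hG ξ hξ]
  simp

lemma memLp (hG : IsGaussianSpace P G) {ξ : Lp ℝ 2 P} (hξ : ξ ∈ G) {p : ℝ≥0∞} (hp : p ≠ ∞) :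
    MemLp ξ p P :=
  (hG.hasGaussianLaw hξ).memLp hp

lemma integral_pow_four (hG : IsGaussianSpace P G) {ξ : Lp ℝ 2 P} (hξ : ξ ∈ G) :
    ∫ ω, ξ ω ^ 4 ∂P = 3 * ‖ξ‖ ^ 4 := by
  have h : ∫ x, x ^ 4 ∂(P.map ξ) = ∫ ω, ξ ω ^ 4 ∂P :=
    integral_map (Lp.stronglyMeasurable ξ).measurable.aemeasurable
      (by fun_prop)
  rw [← h, hG ξ hξ, integral_pow_four_gaussianReal]
  simp; ring

lemma integrable_sq_mul_sq (hG : IsGaussianSpace P G) {ξ η : Lp ℝ 2 P} (hξ : ξ ∈ G) (hη : η ∈ G) :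
    Integrable (fun ω => ξ ω ^ 2 * η ω ^ 2) P := by
  have h (ζ : Lp ℝ 2 P) (hζ : ζ ∈ G) : MemLp (fun ω => ζ ω ^ 2) 2 P := by
    have h4 : MemLp ζ 4 P := hG.memLp hζ (by simp)
    have := h4.norm_rpow_div 2
    convert! this using 2
    · simp
    · have : (4 : ℝ≥0∞) = 2 * 2 := by norm_num
      rw [this, ENNReal.mul_div_cancel_right] <;> simp
  exact (h ξ hξ).integrable_mul (h η hη)

-- Polarisation, 12 ξ²η² = (ξ+η)⁴ + (ξ-η)⁴ - 2ξ⁴ - 2η⁴, reduces the mixed moment to fourth moments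
-- of single elements of the space.
open scoped RealInnerProductSpace in
lemma integral_sq_mul_sq (hG : IsGaussianSpace P G) {ξ η : Lp ℝ 2 P} (hξ : ξ ∈ G) (hη : η ∈ G) :
    ∫ ω, ξ ω ^ 2 * η ω ^ 2 ∂P = ‖ξ‖ ^ 2 * ‖η‖ ^ 2 + 2 * ⟪ξ, η⟫ ^ 2 := by
  have i4 (ζ : Lp ℝ 2 P) (hζ : ζ ∈ G) : Integrable (fun ω => ζ ω ^ 4) P := by
    have := hG.integrable_sq_mul_sq hζ hζ
    refine this.congr (ae_of_all _ fun ω => ?_)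
    simp only; ring
  have hp := G.add_mem hξ hη
  have hm := G.sub_mem hξ hη
  have e : (fun ω => ξ ω ^ 2 * η ω ^ 2) =ᵐ[P] fun ω => (1 / 12 : ℝ) *
      (((ξ + η : Lp ℝ 2 P) ω ^ 4 + (ξ - η : Lp ℝ 2 P) ω ^ 4) - (2 * ξ ω ^ 4 + 2 * η ω ^ 4)) := by
    filter_upwards [Lp.coeFn_add ξ η, Lp.coeFn_sub ξ η] with ω h1 h2
    rw [h1, h2]
    simp only [Pi.add_apply, Pi.sub_apply]
    ring
  rw [integral_congr_ae e, integral_const_mul, integral_sub, integral_add, integral_add,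
    integral_const_mul, integral_const_mul, hG.integral_pow_four hξ, hG.integral_pow_four hη,
    hG.integral_pow_four hp, hG.integral_pow_four hm]
  · have h1 := norm_add_sq_real ξ η
    have h2 := norm_sub_sq_real ξ η
    have e1 : ‖ξ + η‖ ^ 4 = (‖ξ + η‖ ^ 2) ^ 2 := by ring
    have e2 : ‖ξ - η‖ ^ 4 = (‖ξ - η‖ ^ 2) ^ 2 := by ring
    rw [e1, e2, h1, h2]
    ring
  · exact (i4 _ hξ).const_mul _
  · exact (i4 _ hη).const_mul _
  · exact i4 _ hp
  · exact i4 _ hm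
  · exact (i4 _ hp).add (i4 _ hm)
  · exact ((i4 _ hξ).const_mul _).add ((i4 _ hη).const_mul _)

lemma coeFn_sum_smul {ι : Type*} (s : Finset ι) (c : ι → ℝ) (ξ : ι → Lp ℝ 2 P) :
    ((∑ i ∈ s, c i • ξ i : Lp ℝ 2 P) : Ω → ℝ) =ᵐ[P] fun ω => ∑ i ∈ s, c i * ξ i ω := by
  have h := Lp.coeFn_fun_finsetSum s (fun i => c i • ξ i)
  have h2 : ∀ᵐ ω ∂P, ∀ i ∈ s, (c i • ξ i : Lp ℝ 2 P) ω = c i * ξ i ω := by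
    rw [eventually_all_finset]
    intro i _
    filter_upwards [Lp.coeFn_smul (c i) (ξ i)] with ω hω
    rw [hω]; simp
  filter_upwards [h, h2] with ω h h2
  rw [h]
  exact Finset.sum_congr rfl h2

/-- Every linear form of the vector is again an element of `G`, so joint Gaussianity follows from
linearity of `G`. -/
lemma hasGaussianLaw_pi (hG : IsGaussianSpace P G) {ι : Type*} [Fintype ι]
    {ξ : ι → Lp ℝ 2 P} (hξ : ∀ i, ξ i ∈ G) : HasGaussianLaw (fun ω i => ξ i ω) P where
  isGaussian_map := by
    classical
    have hm : Measurable fun ω i => ξ i ω :=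
      measurable_pi_lambda _ fun i => (Lp.stronglyMeasurable (ξ i)).measurable
    refine ⟨fun L => ?_⟩
    have hL : (L ∘ fun ω i => ξ i ω) =ᵐ[P] (∑ i, L (Pi.single i 1) • ξ i : Lp ℝ 2 P) := by
      filter_upwards [coeFn_sum_smul Finset.univ (fun i => L (Pi.single i 1)) ξ] with ω hω
      rw [hω]
      simp only [Function.comp_apply]
      conv_lhs => rw [← Finset.univ_sum_single (fun i => ξ i ω)]
      rw [map_sum]
      refine Finset.sum_congr rfl fun i _ => ?_
      have : Pi.single i (ξ i ω) = ξ i ω • (Pi.single i 1 : ι → ℝ) := by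
        rw [← Pi.single_smul]; simp
      rw [this, map_smul, smul_eq_mul, mul_comm]
    have hmem : (∑ i, L (Pi.single i 1) • ξ i : Lp ℝ 2 P) ∈ G :=
      G.sum_mem fun i _ => G.smul_mem _ (hξ i)
    have hg : HasGaussianLaw (L ∘ fun ω i => ξ i ω) P :=
      (hG.hasGaussianLaw hmem).congr hL.symm
    have := hg.isGaussian_map
    rw [← Measure.map_map L.continuous.measurable hm] at this
    have h3 := this.eq_gaussianReal
    rw [h3, integral_map (by fun_prop) (by fun_prop), variance_map (by fun_prop) (by fun_prop)]
    rfl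

-- The means vanish, so orthogonality is absence of correlation, which for a jointly Gaussian family
-- is independence.
open scoped RealInnerProductSpace in
lemma iIndepFun_of_orthogonal (hG : IsGaussianSpace P G) {ι : Type*} [Fintype ι]
    {ξ : ι → Lp ℝ 2 P} (hξ : ∀ i, ξ i ∈ G) (ho : ∀ i j, i ≠ j → ⟪ξ i, ξ j⟫ = 0) :
    iIndepFun (fun i => (ξ i : Ω → ℝ)) P := by
  have hp : IsProbabilityMeasure P := (hG.hasGaussianLaw G.zero_mem).isProbabilityMeasure
  refine (hG.hasGaussianLaw_pi hξ).iIndepFun_of_covariance_eq_zero fun i j hij => ?_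
  rw [covariance_eq_sub (Lp.memLp _) (Lp.memLp _), hG.integral_eq_zero (hξ i), zero_mul, sub_zero,
    ← ho i j hij, L2.inner_def]
  refine integral_congr_ae (ae_of_all _ fun ω => ?_)
  simp [mul_comm]

lemma mgf_sq (hG : IsGaussianSpace P G) {ξ : Lp ℝ 2 P} (hξ : ξ ∈ G) {t : ℝ}
    (ht : 2 * t * ‖ξ‖ ^ 2 < 1) :
    Integrable (fun ω => Real.exp (t * ξ ω ^ 2)) P ∧
      mgf (fun ω => ξ ω ^ 2) P t = (√(1 - 2 * t * ‖ξ‖ ^ 2))⁻¹ := by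
  have hm : AEMeasurable ξ P := (Lp.stronglyMeasurable ξ).measurable.aemeasurable
  have h := integrable_exp_sq_gaussianReal (‖ξ‖₊ ^ 2) (t := t) (by simpa using ht)
  rw [← hG ξ hξ, integrable_map_measure (by fun_prop) hm, integral_map hm (by fun_prop)] at h
  refine ⟨h.1, ?_⟩
  have := h.2
  simpa [mgf] using this

end IsGaussianSpace

/-- A real symmetric matrix is orthogonally diagonalisable. -/
lemma exists_orthogonal_diagonalization {n : Type*} [Fintype n] [DecidableEq n]
    (A : Matrix n n ℝ) (hA : A.transpose = A) :
    ∃ (U : Matrix n n ℝ) (l : n → ℝ), U.transpose * U = 1 ∧ U * U.transpose = 1 ∧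
      A = U * Matrix.diagonal l * U.transpose := by
  have h : A.IsHermitian := by
    rw [Matrix.IsHermitian, Matrix.conjTranspose_eq_transpose_of_trivial, hA]
  refine ⟨h.eigenvectorUnitary, h.eigenvalues, ?_, ?_, ?_⟩
  · have := Unitary.coe_star_mul_self h.eigenvectorUnitary
    rwa [Matrix.star_eq_conjTranspose, Matrix.conjTranspose_eq_transpose_of_trivial] at this
  · have := Unitary.coe_mul_star_self h.eigenvectorUnitary
    rwa [Unitary.coe_star, Matrix.star_eq_conjTranspose, Matrix.conjTranspose_eq_transpose_of_trivial] at this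
  · have := h.spectral_theorem
    rw [Unitary.conjStarAlgAut_apply] at this
    rwa [Matrix.star_eq_conjTranspose, Matrix.conjTranspose_eq_transpose_of_trivial] at this

open scoped RealInnerProductSpace in
/-- The law of a centred quadratic form in Gaussian variables, in terms of the eigenvalues of the
Gram matrix. -/
lemma IsGaussianSpace.mgf_sum_sq {G : Submodule ℝ (Lp ℝ 2 P)} (hG : IsGaussianSpace P G)
    {ι : Type*} [Fintype ι] [DecidableEq ι] {ξ : ι → Lp ℝ 2 P} (hξ : ∀ i, ξ i ∈ G)
    {U : Matrix ι ι ℝ} {l : ι → ℝ} (h1 : U.transpose * U = 1) (h2 : U * U.transpose = 1)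
    (hA : Matrix.of (fun i j => ⟪ξ i, ξ j⟫) = U * Matrix.diagonal l * U.transpose)
    {t : ℝ} (ht : ∀ i, 2 * t * l i < 1) :
    Integrable (fun ω => Real.exp (t * ∑ i, (ξ i ω ^ 2 - ‖ξ i‖ ^ 2))) P ∧
      mgf (fun ω => ∑ i, (ξ i ω ^ 2 - ‖ξ i‖ ^ 2)) P t =
        ∏ i, (Real.exp (-(t * l i)) * (√(1 - 2 * t * l i))⁻¹) := by
  have hp : IsProbabilityMeasure P := (hG.hasGaussianLaw G.zero_mem).isProbabilityMeasure
  -- The rotated variables are orthogonal with variances `l a`, hence independent, and the rotation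
  -- preserves the sum of squares.
  set η : ι → Lp ℝ 2 P := fun a => ∑ i, U i a • ξ i with hη
  have hηG (a) : η a ∈ G := G.sum_mem fun i _ => G.smul_mem _ (hξ i)
  have hin (a b) : ⟪η a, η b⟫ = Matrix.diagonal l a b := by
    have : Matrix.diagonal l = U.transpose * Matrix.of (fun i j => ⟪ξ i, ξ j⟫) * U := by
      rw [hA]
      calc Matrix.diagonal l = 1 * Matrix.diagonal l * 1 := by simp
        _ = _ := by rw [← h1]; simp only [Matrix.mul_assoc]
    rw [this]
    simp only [hη, sum_inner, inner_sum, inner_smul_left, inner_smul_right, Matrix.mul_apply,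
      Matrix.transpose_apply, Matrix.of_apply, Finset.sum_mul, Finset.mul_sum]
    refine Finset.sum_congr rfl fun i _ => Finset.sum_congr rfl fun j _ => ?_
    simp; ring
  have hnorm (a) : ‖η a‖ ^ 2 = l a := by
    rw [← real_inner_self_eq_norm_sq, hin]; simp
  have hind : iIndepFun (fun a => (η a : Ω → ℝ)) P :=
    hG.iIndepFun_of_orthogonal hηG fun a b hab => by rw [hin, Matrix.diagonal_apply_ne _ hab]
  have hind2 : iIndepFun (fun a ω => η a ω ^ 2) P :=
    hind.comp (fun _ x => x ^ 2) fun _ => by fun_prop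
  have hmeas (a) : Measurable fun ω => η a ω ^ 2 :=
    (Lp.stronglyMeasurable (η a)).measurable.pow_const 2
  have hsq : (∑ a, fun ω => η a ω ^ 2) =ᵐ[P] fun ω => ∑ i, ξ i ω ^ 2 := by
    have : ∀ᵐ ω ∂P, ∀ a, η a ω = ∑ i, U i a * ξ i ω := by
      rw [ae_all_iff]
      exact fun a => IsGaussianSpace.coeFn_sum_smul Finset.univ (fun i => U i a) ξ
    filter_upwards [this] with ω hω
    simp only [Finset.sum_apply, hω]
    have e (i j) : ∑ a, U i a * U j a = (1 : Matrix ι ι ℝ) i j := by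
      rw [← h2]; simp [Matrix.mul_apply]
    calc ∑ a, (∑ i, U i a * ξ i ω) ^ 2 = ∑ a, ∑ i, ∑ j, U i a * U j a * (ξ i ω * ξ j ω) := by
          refine Finset.sum_congr rfl fun a _ => ?_
          rw [sq, Finset.sum_mul_sum]
          refine Finset.sum_congr rfl fun i _ => Finset.sum_congr rfl fun j _ => by ring
      _ = ∑ i, ∑ j, (∑ a, U i a * U j a) * (ξ i ω * ξ j ω) := by
          rw [Finset.sum_comm]
          refine Finset.sum_congr rfl fun i _ => ?_
          rw [Finset.sum_comm]
          refine Finset.sum_congr rfl fun j _ => by rw [Finset.sum_mul]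
      _ = ∑ i, ξ i ω ^ 2 := by
          refine Finset.sum_congr rfl fun i _ => ?_
          simp [e, Matrix.one_apply, sq]
  -- Both sides are the trace of the Gram matrix; this distributes the centring constant over the
  -- eigenvalues.
  have hsum : ∑ i, ‖ξ i‖ ^ 2 = ∑ a, l a := by
    have e1 : Matrix.trace (Matrix.of (fun i j => ⟪ξ i, ξ j⟫)) = ∑ i, ‖ξ i‖ ^ 2 := by
      simp [Matrix.trace]
    rw [← e1, hA, Matrix.trace_mul_comm, ← Matrix.mul_assoc, h1, one_mul, Matrix.trace_diagonal]
  have hint (a) : Integrable (fun ω => Real.exp (t * η a ω ^ 2)) P ∧ _ :=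
    hG.mgf_sq (hηG a) (t := t) (by rw [hnorm]; exact ht a)
  have hI := hind2.integrable_exp_mul_sum hmeas (s := Finset.univ) fun a _ => (hint a).1
  have hM := hind2.mgf_sum (t := t) hmeas Finset.univ
  have hexp : (fun ω => Real.exp (t * ∑ i, (ξ i ω ^ 2 - ‖ξ i‖ ^ 2))) =ᵐ[P]
      fun ω => Real.exp (-(t * ∑ a, l a)) * Real.exp (t * (∑ a, fun ω => η a ω ^ 2) ω) := by
    filter_upwards [hsq] with ω hω
    rw [hω, Finset.sum_sub_distrib, hsum, ← Real.exp_add]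
    ring_nf
  refine ⟨(hI.const_mul _).congr hexp.symm, ?_⟩
  rw [mgf, integral_congr_ae hexp, integral_const_mul]
  change _ * mgf (∑ a, fun ω => η a ω ^ 2) P t = _
  rw [hM, Finset.prod_mul_distrib, ← Real.exp_sum, Finset.sum_neg_distrib, Finset.mul_sum]
  congr 1
  refine Finset.prod_congr rfl fun a _ => ?_
  rw [(hint a).2, hnorm]

end Gaussian

end WaveQV

namespace WaveQV

/-! ### The first chaos is a Gaussian Hilbert space -/

section FirstChaos

variable {Ω : Type*} [MeasurableSpace Ω] {P : Measure Ω}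

lemma integral_sq_eq_norm_sq (ξ : Lp ℝ 2 P) : ∫ ω, ξ ω ^ 2 ∂P = ‖ξ‖ ^ 2 := by
  rw [← real_inner_self_eq_norm_sq, L2.inner_def]
  exact integral_congr_ae (ae_of_all _ fun ω => by simp [sq])

variable {H T : ℝ} {W : ℝ → ℝ → Ω → ℝ}

lemma IsFractionalWhiteNoise.memLp (hW : IsFractionalWhiteNoise P H T W) {t : ℝ}
    (ht : t ∈ Set.Icc 0 T) (y : ℝ) : MemLp (W t y) 2 P :=
  (hW.gaussian.hasGaussianLaw_eval (⟨t, ht⟩, y)).memLp_two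

/-- The value `W(t, y)` of the noise as an element of `L²`. -/
noncomputable def noiseLp (hW : IsFractionalWhiteNoise P H T W) (p : Set.Icc (0 : ℝ) T × ℝ) :
    Lp ℝ 2 P :=
  (hW.memLp p.1.2 p.2).toLp _

lemma firstChaos_eq (hW : IsFractionalWhiteNoise P H T W) :
    firstChaos P T W = (Submodule.span ℝ (Set.range (noiseLp hW))).topologicalClosure := by
  unfold firstChaos
  congr 2
  ext ξ
  constructor
  · rintro ⟨t, ht, y, h⟩
    exact ⟨(⟨t, ht⟩, y), Lp.ext ((MemLp.coeFn_toLp _).trans h.symm)⟩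
  · rintro ⟨⟨⟨t, ht⟩, y⟩, rfl⟩
    exact ⟨t, ht, y, MemLp.coeFn_toLp _⟩

lemma noiseLp_mem_firstChaos (hW : IsFractionalWhiteNoise P H T W) (p) :
    noiseLp hW p ∈ firstChaos P T W := by
  rw [firstChaos_eq hW]
  exact Submodule.le_topologicalClosure _ (Submodule.subset_span ⟨p, rfl⟩)

lemma map_eq_gaussianReal_of_hasGaussianLaw {ξ : Lp ℝ 2 P} (h : HasGaussianLaw ξ P)
    (h0 : ∫ ω, ξ ω ∂P = 0) : P.map ξ = gaussianReal 0 (‖ξ‖₊ ^ 2) := by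
  rw [h.map_eq_gaussianReal, h0, variance_of_integral_eq_zero h.aemeasurable h0,
    integral_sq_eq_norm_sq]
  congr 1
  ext
  simp

variable [IsProbabilityMeasure P]

lemma tendstoInDistribution_of_tendsto_Lp {ξ : ℕ → Lp ℝ 2 P} {ζ : Lp ℝ 2 P}
    (h : Tendsto ξ atTop (𝓝 ζ)) :
    TendstoInDistribution (fun n => (ξ n : Ω → ℝ)) atTop ζ (fun _ => P) P := by
  have h1 := (Lp.tendsto_Lp_iff_tendsto_eLpNorm' ξ ζ).1 h
  exact (tendstoInMeasure_of_tendsto_eLpNorm (by simp)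
    (fun n => (Lp.aestronglyMeasurable (ξ n))) (Lp.aestronglyMeasurable ζ)
      h1).tendstoInDistribution fun n => (Lp.stronglyMeasurable (ξ n)).measurable.aemeasurable

/-- L² limits converge in law, and the characteristic functions exp(-‖ξ n‖² t²/2) converge because
the norms do. -/
lemma IsGaussianSpace.topologicalClosure {G : Submodule ℝ (Lp ℝ 2 P)} (hG : IsGaussianSpace P G) :
    IsGaussianSpace P G.topologicalClosure := by
  intro ζ hζ
  obtain ⟨ξ, hξ, hlim⟩ := mem_closure_iff_seq_limit.1 hζ
  have hd := (tendstoInDistribution_of_tendsto_Lp hlim).tendsto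
  replace hd := ProbabilityMeasure.tendsto_iff_tendsto_charFun.1 hd
  have : IsProbabilityMeasure (P.map ζ) :=
    Measure.isProbabilityMeasure_map (Lp.stronglyMeasurable ζ).measurable.aemeasurable
  refine Measure.ext_of_charFun (funext fun t => ?_)
  refine tendsto_nhds_unique (hd t) ?_
  simp only [ProbabilityMeasure.coe_mk]
  simp_rw [hG _ (hξ _), charFun_gaussianReal]
  have hn : Tendsto (fun n => (‖ξ n‖ : ℂ)) atTop (𝓝 (‖ζ‖ : ℂ)) :=
    (Complex.continuous_ofReal.tendsto _).comp hlim.norm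
  have hc : Continuous fun z : ℂ => Complex.exp (t * (0 : ℝ) * Complex.I - z ^ 2 * t ^ 2 / 2) := by
    fun_prop
  have := (hc.tendsto _).comp hn
  simpa [Function.comp_def] using this

/-- The first chaos of a fractional-white noise is a Gaussian Hilbert space. -/
theorem isGaussianSpace_firstChaos (hW : IsFractionalWhiteNoise P H T W) :
    IsGaussianSpace P (firstChaos P T W) := by
  rw [firstChaos_eq hW]
  refine IsGaussianSpace.topologicalClosure fun ξ hξ => ?_
  obtain ⟨c, rfl⟩ := Finsupp.mem_span_range_iff_exists_finsupp.1 hξ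
  have hae : (c.sum fun i a => a • noiseLp hW i : Lp ℝ 2 P) =ᵐ[P]
      fun ω => ∑ i ∈ c.support, c i * W i.1 i.2 ω := by
    have h1 := IsGaussianSpace.coeFn_sum_smul (P := P) c.support c (noiseLp hW)
    have h2 : ∀ᵐ ω ∂P, ∀ i ∈ c.support, noiseLp hW i ω = W i.1 i.2 ω := by
      rw [eventually_all_finset]
      exact fun i _ => MemLp.coeFn_toLp (hW.memLp i.1.2 i.2)
    filter_upwards [h1, h2] with ω h1 h2
    rw [Finsupp.sum, h1]
    exact Finset.sum_congr rfl fun i hi => by rw [h2 i hi]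
  refine map_eq_gaussianReal_of_hasGaussianLaw ?_ ?_
  · have hg := (hW.gaussian.smul c).hasGaussianLaw_fun_sum (I := c.support)
    exact hg.congr hae.symm
  · rw [integral_congr_ae hae, integral_finsetSum]
    · refine Finset.sum_eq_zero fun i _ => ?_
      rw [integral_const_mul, hW.centred i.1 i.1.2, mul_zero]
    · exact fun i _ => ((hW.memLp i.1.2 i.2).integrable (by simp)).const_mul _

end FirstChaos

end WaveQV

namespace WaveQV

/-! ### Integrals of the singular kernel |x - y|^(-α) -/

section Kernel

lemma enorm_rpow_neg_of_ne_zero {t : ℝ} (ht : t ≠ 0) (α : ℝ) :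
    ‖t‖ₑ ^ (-α) = ENNReal.ofReal (|t| ^ (-α)) := by
  rw [Real.enorm_eq_ofReal_abs, ENNReal.ofReal_rpow_of_pos (abs_pos.2 ht)]

/-- Only at t = 0 can the two sides differ: the real power is 0 there by convention, while the
extended one is ∞ if α > 0. The extended power is therefore the one used in upper bounds. -/
lemma ofReal_abs_rpow_le (t α : ℝ) (hα : α ≠ 0) :
    ENNReal.ofReal (|t| ^ (-α)) ≤ ‖t‖ₑ ^ (-α) := by
  rcases eq_or_ne t 0 with rfl | ht
  · simp [Real.zero_rpow (neg_ne_zero.2 hα)]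
  · rw [enorm_rpow_neg_of_ne_zero ht]

lemma lintegral_Ioc_enorm_rpow {β r : ℝ} (hβ1 : β < 1) (hr : 0 ≤ r) :
    ∫⁻ t in Set.Ioc 0 r, ‖t‖ₑ ^ (-β) = ENNReal.ofReal (r ^ (1 - β) / (1 - β)) := by
  have h1 : ∫⁻ t in Set.Ioc 0 r, ‖t‖ₑ ^ (-β) = ∫⁻ t in Set.Ioc 0 r, ENNReal.ofReal (t ^ (-β)) := by
    refine setLIntegral_congr_fun measurableSet_Ioc fun t ht => ?_
    rw [enorm_rpow_neg_of_ne_zero ht.1.ne', abs_of_pos ht.1]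
  have hi : IntervalIntegrable (fun t : ℝ => t ^ (-β)) volume 0 r :=
    intervalIntegral.intervalIntegrable_rpow' (by linarith)
  rw [h1, ← ofReal_integral_eq_lintegral_ofReal ((intervalIntegrable_iff_integrableOn_Ioc_of_le hr).1 hi)]
  · rw [← intervalIntegral.integral_of_le hr, integral_rpow (Or.inl (by linarith))]
    rw [Real.zero_rpow (by linarith)]
    congr 1
    ring_nf
  · exact (ae_restrict_iff' measurableSet_Ioc).2 (ae_of_all _ fun t ht => Real.rpow_nonneg ht.1.le _)

lemma lintegral_Icc_enorm_rpow {β r : ℝ} (hβ1 : β < 1) (hr : 0 ≤ r) :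
    ∫⁻ t in Set.Icc (-r) r, ‖t‖ₑ ^ (-β) ≤ ENNReal.ofReal (2 * r ^ (1 - β) / (1 - β)) := by
  have hsub : Set.Icc (-r) r ⊆ (Neg.neg ⁻¹' Set.Ioc 0 r ∪ Set.Ioc 0 r) ∪ {0} := by
    intro t ht
    rcases lt_trichotomy t 0 with h | h | h
    · left; left; simp only [Set.mem_preimage, Set.mem_Ioc]; constructor <;> linarith [ht.1]
    · right; exact h
    · left; right; exact ⟨h, ht.2⟩
  have hneg : ∫⁻ t in (Neg.neg ⁻¹' Set.Ioc 0 r), ‖t‖ₑ ^ (-β) =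
      ∫⁻ t in Set.Ioc 0 r, ‖t‖ₑ ^ (-β) := by
    rw [← (Measure.measurePreserving_neg (volume : Measure ℝ)).setLIntegral_comp_preimage_emb
      (MeasurableEquiv.neg ℝ).measurableEmbedding]
    simp
  calc _ ≤ ∫⁻ t in (Neg.neg ⁻¹' Set.Ioc 0 r ∪ Set.Ioc 0 r) ∪ {0}, ‖t‖ₑ ^ (-β) :=
        lintegral_mono_set hsub
    _ ≤ ((∫⁻ t in Set.Ioc 0 r, ‖t‖ₑ ^ (-β)) + ∫⁻ t in Set.Ioc 0 r, ‖t‖ₑ ^ (-β)) + 0 := by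
        refine (lintegral_union_le _ _ _).trans (add_le_add ?_ (by simp))
        refine (lintegral_union_le _ _ _).trans ?_
        rw [hneg]
    _ = _ := by
        have h0 : 0 ≤ r ^ (1 - β) / (1 - β) := div_nonneg (Real.rpow_nonneg hr _) (by linarith)
        rw [add_zero, lintegral_Ioc_enorm_rpow hβ1 hr, ← ENNReal.ofReal_add h0 h0]
        congr 1; ring

/-- Averaging `|p - q|^(-α)` over an interval containing `x` costs at most a constant factor. -/
lemma exists_lintegral_Ico_enorm_rpow_le {α : ℝ} (h0 : 0 < α) (h1 : α < 1) :
    ∃ C : ℝ, 0 ≤ C ∧ ∀ δ > 0, ∀ a : ℝ, ∀ x ∈ Set.Ico a (a + δ), ∀ q : ℝ,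
      ∫⁻ p in Set.Ico a (a + δ), ‖p - q‖ₑ ^ (-α) ≤
        ENNReal.ofReal (C * δ) * ‖x - q‖ₑ ^ (-α) := by
  have hpos : 0 < 1 - α := by linarith
  set C : ℝ := 2 ^ α + 2 * 3 ^ (1 - α) / (1 - α) * 2 ^ α with hC
  have hC0 : 0 ≤ C := by positivity
  refine ⟨C, hC0, fun δ hδ a x hx q => ?_⟩
  -- If q is far from x, then |p - q| ≥ |x - q|/2 on the whole interval. Otherwise the interval lies
  -- within 3δ of q, where the integral of the power is of order δ · δ^(-α), and |x - q|^(-α) ≥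
  -- (2δ)^(-α). The constant C is the sum of the two constants.
  rcases le_or_gt (2 * δ) |x - q| with h | h
  · have hp : ∀ p ∈ Set.Ico a (a + δ), ‖p - q‖ₑ ^ (-α) ≤
        ENNReal.ofReal (2 ^ α) * ‖x - q‖ₑ ^ (-α) := by
      intro p hp
      have hxq : 0 < |x - q| := by linarith
      have hle : |x - q| / 2 ≤ |p - q| := by
        have h2 : |x - p| ≤ δ := by
          rw [abs_le]; constructor <;> linarith [hx.1, hx.2, hp.1, hp.2]
        have := abs_sub_le x p q
        linarith
      rw [enorm_rpow_neg_of_ne_zero (abs_pos.1 hxq),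
        enorm_rpow_neg_of_ne_zero (abs_pos.1 (by linarith)),
        ← ENNReal.ofReal_mul (by positivity)]
      refine ENNReal.ofReal_le_ofReal ?_
      calc |p - q| ^ (-α) ≤ (|x - q| / 2) ^ (-α) :=
            Real.rpow_le_rpow_of_nonpos (by positivity) hle (by linarith)
        _ = 2 ^ α * |x - q| ^ (-α) := by
            rw [Real.div_rpow hxq.le (by norm_num), Real.rpow_neg (by norm_num : (0:ℝ) ≤ 2)]
            field_simp
    calc _ ≤ ∫⁻ p in Set.Ico a (a + δ), ENNReal.ofReal (2 ^ α) * ‖x - q‖ₑ ^ (-α) :=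
          setLIntegral_mono' measurableSet_Ico hp
      _ = ENNReal.ofReal (2 ^ α * δ) * ‖x - q‖ₑ ^ (-α) := by
          rw [setLIntegral_const, Real.volume_Ico, add_sub_cancel_left,
            ENNReal.ofReal_mul (by positivity)]
          ring
      _ ≤ _ := by
          gcongr
          rw [hC]
          have : 0 ≤ 2 * (3:ℝ) ^ (1 - α) / (1 - α) * 2 ^ α := by positivity
          linarith
  · have hsub : Set.Ico a (a + δ) ⊆ (fun p => p - q) ⁻¹' Set.Icc (-(3 * δ)) (3 * δ) := by
      intro p hp
      have h2 : |p - x| ≤ δ := by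
        rw [abs_le]; constructor <;> linarith [hx.1, hx.2, hp.1, hp.2]
      have := abs_sub_le p x q
      exact abs_le.1 (by linarith)
    have hmul : (2 * δ) ^ (-α) ≤ |x - q| ^ (-α) ∨ x - q = 0 := by
      by_cases h3 : x - q = 0
      · exact Or.inr h3
      · exact Or.inl (Real.rpow_le_rpow_of_nonpos (abs_pos.2 h3) h.le (by linarith))
    have hlow : ENNReal.ofReal ((2 * δ) ^ (-α)) ≤ ‖x - q‖ₑ ^ (-α) := by
      rcases hmul with h3 | h3
      · exact (ENNReal.ofReal_le_ofReal h3).trans (ofReal_abs_rpow_le _ _ h0.ne')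
      · simp [h3, ENNReal.zero_rpow_of_neg (neg_lt_zero.2 h0)]
    calc _ ≤ ∫⁻ p in (fun p => p - q) ⁻¹' Set.Icc (-(3 * δ)) (3 * δ), ‖p - q‖ₑ ^ (-α) :=
          lintegral_mono_set hsub
      _ = ∫⁻ t in Set.Icc (-(3 * δ)) (3 * δ), ‖t‖ₑ ^ (-α) :=
          (measurePreserving_sub_right volume q).setLIntegral_comp_preimage_emb
            (measurableEmbedding_subRight q) (fun t => ‖t‖ₑ ^ (-α)) _
      _ ≤ ENNReal.ofReal (2 * (3 * δ) ^ (1 - α) / (1 - α)) :=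
          lintegral_Icc_enorm_rpow h1 (by positivity)
      _ ≤ ENNReal.ofReal (C * δ * (2 * δ) ^ (-α)) := by
          refine ENNReal.ofReal_le_ofReal ?_
          have e1 : (3 * δ) ^ (1 - α) = 3 ^ (1 - α) * (δ * δ ^ (-α)) := by
            rw [Real.mul_rpow (by norm_num) hδ.le, sub_eq_add_neg 1 α, Real.rpow_add hδ,
              Real.rpow_one]
          have e2 : (2 * δ) ^ (-α) = (2 ^ α)⁻¹ * δ ^ (-α) := by
            rw [Real.mul_rpow (by norm_num) hδ.le, Real.rpow_neg (by norm_num : (0:ℝ) ≤ 2)]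
          rw [e1, e2, hC]
          have h2 : (0:ℝ) < 2 ^ α := by positivity
          have : (2 ^ α + 2 * 3 ^ (1 - α) / (1 - α) * 2 ^ α) * δ * ((2 ^ α)⁻¹ * δ ^ (-α)) =
              δ * δ ^ (-α) + 2 * (3 ^ (1 - α) * (δ * δ ^ (-α))) / (1 - α) := by
            field_simp
          rw [this]
          have : 0 ≤ δ * δ ^ (-α) := by positivity
          linarith
      _ = ENNReal.ofReal (C * δ) * ENNReal.ofReal ((2 * δ) ^ (-α)) :=
          ENNReal.ofReal_mul (by positivity)
      _ ≤ _ := by gcongr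

/-- Lebesgue measure on `[0, 1)`. -/
noncomputable def unitMeasure : Measure ℝ := volume.restrict (Set.Ico 0 1)

instance : IsProbabilityMeasure unitMeasure := ⟨by simp [unitMeasure]⟩

/-- Split at |x - y| = 1: inside, β < 1 gives integrability uniformly in y; outside, the power is at
most 1. -/
lemma exists_lintegral_unitMeasure_enorm_rpow_le {β : ℝ} (h0 : 0 < β) (h1 : β < 1) :
    ∃ C : ℝ≥0∞, C ≠ ∞ ∧ ∀ y : ℝ, ∫⁻ x, ‖x - y‖ₑ ^ (-β) ∂unitMeasure ≤ C := by
  refine ⟨ENNReal.ofReal (2 * 1 ^ (1 - β) / (1 - β)) + 1, by simp, fun y => ?_⟩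
  set S : Set ℝ := (fun p => p - y) ⁻¹' Set.Icc (-1) 1 with hS
  have hSm : MeasurableSet S := (measurable_id.sub_const y) measurableSet_Icc
  rw [← lintegral_add_compl _ hSm]
  gcongr
  · calc _ ≤ ∫⁻ x in S, ‖x - y‖ₑ ^ (-β) :=
          lintegral_mono' (Measure.restrict_mono_measure Measure.restrict_le_self _) le_rfl
      _ = ∫⁻ t in Set.Icc (-1) 1, ‖t‖ₑ ^ (-β) :=
          (measurePreserving_sub_right volume y).setLIntegral_comp_preimage_emb
            (measurableEmbedding_subRight y) (fun t => ‖t‖ₑ ^ (-β)) _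
      _ ≤ _ := lintegral_Icc_enorm_rpow h1 zero_le_one
  · calc _ ≤ ∫⁻ x in Sᶜ, 1 ∂unitMeasure := by
          refine setLIntegral_mono' hSm.compl fun x hx => ?_
          have hx1 : 1 < |x - y| := by
            by_contra! hcon
            exact hx (abs_le.1 hcon)
          have : (1 : ℝ≥0∞) ≤ ‖x - y‖ₑ := by
            rw [Real.enorm_eq_ofReal_abs]
            simpa using hx1.le
          exact ENNReal.rpow_le_one_of_one_le_of_neg this (by linarith)
      _ ≤ 1 := by simpa using prob_le_one

/-- Integration over `Fin (n + 1) → ℝ`, the first coordinate first. -/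
lemma lintegral_pi_succ (μ : Measure ℝ) [SigmaFinite μ] (n : ℕ) {f : (Fin (n + 1) → ℝ) → ℝ≥0∞}
    (hf : Measurable f) :
    ∫⁻ z, f z ∂(Measure.pi fun _ => μ) =
      ∫⁻ z, ∫⁻ x, f (Fin.cons x z) ∂μ ∂(Measure.pi fun _ : Fin n => μ) := by
  have h := (measurePreserving_piFinSuccAbove (fun _ : Fin (n + 1) => μ) 0).symm
  rw [← h.lintegral_comp hf, lintegral_prod_symm]
  · simp [MeasurableEquiv.piFinSuccAbove]
    rfl
  · exact (hf.comp (MeasurableEquiv.measurable _)).aemeasurable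

lemma measurable_uncurry_eval {M : Type*} [MeasurableSpace M] {b : ℝ → ℝ → M}
    (hb : Measurable (Function.uncurry b)) {ι : Type*} (i j : ι) :
    Measurable fun z : ι → ℝ => b (z i) (z j) :=
  hb.comp (f := fun z : ι → ℝ => (z i, z j)) (by fun_prop)

/-- Integrating out the first vertex costs a factor C and leaves a path with one edge fewer. -/
lemma lintegral_path_le (μ : Measure ℝ) [IsProbabilityMeasure μ] {b : ℝ → ℝ → ℝ≥0∞}
    (hb : Measurable (Function.uncurry b)) {C : ℝ≥0∞} (h : ∀ y, ∫⁻ x, b x y ∂μ ≤ C) (n : ℕ) :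
    ∫⁻ z, ∏ i : Fin n, b (z i.castSucc) (z i.succ) ∂(Measure.pi fun _ : Fin (n + 1) => μ) ≤
      C ^ n := by
  induction n with
  | zero => simp
  | succ n ih =>
    rw [lintegral_pi_succ]
    · simp only [Fin.prod_univ_succ (n := n), Fin.castSucc_zero, Fin.cons_zero, Fin.cons_succ,
        ← Fin.succ_castSucc]
      have hm (z : Fin (n + 1) → ℝ) : Measurable fun x => b x (z 0) :=
        hb.comp (measurable_id.prodMk measurable_const)
      simp_rw [fun z : Fin (n + 1) → ℝ => lintegral_mul_const (μ := μ)
        (∏ i : Fin n, b (z i.castSucc) (z i.succ)) (hm z)]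
      calc _ ≤ ∫⁻ z, C * ∏ i : Fin n, b (z i.castSucc) (z i.succ)
              ∂(Measure.pi fun _ : Fin (n + 1) => μ) :=
            lintegral_mono fun z => mul_le_mul_left (h _) _
        _ ≤ _ := by
            rw [lintegral_const_mul, pow_succ']
            · gcongr
            · exact Finset.measurable_fun_prod _ fun i _ => measurable_uncurry_eval hb _ _
    · exact Finset.measurable_fun_prod _ fun i _ => measurable_uncurry_eval hb _ _

lemma prod_finRotate {M : Type*} [CommMonoid M] {n : ℕ} (b : ℝ → ℝ → M) (z : Fin (n + 1) → ℝ) :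
    ∏ i, b (z i) (z (finRotate (n + 1) i)) =
      (∏ i : Fin n, b (z i.castSucc) (z i.succ)) * b (z (Fin.last n)) (z 0) := by
  rw [Fin.prod_univ_castSucc]
  simp

/-- The cyclic integral of a kernel, of which products of two are integrable in the middle
variable, is finite. -/
lemma lintegral_cycle_le (μ : Measure ℝ) [IsProbabilityMeasure μ] {b : ℝ → ℝ → ℝ≥0∞}
    (hb : Measurable (Function.uncurry b)) {C : ℝ≥0∞} (h : ∀ y, ∫⁻ x, b x y ∂μ ≤ C)
    (h2 : ∀ y w, ∫⁻ x, b x y * b w x ∂μ ≤ C) (n : ℕ) :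
    ∫⁻ z, ∏ i, b (z i) (z (finRotate (n + 2) i)) ∂(Measure.pi fun _ : Fin (n + 2) => μ) ≤
      C * C ^ n := by
  simp_rw [prod_finRotate]
  have hbz {k : ℕ} (i j : Fin k) : Measurable fun z : Fin k → ℝ => b (z i) (z j) :=
    measurable_uncurry_eval hb i j
  rw [lintegral_pi_succ]
  · simp only [Fin.prod_univ_succ (n := n), Fin.castSucc_zero, Fin.cons_zero, Fin.cons_succ,
        ← Fin.succ_castSucc, ← Fin.succ_last]
    -- The first vertex occurs only in its two adjacent edges; integrating it out by `h2` opens the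
    -- cycle into a path.
    have e (z : Fin (n + 1) → ℝ) : ∫⁻ x, (b x (z 0) * ∏ i : Fin n, b (z i.castSucc) (z i.succ)) *
        b (z (Fin.last n)) x ∂μ = (∫⁻ x, b x (z 0) * b (z (Fin.last n)) x ∂μ) *
          ∏ i : Fin n, b (z i.castSucc) (z i.succ) := by
      rw [← lintegral_mul_const]
      · exact lintegral_congr fun x => by ring
      · exact (hb.comp (measurable_id.prodMk measurable_const)).mul
          (hb.comp (measurable_const.prodMk measurable_id))
    simp_rw [e]
    calc _ ≤ ∫⁻ z, C * ∏ i : Fin n, b (z i.castSucc) (z i.succ)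
              ∂(Measure.pi fun _ : Fin (n + 1) => μ) :=
          lintegral_mono fun z => mul_le_mul_left (h2 _ _) _
      _ ≤ _ := by
          rw [lintegral_const_mul _ (Finset.measurable_fun_prod _ fun i _ => hbz _ _)]
          gcongr
          exact lintegral_path_le μ hb h n
  · exact (Finset.measurable_fun_prod _ fun i _ => hbz _ _).mul (hbz _ _)

/-- The cyclic integral of `|x - y|^(-α)`, `α < 1/2`, is finite. -/
lemma lintegral_cycle_enorm_rpow_lt_top {α : ℝ} (h0 : 0 < α) (h1 : α < 1 / 2) (n : ℕ) :
    ∫⁻ z, ∏ i, ‖z i - z (finRotate (n + 2) i)‖ₑ ^ (-α)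
      ∂(Measure.pi fun _ : Fin (n + 2) => unitMeasure) < ∞ := by
  obtain ⟨C₁, hC₁, h₁⟩ := exists_lintegral_unitMeasure_enorm_rpow_le h0 (by linarith)
  obtain ⟨C₂, hC₂, h₂⟩ := exists_lintegral_unitMeasure_enorm_rpow_le (β := 2 * α)
    (by linarith) (by linarith)
  have hb : Measurable (Function.uncurry fun x y : ℝ => ‖x - y‖ₑ ^ (-α)) := by
    unfold Function.uncurry; fun_prop
  refine (lintegral_cycle_le unitMeasure hb (C := C₁ + (C₂ + C₂))
    (fun y => (h₁ y).trans le_self_add) (fun y w => ?_) n).trans_lt ?_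
  · refine le_trans ?_ (le_add_self (a := C₂ + C₂))
    have hsq (t : ℝ) : ‖t‖ₑ ^ (-(2 * α)) = ‖t‖ₑ ^ (-α) * ‖t‖ₑ ^ (-α) := by
      rw [← sq, ← ENNReal.rpow_natCast, ← ENNReal.rpow_mul]; congr 1; push_cast; ring
    -- The product of the two edges at x is at most the sum of their squares, whose exponent 2α is
    -- still below 1.
    calc _ ≤ ∫⁻ x, (‖x - y‖ₑ ^ (-(2 * α)) + ‖x - w‖ₑ ^ (-(2 * α))) ∂unitMeasure := by
          refine lintegral_mono fun x => ?_
          rw [hsq, hsq, ← enorm_neg (w - x), neg_sub]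
          rcases le_total (‖x - y‖ₑ ^ (-α)) (‖x - w‖ₑ ^ (-α)) with h | h
          · exact (mul_le_mul_left h _).trans le_add_self
          · exact (mul_le_mul_right h _).trans le_self_add
      _ ≤ _ := by
          rw [lintegral_add_left (by fun_prop)]
          gcongr
          · exact h₂ y
          · exact h₂ w
  · have : C₁ + (C₂ + C₂) < ∞ := by simp [lt_top_iff_ne_top, hC₁, hC₂]
    exact ENNReal.mul_lt_top this (ENNReal.pow_lt_top this)

end Kernel

end WaveQV

namespace WaveQV

/-! ### Cell averages of the covariance density and their limits -/

section Averages

/-- The density of the covariance of the time increments of the solution. -/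
noncomputable def waveCov (H p q : ℝ) : ℝ :=
  H * (2 * H - 1) / 2 * (|p - q| ^ (2 * H - 2) * min p q)

/-- The `i`-th cell `[i/N, (i+1)/N)` of the grid of mesh `1/N`. -/
def gridCell (N i : ℕ) : Set ℝ := Set.Ico ((i : ℝ) / N) (((i : ℝ) + 1) / N)

/-- The covariance of the increments of the solution over two grid cells. -/
noncomputable def cellCov (H : ℝ) (N M i j : ℕ) : ℝ :=
  ∫ w in gridCell N i ×ˢ gridCell M j, waveCov H w.1 w.2

/-- The average of `waveCov` over the product of the grid cells which contain `x` and `y`. -/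
noncomputable def avgCov (H : ℝ) (N M : ℕ) (x y : ℝ) : ℝ :=
  N * M * cellCov H N M ⌊N * x⌋₊ ⌊M * y⌋₊

lemma measurableSet_gridCell (N i : ℕ) : MeasurableSet (gridCell N i) := measurableSet_Ico

lemma gridCell_eq (N i : ℕ) :
    gridCell N i = Set.Ico ((i : ℝ) / N) ((i : ℝ) / N + 1 / N) := by
  rw [gridCell, add_div]

lemma volume_gridCell (N i : ℕ) :
    volume (gridCell N i) = ENNReal.ofReal (1 / N) := by
  rw [gridCell_eq, Real.volume_Ico]; congr 1; ring

lemma mem_gridCell_iff {N : ℕ} (hN : 0 < N) {i : ℕ} {x : ℝ} (hx : 0 ≤ x) :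
    x ∈ gridCell N i ↔ ⌊N * x⌋₊ = i := by
  have hN' : (0 : ℝ) < N := by exact_mod_cast hN
  rw [Nat.floor_eq_iff (by positivity), gridCell, Set.mem_Ico, div_le_iff₀ hN', lt_div_iff₀ hN',
    mul_comm]

lemma floor_lt_of_mem_Ico {N : ℕ} (hN : 0 < N) {x : ℝ} (hx : x ∈ Set.Ico (0 : ℝ) 1) :
    ⌊N * x⌋₊ < N := by
  have hN' : (0 : ℝ) < N := by exact_mod_cast hN
  rw [Nat.floor_lt (mul_nonneg hN'.le hx.1)]
  nlinarith [hx.2]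

lemma gridCell_subset {N i : ℕ} (hi : i < N) : gridCell N i ⊆ Set.Ico 0 1 := by
  have hN' : (0 : ℝ) < N := by exact_mod_cast (by omega : 0 < N)
  intro x hx
  refine ⟨(by positivity : (0 : ℝ) ≤ i / N).trans hx.1, hx.2.trans_le ?_⟩
  rw [div_le_one hN']
  exact_mod_cast hi

@[fun_prop]
lemma measurable_waveCov (H : ℝ) : Measurable fun w : ℝ × ℝ => waveCov H w.1 w.2 := by
  unfold waveCov; fun_prop

lemma waveCov_nonneg {H p q : ℝ} (hH : 1 / 2 < H) (hp : 0 ≤ p) (hq : 0 ≤ q) :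
    0 ≤ waveCov H p q := by
  have := le_min hp hq
  have : 0 ≤ 2 * H - 1 := by linarith
  have : 0 ≤ H := by linarith
  unfold waveCov; positivity

lemma waveCov_pos {H p q : ℝ} (hH : 1 / 2 < H) (hp : 0 < p) (hq : 0 < q) (hpq : p ≠ q) :
    0 < waveCov H p q := by
  have := lt_min hp hq
  have : 0 < 2 * H - 1 := by linarith
  have : 0 < H := by linarith
  have : 0 < |p - q| := abs_pos.2 (sub_ne_zero.2 hpq)
  unfold waveCov; positivity

lemma continuousAt_waveCov (H : ℝ) {x y : ℝ} (h : x ≠ y) :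
    ContinuousAt (fun w : ℝ × ℝ => waveCov H w.1 w.2) (x, y) := by
  unfold waveCov
  have h1 : ContinuousAt (fun w : ℝ × ℝ => |w.1 - w.2| ^ (2 * H - 2)) (x, y) :=
    ContinuousAt.rpow_const (by fun_prop) (Or.inl (abs_pos.2 (sub_ne_zero.2 h)).ne')
  exact continuousAt_const.mul (h1.mul (by fun_prop))

/-- On the unit square both the constant H(2H-1)/2 and the minimum are at most 1, so only the
singular factor matters. -/
lemma enorm_waveCov_le {H p q : ℝ} (hH : 1 / 2 < H) (hH1 : H < 1) (hp : p ∈ Set.Ico (0 : ℝ) 1)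
    (hq : q ∈ Set.Ico (0 : ℝ) 1) : ‖waveCov H p q‖ₑ ≤ ‖p - q‖ₑ ^ (-(2 - 2 * H)) := by
  refine le_trans ?_ (ofReal_abs_rpow_le _ _ (by linarith))
  rw [Real.enorm_eq_ofReal (waveCov_nonneg hH hp.1 hq.1)]
  refine ENNReal.ofReal_le_ofReal ?_
  have e : -(2 - 2 * H) = 2 * H - 2 := by ring
  rw [e, waveCov]
  have h1 : min p q ≤ 1 := (min_le_left _ _).trans hp.2.le
  have h0 : 0 ≤ min p q := le_min hp.1 hq.1
  have h2 : H * (2 * H - 1) / 2 ≤ 1 := by nlinarith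
  have h3 : 0 ≤ |p - q| ^ (2 * H - 2) := by positivity
  have h4 : 0 ≤ H * (2 * H - 1) / 2 := by
    have : 0 ≤ 2 * H - 1 := by linarith
    have : 0 ≤ H := by linarith
    positivity
  calc _ ≤ 1 * (|p - q| ^ (2 * H - 2) * 1) := by gcongr
    _ = _ := by ring

/-- The averages of `waveCov` over grid cells are dominated by a multiple of
`|x - y|^(2H-2)`. -/
lemma exists_enorm_avgCov_le {H : ℝ} (hH : 3 / 4 < H) (hH1 : H < 1) :
    ∃ C : ℝ≥0∞, C ≠ ∞ ∧ ∀ N M : ℕ, ∀ x ∈ Set.Ico (0 : ℝ) 1, ∀ y ∈ Set.Ico (0 : ℝ) 1,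
      ‖avgCov H N M x y‖ₑ ≤ C * ‖x - y‖ₑ ^ (-(2 - 2 * H)) := by
  obtain ⟨C, hC0, hC⟩ := exists_lintegral_Ico_enorm_rpow_le (α := 2 - 2 * H)
    (by linarith) (by linarith)
  refine ⟨ENNReal.ofReal (C * C), ENNReal.ofReal_ne_top, fun N M x hx y hy => ?_⟩
  rcases Nat.eq_zero_or_pos N with rfl | hN
  · simp [avgCov]
  rcases Nat.eq_zero_or_pos M with rfl | hM
  · simp [avgCov]
  have hN' : (0 : ℝ) < N := by exact_mod_cast hN
  have hM' : (0 : ℝ) < M := by exact_mod_cast hM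
  have hxm : x ∈ gridCell N ⌊N * x⌋₊ := (mem_gridCell_iff hN hx.1).2 rfl
  have hym : y ∈ gridCell M ⌊M * y⌋₊ := (mem_gridCell_iff hM hy.1).2 rfl
  have hsx := gridCell_subset (floor_lt_of_mem_Ico hN hx)
  have hsy := gridCell_subset (floor_lt_of_mem_Ico hM hy)
  have key : ‖cellCov H N M ⌊N * x⌋₊ ⌊M * y⌋₊‖ₑ ≤
      ENNReal.ofReal (C * (1 / M)) * (ENNReal.ofReal (C * (1 / N)) *
        ‖x - y‖ₑ ^ (-(2 - 2 * H))) := by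
    -- The variables are averaged one at a time, q to y and then p to x; each costs C times the
    -- mesh, and the factor N M in `avgCov` cancels the two meshes.
    calc _ ≤ ∫⁻ w in gridCell N ⌊N * x⌋₊ ×ˢ gridCell M ⌊M * y⌋₊, ‖waveCov H w.1 w.2‖ₑ :=
          enorm_integral_le_lintegral_enorm _
      _ ≤ ∫⁻ w in gridCell N ⌊N * x⌋₊ ×ˢ gridCell M ⌊M * y⌋₊,
            ‖w.1 - w.2‖ₑ ^ (-(2 - 2 * H)) :=
          setLIntegral_mono' ((measurableSet_gridCell _ _).prod (measurableSet_gridCell _ _))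
            fun w hw => enorm_waveCov_le (by linarith) hH1 (hsx hw.1) (hsy hw.2)
      _ = ∫⁻ p in gridCell N ⌊N * x⌋₊, ∫⁻ q in gridCell M ⌊M * y⌋₊,
            ‖q - p‖ₑ ^ (-(2 - 2 * H)) := by
          rw [Measure.volume_eq_prod, ← Measure.prod_restrict, lintegral_prod _ (by fun_prop)]
          simp_rw [enorm_sub_rev]
      _ ≤ ∫⁻ p in gridCell N ⌊N * x⌋₊, ENNReal.ofReal (C * (1 / M)) *
            ‖y - p‖ₑ ^ (-(2 - 2 * H)) := by
          refine lintegral_mono fun p => ?_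
          rw [gridCell_eq] at hym ⊢
          exact hC (1 / M) (by positivity) _ y hym p
      _ = ENNReal.ofReal (C * (1 / M)) * ∫⁻ p in gridCell N ⌊N * x⌋₊,
            ‖p - y‖ₑ ^ (-(2 - 2 * H)) := by
          rw [lintegral_const_mul _ (by fun_prop)]
          simp_rw [enorm_sub_rev y]
      _ ≤ _ := by
          gcongr
          rw [gridCell_eq] at hxm ⊢
          exact hC (1 / N) (by positivity) _ x hxm y
  have hNM : (0:ℝ) ≤ N * M := by positivity
  rw [avgCov, enorm_mul, Real.enorm_eq_ofReal hNM]
  calc _ ≤ ENNReal.ofReal (N * M) * (ENNReal.ofReal (C * (1 / M)) * (ENNReal.ofReal (C * (1 / N)) *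
        ‖x - y‖ₑ ^ (-(2 - 2 * H)))) := by gcongr
    _ = _ := by
        rw [← mul_assoc, ← mul_assoc, ← ENNReal.ofReal_mul hNM, ← ENNReal.ofReal_mul (by positivity)]
        congr 2
        field_simp

/-- Off the diagonal the averages of `waveCov` over grid cells converge. -/
lemma tendsto_avgCov (H : ℝ) {x y : ℝ} (hx : 0 ≤ x) (hy : 0 ≤ y) (hxy : x ≠ y) :
    Tendsto (fun n : ℕ × ℕ => avgCov H n.1 n.2 x y) (atTop ×ˢ atTop) (𝓝 (waveCov H x y)) := by
  rw [Metric.tendsto_nhds]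
  intro ε hε
  obtain ⟨δ, hδ, hcont⟩ := Metric.continuousAt_iff.1 (continuousAt_waveCov H hxy) (ε / 2)
    (by positivity)
  obtain ⟨N₀, hN₀⟩ := exists_nat_one_div_lt hδ
  have hev : ∀ᶠ n : ℕ × ℕ in atTop ×ˢ atTop, N₀ + 1 ≤ n.1 ∧ N₀ + 1 ≤ n.2 :=
    (eventually_ge_atTop _).prod_mk (eventually_ge_atTop _)
  filter_upwards [hev] with n hn
  obtain ⟨N, M⟩ := n
  simp only at hn ⊢
  have hN : 0 < N := by omega
  have hM : 0 < M := by omega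
  have hN' : (0 : ℝ) < N := by exact_mod_cast hN
  have hM' : (0 : ℝ) < M := by exact_mod_cast hM
  have hxm : x ∈ gridCell N ⌊N * x⌋₊ := (mem_gridCell_iff hN hx).2 rfl
  have hym : y ∈ gridCell M ⌊M * y⌋₊ := (mem_gridCell_iff hM hy).2 rfl
  set S := gridCell N ⌊N * x⌋₊ ×ˢ gridCell M ⌊M * y⌋₊ with hS
  have hSm : MeasurableSet S := (measurableSet_gridCell _ _).prod (measurableSet_gridCell _ _)
  have hvol : volume S = ENNReal.ofReal (1 / N * (1 / M)) := by
    rw [hS, Measure.volume_eq_prod, Measure.prod_prod, volume_gridCell, volume_gridCell,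
      ENNReal.ofReal_mul (by positivity)]
  have small {K : ℕ} (hK : N₀ + 1 ≤ K) {a z : ℝ} {i : ℕ} (ha : a ∈ gridCell K i)
      (hz : z ∈ gridCell K i) : |a - z| < δ := by
    have hK0 : 0 < K := by omega
    have : (1 : ℝ) / K ≤ 1 / (N₀ + 1) := by
      apply one_div_le_one_div_of_le (by positivity); exact_mod_cast hK
    rw [gridCell_eq] at ha hz
    rw [abs_lt]; constructor <;> linarith [ha.1, ha.2, hz.1, hz.2]
  have hclose : ∀ w ∈ S, ‖waveCov H w.1 w.2 - waveCov H x y‖ ≤ ε / 2 := by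
    intro w hw
    have : dist w (x, y) < δ := by
      rw [Prod.dist_eq, max_lt_iff]
      exact ⟨small hn.1 hw.1 hxm, small hn.2 hw.2 hym⟩
    exact (hcont this).le
  have hfin : volume S < ∞ := by rw [hvol]; exact ENNReal.ofReal_lt_top
  have hint : IntegrableOn (fun w : ℝ × ℝ => waveCov H w.1 w.2 - waveCov H x y) S :=
    Measure.integrableOn_of_bounded hfin.ne
      ((measurable_waveCov H).sub_const _).aestronglyMeasurable
      ((ae_restrict_iff' hSm).2 (ae_of_all _ hclose))
  have hb := norm_setIntegral_le_of_norm_le_const hfin hclose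
  have hreal : volume.real S = 1 / N * (1 / M) := by
    rw [Measure.real, hvol, ENNReal.toReal_ofReal (by positivity)]
  have hconst : IntegrableOn (fun _ : ℝ × ℝ => waveCov H x y) S :=
    integrableOn_const hfin.ne
  have hsplit : cellCov H N M ⌊N * x⌋₊ ⌊M * y⌋₊ =
      (∫ w in S, (waveCov H w.1 w.2 - waveCov H x y)) + 1 / N * (1 / M) * waveCov H x y := by
    have h1 : ∫ w in S, waveCov H x y = 1 / N * (1 / M) * waveCov H x y := by
      rw [setIntegral_const, hreal, smul_eq_mul]
    rw [← h1, ← integral_add hint hconst, cellCov]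
    simp [hS]
  have e : avgCov H N M x y - waveCov H x y =
      N * M * ∫ w in S, (waveCov H w.1 w.2 - waveCov H x y) := by
    rw [avgCov, hsplit]; field_simp; ring
  rw [Real.dist_eq, e, abs_mul, abs_of_nonneg (by positivity)]
  rw [hreal, Real.norm_eq_abs] at hb
  calc _ ≤ (N * M : ℝ) * (ε / 2 * (1 / N * (1 / M))) := by gcongr
    _ = ε / 2 := by field_simp
    _ < ε := by linarith

lemma tendsto_avgCov_diag (H : ℝ) {x y : ℝ} (hx : 0 ≤ x) (hy : 0 ≤ y) (hxy : x ≠ y) :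
    Tendsto (fun N : ℕ => avgCov H N N x y) atTop (𝓝 (waveCov H x y)) := by
  have h := tendsto_avgCov H hx hy hxy
  rw [tendsto_def] at h ⊢
  intro s hs
  have h2 : Tendsto (fun N : ℕ => (N, N)) atTop (atTop ×ˢ atTop) := tendsto_id.prodMk tendsto_id
  exact h2 (h s hs)

@[fun_prop]
lemma measurable_avgCov (H : ℝ) (N M : ℕ) :
    Measurable (Function.uncurry fun x y => avgCov H N M x y) := by
  unfold avgCov Function.uncurry
  have : Measurable fun w : ℝ × ℝ => (⌊N * w.1⌋₊, ⌊M * w.2⌋₊) := by fun_prop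
  have h2 : Measurable fun n : ℕ × ℕ => cellCov H N M n.1 n.2 := measurable_of_countable _
  exact (h2.comp this).const_mul _

lemma pi_unitMeasure (m : ℕ) : Measure.pi (fun _ : Fin m => unitMeasure) =
    volume.restrict (Set.univ.pi fun _ : Fin m => Set.Ico (0 : ℝ) 1) := by
  rw [volume_pi, Measure.restrict_pi_pi]; rfl

lemma ae_pi_unitMeasure_mem (m : ℕ) :
    ∀ᵐ z ∂(Measure.pi fun _ : Fin m => unitMeasure), ∀ i, z i ∈ Set.Ico (0 : ℝ) 1 := by
  rw [pi_unitMeasure]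
  filter_upwards [ae_restrict_mem (MeasurableSet.univ_pi fun _ => measurableSet_Ico)] with z hz i
  exact hz i trivial

/-- The diagonal is a proper linear subspace, hence null for Haar measure. -/
lemma ae_pi_unitMeasure_ne {m : ℕ} {i j : Fin m} (hij : i ≠ j) :
    ∀ᵐ z ∂(Measure.pi fun _ : Fin m => unitMeasure), z i ≠ z j := by
  rw [pi_unitMeasure]
  refine ae_restrict_of_ae ?_
  have h := Measure.addHaar_submodule (volume : Measure (Fin m → ℝ))
    (LinearMap.ker (LinearMap.proj (R := ℝ) (φ := fun _ : Fin m => ℝ) i - LinearMap.proj j)) (by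
      intro htop
      have : (Pi.single i 1 : Fin m → ℝ) ∈ LinearMap.ker
          (LinearMap.proj (R := ℝ) (φ := fun _ : Fin m => ℝ) i - LinearMap.proj j) := by
        rw [htop]; trivial
      simp [hij.symm] at this)
  rw [ae_iff]
  convert h using 2
  ext z
  simp [sub_eq_zero]

lemma ae_unitMeasure_prod :
    ∀ᵐ w ∂(unitMeasure.prod unitMeasure), w.1 ∈ Set.Ico (0 : ℝ) 1 ∧ w.2 ∈ Set.Ico (0 : ℝ) 1 ∧
      w.1 ≠ w.2 := by
  have h1 : ∀ᵐ x ∂unitMeasure, x ∈ Set.Ico (0 : ℝ) 1 := ae_restrict_mem measurableSet_Ico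
  have hd : MeasurableSet {w : ℝ × ℝ | w.1 = w.2} :=
    measurableSet_eq_fun measurable_fst measurable_snd
  have h3 : ∀ᵐ w ∂(unitMeasure.prod unitMeasure), w.1 ≠ w.2 := by
    rw [ae_iff]
    simp only [ne_eq, not_not]
    rw [Measure.measure_prod_null hd]
    refine ae_of_all _ fun x => ?_
    have : Prod.mk x ⁻¹' {w : ℝ × ℝ | w.1 = w.2} = {x} := by ext; simp [eq_comm]
    simp only [this]
    exact (Measure.absolutelyContinuous_of_le Measure.restrict_le_self) (by simp)
  filter_upwards [h3, Measure.quasiMeasurePreserving_fst.ae h1,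
    Measure.quasiMeasurePreserving_snd.ae h1] with w a b c
  exact ⟨b, c, a⟩

lemma norm_le_toReal_of_enorm_le {a : ℝ} {b : ℝ≥0∞} (h : ‖a‖ₑ ≤ b) (hb : b ≠ ∞) :
    ‖a‖ ≤ b.toReal := by
  rw [← toReal_enorm]; exact ENNReal.toReal_mono hb h

lemma enorm_rpow_neg_ne_top {t : ℝ} (ht : t ≠ 0) (α : ℝ) : ‖t‖ₑ ^ (-α) ≠ ∞ := by
  rw [enorm_rpow_neg_of_ne_zero ht]; exact ENNReal.ofReal_ne_top

lemma enorm_finset_prod {ι : Type*} (s : Finset ι) (f : ι → ℝ) :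
    ‖∏ i ∈ s, f i‖ₑ = ∏ i ∈ s, ‖f i‖ₑ := by
  classical
  induction s using Finset.induction_on with
  | empty => simp
  | insert i s hi ih => rw [Finset.prod_insert hi, Finset.prod_insert hi, enorm_mul, ih]

/-- Convergence of the cyclic integrals of the averages. -/
lemma tendsto_integral_cycle {H : ℝ} (hH : 3 / 4 < H) (hH1 : H < 1) (n : ℕ) :
    Integrable (fun z => ∏ i, waveCov H (z i) (z (finRotate (n + 2) i)))
        (Measure.pi fun _ : Fin (n + 2) => unitMeasure) ∧
      Tendsto (fun N : ℕ => ∫ z, ∏ i, avgCov H N N (z i) (z (finRotate (n + 2) i))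
        ∂(Measure.pi fun _ : Fin (n + 2) => unitMeasure)) atTop
        (𝓝 (∫ z, ∏ i, waveCov H (z i) (z (finRotate (n + 2) i))
          ∂(Measure.pi fun _ : Fin (n + 2) => unitMeasure))) := by
  obtain ⟨C, hC, hbound⟩ := exists_enorm_avgCov_le hH hH1
  -- The condition 2 - 2H < 1/2 is H > 3/4. Up to a constant factor this cyclic product dominates
  -- the integrands for every N.
  have hfin := lintegral_cycle_enorm_rpow_lt_top (α := 2 - 2 * H) (by linarith) (by linarith) n
  -- With n + 2 ≥ 2 vertices the rotation has no fixed point, so these are genuine diagonals.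
  have hne : ∀ᵐ z ∂(Measure.pi fun _ : Fin (n + 2) => unitMeasure), ∀ i,
      z i ≠ z (finRotate (n + 2) i) :=
    ae_all_iff.2 fun i => ae_pi_unitMeasure_ne (by simp)
  have hm (D : ℝ≥0∞) : Measurable fun z : Fin (n + 2) → ℝ =>
      ∏ i, (D * ‖z i - z (finRotate (n + 2) i)‖ₑ ^ (-(2 - 2 * H))) := by fun_prop
  have hint (D : ℝ≥0∞) (hD : D ≠ ∞) : Integrable (fun z : Fin (n + 2) → ℝ =>
      (∏ i, (D * ‖z i - z (finRotate (n + 2) i)‖ₑ ^ (-(2 - 2 * H)))).toReal)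
      (Measure.pi fun _ : Fin (n + 2) => unitMeasure) := by
    refine integrable_toReal_of_lintegral_ne_top (hm D).aemeasurable ?_
    simp_rw [Finset.prod_mul_distrib, Finset.prod_const]
    rw [lintegral_const_mul _ (by fun_prop)]
    exact ENNReal.mul_ne_top (ENNReal.pow_ne_top hD) hfin.ne
  have hnt (D : ℝ≥0∞) (hD : D ≠ ∞) (z : Fin (n + 2) → ℝ)
      (hz : ∀ i, z i ≠ z (finRotate (n + 2) i)) :
      ∏ i, (D * ‖z i - z (finRotate (n + 2) i)‖ₑ ^ (-(2 - 2 * H))) ≠ ∞ :=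
    ENNReal.prod_ne_top fun i _ =>
      ENNReal.mul_ne_top hD (enorm_rpow_neg_ne_top (sub_ne_zero.2 (hz i)) _)
  have hmK : Measurable (Function.uncurry fun x y => waveCov H x y) := measurable_waveCov H
  constructor
  · refine (hint 1 (by simp)).mono' (Finset.measurable_fun_prod _ fun i _ =>
      measurable_uncurry_eval hmK _ _).aestronglyMeasurable ?_
    filter_upwards [hne, ae_pi_unitMeasure_mem (n + 2)] with z hz hz1
    refine norm_le_toReal_of_enorm_le ?_ (hnt 1 (by simp) z hz)
    rw [enorm_finset_prod]
    refine Finset.prod_le_prod' fun i _ => ?_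
    rw [one_mul]
    exact enorm_waveCov_le (by linarith) hH1 (hz1 _) (hz1 _)
  · refine tendsto_integral_of_dominated_convergence _ (fun N => ?_) (hint C hC) (fun N => ?_) ?_
    · exact (Finset.measurable_fun_prod _ fun i _ =>
        measurable_uncurry_eval (measurable_avgCov H N N) _ _).aestronglyMeasurable
    · filter_upwards [hne, ae_pi_unitMeasure_mem (n + 2)] with z hz hz1
      refine norm_le_toReal_of_enorm_le ?_ (hnt C hC z hz)
      rw [enorm_finset_prod]
      exact Finset.prod_le_prod' fun i _ => hbound N N _ (hz1 _) _ (hz1 _)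
    · filter_upwards [hne, ae_pi_unitMeasure_mem (n + 2)] with z hz hz1
      exact tendsto_finsetProd _ fun i _ =>
        tendsto_avgCov_diag H (hz1 i).1 (hz1 (finRotate (n + 2) i)).1 (hz i)

lemma lintegral_prod_enorm_rpow_lt_top {β : ℝ} (h0 : 0 < β) (h1 : β < 1) :
    ∫⁻ w, ‖w.1 - w.2‖ₑ ^ (-β) ∂(unitMeasure.prod unitMeasure) < ∞ := by
  obtain ⟨C, hC, h⟩ := exists_lintegral_unitMeasure_enorm_rpow_le h0 h1
  rw [lintegral_prod_symm _ (by fun_prop)]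
  exact (lintegral_mono h).trans_lt (by simpa using hC.lt_top)

/-- Convergence of the `L²` norms of the averages, for two independent grids. -/
lemma tendsto_integral_avgCov_sq {H : ℝ} (hH : 3 / 4 < H) (hH1 : H < 1) :
    Integrable (fun w : ℝ × ℝ => waveCov H w.1 w.2 ^ 2) (unitMeasure.prod unitMeasure) ∧
      (∀ N M, Integrable (fun w : ℝ × ℝ => avgCov H N M w.1 w.2 ^ 2)
        (unitMeasure.prod unitMeasure)) ∧
      Tendsto (fun n : ℕ × ℕ => ∫ w, avgCov H n.1 n.2 w.1 w.2 ^ 2 ∂(unitMeasure.prod unitMeasure))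
        (atTop ×ˢ atTop)
        (𝓝 (∫ w, waveCov H w.1 w.2 ^ 2 ∂(unitMeasure.prod unitMeasure))) := by
  obtain ⟨C, hC, hbound⟩ := exists_enorm_avgCov_le hH hH1
  -- Square integrability of the singularity, 2(2 - 2H) < 1, is again H > 3/4.
  have hfin := lintegral_prod_enorm_rpow_lt_top (β := 2 * (2 - 2 * H)) (by linarith) (by linarith)
  have hsq (t : ℝ) : (‖t‖ₑ ^ (-(2 - 2 * H))) ^ 2 = ‖t‖ₑ ^ (-(2 * (2 - 2 * H))) := by
    rw [← ENNReal.rpow_natCast, ← ENNReal.rpow_mul]; congr 1; push_cast; ring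
  have hint (D : ℝ≥0∞) (hD : D ≠ ∞) : Integrable (fun w : ℝ × ℝ =>
      ((D * ‖w.1 - w.2‖ₑ ^ (-(2 - 2 * H))) ^ 2).toReal) (unitMeasure.prod unitMeasure) := by
    refine integrable_toReal_of_lintegral_ne_top (by fun_prop) ?_
    simp_rw [mul_pow, hsq]
    rw [lintegral_const_mul _ (by fun_prop)]
    exact ENNReal.mul_ne_top (ENNReal.pow_ne_top hD) hfin.ne
  have hnt (D : ℝ≥0∞) (hD : D ≠ ∞) {x y : ℝ} (h : x ≠ y) :
      (D * ‖x - y‖ₑ ^ (-(2 - 2 * H))) ^ 2 ≠ ∞ :=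
    ENNReal.pow_ne_top (ENNReal.mul_ne_top hD (enorm_rpow_neg_ne_top (sub_ne_zero.2 h) _))
  have hle (n : ℕ × ℕ) : ∀ᵐ w ∂(unitMeasure.prod unitMeasure), ‖avgCov H n.1 n.2 w.1 w.2 ^ 2‖ ≤
      ((C * ‖w.1 - w.2‖ₑ ^ (-(2 - 2 * H))) ^ 2).toReal := by
    filter_upwards [ae_unitMeasure_prod] with w hw
    refine norm_le_toReal_of_enorm_le ?_ (hnt C hC hw.2.2)
    rw [enorm_pow]
    gcongr
    exact hbound _ _ _ hw.1 _ hw.2.1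
  have hm (n : ℕ × ℕ) : AEStronglyMeasurable (fun w : ℝ × ℝ => avgCov H n.1 n.2 w.1 w.2 ^ 2)
      (unitMeasure.prod unitMeasure) :=
    ((measurable_avgCov H n.1 n.2).pow_const 2).aestronglyMeasurable
  refine ⟨?_, fun N M => (hint C hC).mono' (hm (N, M)) (hle (N, M)), ?_⟩
  · refine (hint 1 (by simp)).mono' ((measurable_waveCov H).pow_const 2).aestronglyMeasurable ?_
    filter_upwards [ae_unitMeasure_prod] with w hw
    refine norm_le_toReal_of_enorm_le ?_ (hnt 1 (by simp) hw.2.2)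
    rw [enorm_pow, one_mul]
    gcongr
    exact enorm_waveCov_le (by linarith) hH1 hw.1 hw.2.1
  · refine tendsto_integral_filter_of_dominated_convergence _ (Eventually.of_forall hm)
      (Eventually.of_forall hle) (hint C hC) ?_
    filter_upwards [ae_unitMeasure_prod] with w hw
    exact (tendsto_avgCov H hw.1.1 hw.2.1.1 hw.2.2).pow 2

end Averages

end WaveQV

namespace WaveQV

/-! ### Power sums of eigenvalues as cyclic integrals -/

section Trace

lemma step_ae_eq {N : ℕ} (hN : 0 < N) (f : ℕ → ℝ) :
    (fun x : ℝ => f ⌊N * x⌋₊) =ᵐ[unitMeasure]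
      fun x => ∑ i ∈ Finset.range N, (gridCell N i).indicator (fun _ => f i) x := by
  filter_upwards [ae_restrict_mem measurableSet_Ico] with x hx
  have h (i) : (gridCell N i).indicator (fun _ => f i) x = if ⌊N * x⌋₊ = i then f i else 0 := by
    classical
    rw [Set.indicator_apply]
    exact if_congr (mem_gridCell_iff hN hx.1) rfl rfl
  rw [Finset.sum_congr rfl fun i _ => h i, Finset.sum_ite_eq, if_pos (Finset.mem_range.2 (floor_lt_of_mem_Ico hN hx))]

lemma integrable_step {N : ℕ} (hN : 0 < N) (f : ℕ → ℝ) :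
    Integrable (fun x : ℝ => f ⌊N * x⌋₊) unitMeasure := by
  refine Integrable.congr ?_ (step_ae_eq hN f).symm
  exact integrable_finsetSum _ fun i _ =>
    (integrable_const _).indicator (measurableSet_gridCell N i)

lemma integral_step {N : ℕ} (hN : 0 < N) (f : ℕ → ℝ) :
    ∫ x, f ⌊N * x⌋₊ ∂unitMeasure = (1 / N : ℝ) * ∑ i ∈ Finset.range N, f i := by
  rw [integral_congr_ae (step_ae_eq hN f), integral_finsetSum _ fun i _ =>
    (integrable_const _).indicator (measurableSet_gridCell N i), Finset.mul_sum]
  refine Finset.sum_congr rfl fun i hi => ?_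
  rw [integral_indicator_const _ (measurableSet_gridCell N i), smul_eq_mul, Measure.real,
    unitMeasure, Measure.restrict_apply (measurableSet_gridCell N i),
    Set.inter_eq_self_of_subset_left (gridCell_subset (Finset.mem_range.1 hi)),
    volume_gridCell, ENNReal.toReal_ofReal (by positivity)]

/-- The integrand is constant on products of cells, which have area 1/(NM); the square of the
normalisation NM leaves one factor NM. -/
lemma integral_avgCov_sq {H : ℝ} {N M : ℕ} (hN : 0 < N) (hM : 0 < M)
    (hint : Integrable (fun w : ℝ × ℝ => avgCov H N M w.1 w.2 ^ 2) (unitMeasure.prod unitMeasure)) :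
    ∫ w, avgCov H N M w.1 w.2 ^ 2 ∂(unitMeasure.prod unitMeasure) =
      N * M * ∑ i ∈ Finset.range N, ∑ j ∈ Finset.range M, cellCov H N M i j ^ 2 := by
  have hN' : (N : ℝ) ≠ 0 := by positivity
  have hM' : (M : ℝ) ≠ 0 := by positivity
  rw [integral_prod _ hint]
  simp only [avgCov]
  have h1 (x : ℝ) := integral_step hM fun j => (N * M * cellCov H N M ⌊N * x⌋₊ j : ℝ) ^ 2
  simp_rw [h1]
  rw [integral_step hN fun i =>
    (1 / M : ℝ) * ∑ j ∈ Finset.range M, (N * M * cellCov H N M i j : ℝ) ^ 2]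
  simp only [Finset.mul_sum]
  refine Finset.sum_congr rfl fun i _ => Finset.sum_congr rfl fun j _ => ?_
  field_simp

lemma eq_const_of_finRotate {α : Type*} {n : ℕ} {s : Fin (n + 1) → α}
    (h : ∀ i, s i = s (finRotate (n + 1) i)) (i : Fin (n + 1)) : s i = s 0 := by
  induction i using Fin.induction with
  | zero => rfl
  | succ i ih =>
    rw [← ih, h i.castSucc]
    simp

/-- The cyclic integral of a kernel of finite rank, given in terms of an orthonormal family. -/
lemma integral_cycle_finite_rank {ι : Type*} [Fintype ι] [DecidableEq ι] (μ : Measure ℝ)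
    [IsProbabilityMeasure μ] (c : ι → ℝ) (e : ι → ℝ → ℝ)
    (hint : ∀ a b, Integrable (fun x => e a x * e b x) μ)
    (ho : ∀ a b, ∫ x, e a x * e b x ∂μ = if a = b then 1 else 0) (n : ℕ) :
    ∫ z, ∏ i, ∑ a, c a * (e a (z i) * e a (z (finRotate (n + 1) i)))
      ∂(Measure.pi fun _ : Fin (n + 1) => μ) = ∑ a, c a ^ (n + 1) := by
  set σ := finRotate (n + 1) with hσ
  -- After expansion the second factor of each edge is moved to the vertex where it is evaluated, so
  -- that vertex j carries the functions of its two adjacent edges.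
  have hexp (z : Fin (n + 1) → ℝ) : ∏ i, ∑ a, c a * (e a (z i) * e a (z (σ i))) =
      ∑ s : Fin (n + 1) → ι, (∏ i, c (s i)) * ∏ j, (e (s j) (z j) * e (s (σ.symm j)) (z j)) := by
    rw [Finset.prod_univ_sum, Fintype.piFinset_univ]
    refine Finset.sum_congr rfl fun s _ => ?_
    rw [Finset.prod_mul_distrib, Finset.prod_mul_distrib, Finset.prod_mul_distrib]
    congr 2
    rw [← Equiv.prod_comp σ fun j => e (s (σ.symm j)) (z j)]
    simp
  have hi (s : Fin (n + 1) → ι) : Integrable (fun z : Fin (n + 1) → ℝ =>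
      (∏ i, c (s i)) * ∏ j, (e (s j) (z j) * e (s (σ.symm j)) (z j)))
      (Measure.pi fun _ : Fin (n + 1) => μ) :=
    (Integrable.fintype_prod (f := fun j x => e (s j) x * e (s (σ.symm j)) x)
      fun j => hint _ _).const_mul _
  simp_rw [hexp]
  rw [integral_finsetSum _ fun s _ => hi s]
  have hval (s : Fin (n + 1) → ι) : ∫ z, (∏ i, c (s i)) *
      ∏ j, (e (s j) (z j) * e (s (σ.symm j)) (z j)) ∂(Measure.pi fun _ : Fin (n + 1) => μ) =
      (∏ i, c (s i)) * ∏ j, if s j = s (σ.symm j) then 1 else 0 := by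
    rw [integral_const_mul, integral_fintype_prod_eq_prod
      (f := fun j x => e (s j) x * e (s (σ.symm j)) x)]
    simp_rw [ho]
  simp_rw [hval]
  -- By orthonormality an assignment of indices to edges contributes only if adjacent edges agree,
  -- that is, if it is constant around the cycle.
  rw [← Finset.sum_subset (Finset.subset_univ (Finset.univ.image fun a (_ : Fin (n + 1)) => a))]
  · rw [Finset.sum_image fun a _ b _ hab => congrFun hab 0]
    simp
  · intro s _ hs
    rw [mul_eq_zero]
    right
    rw [Finset.prod_eq_zero_iff]
    by_contra! hcon
    apply hs
    rw [Finset.mem_image]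
    refine ⟨s 0, Finset.mem_univ _, funext fun i => (eq_const_of_finRotate (fun i => ?_) i).symm⟩
    by_contra hne
    apply hcon (σ i) (Finset.mem_univ _)
    rw [if_neg]
    rw [Equiv.symm_apply_apply]
    exact fun h => hne h.symm

/-- The power sums of the eigenvalues of the covariance matrix of the increments are cyclic
integrals. -/
lemma sum_eigenvalues_pow {H : ℝ} {N : ℕ} (hN : 0 < N) {U : Matrix (Fin N) (Fin N) ℝ}
    {l : Fin N → ℝ} (h1 : U.transpose * U = 1)
    (hA : Matrix.of (fun i j : Fin N => cellCov H N N i j) =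
      U * Matrix.diagonal l * U.transpose) (n : ℕ) :
    ∑ a, (N * l a) ^ (n + 1) =
      ∫ z, ∏ i, avgCov H N N (z i) (z (finRotate (n + 1) i))
        ∂(Measure.pi fun _ : Fin (n + 1) => unitMeasure) := by
  have hN' : (0 : ℝ) < N := by exact_mod_cast hN
  -- The columns of U, spread over the cells as step functions and scaled by √N, are orthonormal on
  -- [0, 1), and there `avgCov` is the sum of (N l_a) e_a(x) e_a(y). The value 0 for i ≥ N is never
  -- met on [0, 1).
  set V : Fin N → ℕ → ℝ := fun a i => if h : i < N then U ⟨i, h⟩ a else 0 with hV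
  set e : Fin N → ℝ → ℝ := fun a x => √N * V a ⌊N * x⌋₊ with he
  have hprod (a b : Fin N) (x : ℝ) : e a x * e b x = (fun i => N * (V a i * V b i)) ⌊N * x⌋₊ := by
    have := Real.mul_self_sqrt hN'.le
    simp only [he]
    linear_combination V a ⌊N * x⌋₊ * V b ⌊N * x⌋₊ * this
  rw [← integral_cycle_finite_rank unitMeasure (fun a => N * l a) e]
  · refine integral_congr_ae ?_
    filter_upwards [ae_pi_unitMeasure_mem (n + 1)] with z hz
    refine Finset.prod_congr rfl fun i _ => ?_
    have hi := floor_lt_of_mem_Ico hN (hz i)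
    have hj := floor_lt_of_mem_Ico hN (hz (finRotate (n + 1) i))
    have h := congrFun (congrFun hA ⟨_, hi⟩) ⟨_, hj⟩
    rw [Matrix.of_apply, Matrix.mul_apply] at h
    simp only [Matrix.mul_diagonal, Matrix.transpose_apply] at h
    have := Real.mul_self_sqrt hN'.le
    rw [avgCov, h, Finset.mul_sum]
    refine Finset.sum_congr rfl fun a _ => ?_
    simp only [he, hV, hi, hj, dif_pos]
    linear_combination (N * l a * U ⟨_, hi⟩ a * U ⟨_, hj⟩ a) * this
  · intro a b
    simp_rw [hprod]
    exact integrable_step hN fun i => N * (V a i * V b i)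
  · intro a b
    simp_rw [hprod]
    rw [integral_step hN fun i => N * (V a i * V b i), ← Finset.mul_sum, ← mul_assoc, one_div, inv_mul_cancel₀ hN'.ne', one_mul,
      ← Fin.sum_univ_eq_sum_range (fun i => V a i * V b i) N]
    have := congrFun (congrFun h1 a) b
    simpa [hV, Matrix.mul_apply, Matrix.one_apply] using this

end Trace

end WaveQV

namespace WaveQV

/-! ### Positive definiteness of the noise kernel and Cauchy-Schwarz -/

section Energy

/-- The indicator of the interval `(z, z + l)`, where `θ = (l, z)`. -/
noncomputable def intervalIndicator (θ : ℝ × ℝ) (s : ℝ) : ℝ≥0∞ :=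
  if θ.2 < s ∧ s < θ.2 + θ.1 then 1 else 0

@[fun_prop]
lemma measurable_intervalIndicator :
    Measurable (Function.uncurry intervalIndicator) := by
  have h1 : MeasurableSet {w : (ℝ × ℝ) × ℝ | w.1.2 < w.2} :=
    measurableSet_lt (by fun_prop) (by fun_prop)
  have h2 : MeasurableSet {w : (ℝ × ℝ) × ℝ | w.2 < w.1.2 + w.1.1} :=
    measurableSet_lt (by fun_prop) (by fun_prop)
  exact Measurable.ite (h1.inter h2) measurable_const measurable_const

/-- The measure `l^(-α-2) dl dz` on `(0, ∞) × ℝ`. -/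
noncomputable def intervalMeasure (α : ℝ) : Measure (ℝ × ℝ) :=
  ((volume.restrict (Set.Ioi 0)).withDensity fun l => ENNReal.ofReal (l ^ (-α - 2))).prod volume

instance (α : ℝ) : SFinite (intervalMeasure α) := by unfold intervalMeasure; infer_instance

/-- For fixed length l the left endpoints of intervals containing both s and r fill length max(l -
|s - r|, 0); integrating this against l^(-α-2) gives the kernel. The kernel is thus a superposition
of products f(s) f(r), which makes its positivity visible. -/
lemma lintegral_intervalIndicator {α : ℝ} (h0 : 0 < α) {s r : ℝ} (hsr : s ≠ r) :
    ∫⁻ θ, intervalIndicator θ s * intervalIndicator θ r ∂(intervalMeasure α) =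
      ENNReal.ofReal (|s - r| ^ (-α) / (α * (α + 1))) := by
  have hd : 0 < |s - r| := abs_pos.2 (sub_ne_zero.2 hsr)
  have hm (t : ℝ) : Measurable fun θ => intervalIndicator θ t :=
    measurable_intervalIndicator.comp (measurable_id.prodMk measurable_const)
  have hms : Measurable fun θ => intervalIndicator θ s * intervalIndicator θ r :=
    (hm s).mul (hm r)
  rw [intervalMeasure, lintegral_prod _ hms.aemeasurable]
  have hin (l : ℝ) : ∫⁻ z, intervalIndicator (l, z) s * intervalIndicator (l, z) r =
      ENNReal.ofReal (l - |s - r|) := by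
    have e (z : ℝ) : intervalIndicator (l, z) s * intervalIndicator (l, z) r =
        (Set.Ioo (max s r - l) (min s r)).indicator 1 z := by
      simp only [intervalIndicator, Set.indicator_apply, Set.mem_Ioo, sub_lt_iff_lt_add,
        max_lt_iff, lt_min_iff, Pi.one_apply]
      split_ifs <;> first | (simp; done) | (exfalso; tauto)
    simp_rw [e]
    rw [lintegral_indicator_one measurableSet_Ioo, Real.volume_Ioo]
    congr 1
    rcases le_total s r with h | h
    · rw [max_eq_right h, min_eq_left h, abs_of_nonpos (by linarith)]; ring
    · rw [max_eq_left h, min_eq_right h, abs_of_nonneg (by linarith)]; ring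
  simp_rw [hin]
  rw [lintegral_withDensity_eq_lintegral_mul _ (by fun_prop) (by fun_prop)]
  simp only [Pi.mul_apply]
  set d := |s - r| with hdd
  have h1 : ∫⁻ l in Set.Ioi 0, ENNReal.ofReal (l ^ (-α - 2)) * ENNReal.ofReal (l - d) =
      ∫⁻ l in Set.Ioi d, ENNReal.ofReal (l ^ (-α - 1) - d * l ^ (-α - 2)) := by
    rw [← lintegral_indicator measurableSet_Ioi, ← lintegral_indicator measurableSet_Ioi]
    refine lintegral_congr fun l => ?_
    simp only [Set.indicator_apply, Set.mem_Ioi]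
    by_cases h : d < l
    · have hl : 0 < l := hd.trans h
      rw [if_pos hl, if_pos h, ← ENNReal.ofReal_mul (by positivity)]
      congr 1
      have : l ^ (-α - 1) = l ^ (-α - 2) * l := by
        rw [← Real.rpow_add_one hl.ne']; congr 1; ring
      rw [this]; ring
    · rw [if_neg h, ENNReal.ofReal_of_nonpos (p := l - d) (by linarith), mul_zero, ite_self]
  have i1 : IntegrableOn (fun l : ℝ => l ^ (-α - 1)) (Set.Ioi d) :=
    integrableOn_Ioi_rpow_of_lt (by linarith) hd
  have i2 : IntegrableOn (fun l : ℝ => l ^ (-α - 2)) (Set.Ioi d) :=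
    integrableOn_Ioi_rpow_of_lt (by linarith) hd
  have i3 : IntegrableOn (fun l : ℝ => l ^ (-α - 1) - d * l ^ (-α - 2)) (Set.Ioi d) :=
    i1.sub (i2.const_mul d)
  rw [h1, ← ofReal_integral_eq_lintegral_ofReal i3]
  · congr 1
    rw [integral_sub i1 (i2.const_mul d), integral_const_mul,
      integral_Ioi_rpow_of_lt (by linarith) hd, integral_Ioi_rpow_of_lt (by linarith) hd]
    have e1 : -α - 1 + 1 = -α := by ring
    have e2 : -α - 2 + 1 = -α - 1 := by ring
    rw [e1, e2, Real.rpow_sub_one hd.ne']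
    have : -α - 1 ≠ 0 := by linarith
    have : α + 1 ≠ 0 := by linarith
    field_simp
    ring
  · refine (ae_restrict_iff' measurableSet_Ioi).2 (ae_of_all _ fun l (hl : d < l) => ?_)
    have hl0 : 0 < l := hd.trans hl
    have : l ^ (-α - 1) = l ^ (-α - 2) * l := by
      rw [← Real.rpow_add_one hl0.ne']; congr 1; ring
    have h3 : 0 ≤ l ^ (-α - 2) := by positivity
    simp only [Pi.zero_apply]
    rw [this]
    nlinarith

/-- Tonelli: a kernel factored through an auxiliary space turns the double integral into a pairing
on that space. -/
lemma lintegral_lintegral_lintegral_mul {A B : Type*} [MeasurableSpace A] [MeasurableSpace B]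
    {τ : Measure A} {ζ : Measure B} [SFinite τ] [SFinite ζ] {F G : A → B → ℝ≥0∞}
    (hF : Measurable (Function.uncurry F)) (hG : Measurable (Function.uncurry G)) :
    ∫⁻ s, ∫⁻ r, ∫⁻ b, F s b * G r b ∂ζ ∂τ ∂τ = ∫⁻ b, (∫⁻ s, F s b ∂τ) * ∫⁻ r, G r b ∂τ ∂ζ := by
  have hF1 (s) : Measurable (F s) := hF.comp measurable_prodMk_left
  have hG1 (b) : Measurable fun r => G r b := hG.comp (measurable_id.prodMk measurable_const)
  have hF2 (b) : Measurable fun r => F r b := hF.comp (measurable_id.prodMk measurable_const)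
  have hGi : Measurable fun b => ∫⁻ r, G r b ∂τ := hG.lintegral_prod_left'
  have h1 (s) : ∫⁻ r, ∫⁻ b, F s b * G r b ∂ζ ∂τ = ∫⁻ b, F s b * ∫⁻ r, G r b ∂τ ∂ζ := by
    rw [lintegral_lintegral_swap]
    · exact lintegral_congr fun b => lintegral_const_mul _ (hG1 b)
    · exact (((hF1 s).comp measurable_snd).mul hG).aemeasurable
  simp_rw [h1]
  rw [lintegral_lintegral_swap]
  · exact lintegral_congr fun b => lintegral_mul_const _ (hF2 b)
  · exact (hF.mul (hGi.comp measurable_snd)).aemeasurable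

/-- The measure `|s - r|^(2H-2) ds dr dy` on `[0, T] × [0, T] × ℝ`. -/
noncomputable def energyMeasure (H T : ℝ) : Measure (ℝ × ℝ × ℝ) :=
  ((volume.restrict (Set.Icc 0 T)).prod ((volume.restrict (Set.Icc 0 T)).prod volume)).withDensity
    fun w => ENNReal.ofReal (|w.1 - w.2.1| ^ (2 * H - 2))

lemma lintegral_energyMeasure (H T : ℝ) {F : ℝ × ℝ × ℝ → ℝ≥0∞} (hF : Measurable F) :
    ∫⁻ w, F w ∂(energyMeasure H T) = ∫⁻ s in Set.Icc 0 T, ∫⁻ r in Set.Icc 0 T, ∫⁻ y,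
      F (s, r, y) * ENNReal.ofReal (|s - r| ^ (2 * H - 2)) := by
  have hm : Measurable fun w : ℝ × ℝ × ℝ => ENNReal.ofReal (|w.1 - w.2.1| ^ (2 * H - 2)) := by
    fun_prop
  rw [energyMeasure, lintegral_withDensity_eq_lintegral_mul _ hm hF,
    lintegral_prod _ (hm.mul hF).aemeasurable]
  refine lintegral_congr fun s => ?_
  rw [lintegral_prod]
  · simp only [Pi.mul_apply, mul_comm]
  · exact ((hm.mul hF).comp measurable_prodMk_left).aemeasurable

/-- The bilinear form of the noise on nonnegative functions. -/
noncomputable def energy (H T : ℝ) (a b : ℝ → ℝ → ℝ≥0∞) : ℝ≥0∞ :=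
  ∫⁻ w, a w.1 w.2.2 * b w.2.1 w.2.2 ∂(energyMeasure H T)

lemma measurable_energy_integrand {a b : ℝ → ℝ → ℝ≥0∞} (ha : Measurable (Function.uncurry a))
    (hb : Measurable (Function.uncurry b)) :
    Measurable fun w : ℝ × ℝ × ℝ => a w.1 w.2.2 * b w.2.1 w.2.2 :=
  (ha.comp (f := fun w : ℝ × ℝ × ℝ => (w.1, w.2.2)) (by fun_prop)).mul
    (hb.comp (f := fun w : ℝ × ℝ × ℝ => (w.2.1, w.2.2)) (by fun_prop))

/-- Substituting the superposition for the kernel makes the energy an L² pairing of transforms of a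
and b; the prefactor undoes the constant in `lintegral_intervalIndicator`. -/
lemma energy_eq {H : ℝ} (T : ℝ) (hH1 : H < 1) {a b : ℝ → ℝ → ℝ≥0∞}
    (ha : Measurable (Function.uncurry a)) (hb : Measurable (Function.uncurry b)) :
    energy H T a b = ENNReal.ofReal ((2 - 2 * H) * (2 - 2 * H + 1)) *
      ∫⁻ p, (∫⁻ s in Set.Icc 0 T, a s p.1 * intervalIndicator p.2 s) *
        (∫⁻ r in Set.Icc 0 T, b r p.1 * intervalIndicator p.2 r)
        ∂((volume : Measure ℝ).prod (intervalMeasure (2 - 2 * H))) := by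
  set α := 2 - 2 * H with hα
  have hα0 : 0 < α := by linarith
  set c := ENNReal.ofReal (α * (α + 1)) with hc
  have hmul {a : ℝ → ℝ → ℝ≥0∞} (ha : Measurable (Function.uncurry a)) :
      Measurable (Function.uncurry fun (s : ℝ) (p : ℝ × ℝ × ℝ) =>
        a s p.1 * intervalIndicator p.2 s) :=
    (ha.comp (f := fun w : ℝ × ℝ × ℝ × ℝ => (w.1, w.2.1)) (by fun_prop)).mul
      (measurable_intervalIndicator.comp (f := fun w : ℝ × ℝ × ℝ × ℝ => (w.2.2, w.1))
        (by fun_prop))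
  rw [← lintegral_lintegral_lintegral_mul (hmul ha) (hmul hb), energy,
    lintegral_energyMeasure _ _ (measurable_energy_integrand ha hb),
    ← lintegral_const_mul' _ _ ENNReal.ofReal_ne_top]
  refine lintegral_congr fun s => ?_
  rw [← lintegral_const_mul' _ _ ENNReal.ofReal_ne_top]
  -- At r = s the real power is 0 by convention while the superposition is infinite; this point is
  -- null.
  have hne : ∀ᵐ r ∂(volume.restrict (Set.Icc 0 T)), r ≠ s :=
    ae_restrict_of_ae (by simp [ae_iff])
  refine lintegral_congr_ae ?_
  filter_upwards [hne] with r hr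
  have hker : ENNReal.ofReal (|s - r| ^ (2 * H - 2)) =
      c * ∫⁻ θ, intervalIndicator θ s * intervalIndicator θ r ∂(intervalMeasure α) := by
    rw [lintegral_intervalIndicator hα0 hr.symm, hc, ← ENNReal.ofReal_mul (by positivity)]
    congr 1
    have : 2 * H - 2 = -α := by rw [hα]; ring
    rw [this]
    field_simp
  rw [← lintegral_const_mul' _ _ ENNReal.ofReal_ne_top, lintegral_prod]
  · refine lintegral_congr fun y => ?_
    rw [hker, ← mul_assoc, ← lintegral_const_mul]
    · refine lintegral_congr fun θ => ?_
      ring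
    · have hm (t : ℝ) : Measurable fun θ => intervalIndicator θ t :=
        measurable_intervalIndicator.comp (measurable_id.prodMk measurable_const)
      exact (hm s).mul (hm r)
  · have h1 := (hmul ha).comp (measurable_prodMk_left (x := s))
    have h2 := (hmul hb).comp (measurable_prodMk_left (x := r))
    exact ((h1.mul h2).const_mul c).aemeasurable

/-- The Cauchy-Schwarz inequality for the energy. -/
lemma energy_le {H : ℝ} (T : ℝ) (hH1 : H < 1) {a b : ℝ → ℝ → ℝ≥0∞}
    (ha : Measurable (Function.uncurry a)) (hb : Measurable (Function.uncurry b)) :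
    energy H T a b ≤ energy H T a a ^ (1 / 2 : ℝ) * energy H T b b ^ (1 / 2 : ℝ) := by
  rw [energy_eq T hH1 ha hb, energy_eq T hH1 ha ha, energy_eq T hH1 hb hb]
  set c := ENNReal.ofReal ((2 - 2 * H) * (2 - 2 * H + 1)) with hc
  have hmul {a : ℝ → ℝ → ℝ≥0∞} (ha : Measurable (Function.uncurry a)) :
      Measurable fun p : ℝ × ℝ × ℝ => ∫⁻ s in Set.Icc 0 T, a s p.1 * intervalIndicator p.2 s := by
    refine Measurable.lintegral_prod_left' (f := fun w : ℝ × ℝ × ℝ × ℝ =>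
      a w.1 w.2.1 * intervalIndicator w.2.2 w.1) ?_
    exact (ha.comp (f := fun w : ℝ × ℝ × ℝ × ℝ => (w.1, w.2.1)) (by fun_prop)).mul
      (measurable_intervalIndicator.comp (f := fun w : ℝ × ℝ × ℝ × ℝ => (w.2.2, w.1))
        (by fun_prop))
  have hold := ENNReal.lintegral_mul_le_Lp_mul_Lq
    ((volume : Measure ℝ).prod (intervalMeasure (2 - 2 * H))) Real.HolderConjugate.two_two
    (hmul ha).aemeasurable (hmul hb).aemeasurable
  have hcc : c = c ^ (1 / 2 : ℝ) * c ^ (1 / 2 : ℝ) := by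
    rw [← ENNReal.rpow_add_of_nonneg _ _ (by norm_num) (by norm_num)]; norm_num
  rw [ENNReal.mul_rpow_of_nonneg _ _ (by norm_num), ENNReal.mul_rpow_of_nonneg _ _ (by norm_num)]
  calc _ ≤ c * _ := mul_le_mul_right hold c
    _ = _ := by
      simp only [ENNReal.rpow_two, sq]
      nth_rw 1 [hcc]
      ring

end Energy

end WaveQV

namespace WaveQV

/-! ### Covariance of rectangular increments of the noise -/

section Isometry

/-- Up to the factor 2H this is the derivative of |x|^(2H), which is C¹ as 2H > 1; the argument
covers the point 0, where |x|^(2H-2) alone is singular for H < 1. -/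
lemma continuous_abs_rpow_mul {H : ℝ} (hH : 1 / 2 < H) :
    Continuous fun x : ℝ => |x| ^ (2 * H - 2) * x := by
  have h := (contDiff_norm_rpow (E := ℝ) (p := 2 * H) (by linarith)).continuous_deriv le_rfl
  have e : deriv (fun x : ℝ => ‖x‖ ^ (2 * H)) = fun x => 2 * H * |x| ^ (2 * H - 2) * x := by
    ext x
    exact (hasDerivAt_abs_rpow x (by linarith)).deriv
  rw [e] at h
  have hne : 2 * H ≠ 0 := by linarith
  refine (h.const_mul (2 * H)⁻¹).congr fun x => ?_
  field_simp

lemma hasDerivAt_abs_rpow_mul (H : ℝ) {x : ℝ} (hx : x ≠ 0) :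
    HasDerivAt (fun x : ℝ => |x| ^ (2 * H - 2) * x) ((2 * H - 1) * |x| ^ (2 * H - 2)) x := by
  have h := ((hasDerivAt_abs hx).rpow_const (p := 2 * H - 2)
    (Or.inl (abs_pos.2 hx).ne')).mul (hasDerivAt_id x)
  convert! h using 1
  have h1 : |x| ^ (2 * H - 2 - 1) * |x| = |x| ^ (2 * H - 2) := by
    rw [← Real.rpow_add_one (abs_pos.2 hx).ne']; congr 1; ring
  have h2 : ((SignType.sign x : ℤ) : ℝ) * x = |x| := by
    rcases lt_or_gt_of_ne hx with h | h
    · simp [sign_neg h, abs_of_neg h]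
    · simp [sign_pos h, abs_of_pos h]
  have h2' : (SignType.sign x : ℝ) * x = |x| := by
    rcases lt_or_gt_of_ne hx with h | h
    · simp [sign_neg h, abs_of_neg h]
    · simp [sign_pos h, abs_of_pos h]
  simp only [id, mul_one]
  linear_combination (-(2 * H - 2)) * h1 - ((2 * H - 2) * |x| ^ (2 * H - 2 - 1)) * h2'

lemma intervalIntegrable_abs_rpow {H : ℝ} (hH : 1 / 2 < H) (a b : ℝ) :
    IntervalIntegrable (fun x : ℝ => |x| ^ (2 * H - 2)) volume a b := by
  by_cases hH1 : H = 1
  · subst hH1; simp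
  set R := max |a| |b| with hR
  have hR0 : 0 ≤ R := (abs_nonneg a).trans (le_max_left _ _)
  have hi : IntegrableOn (fun x : ℝ => |x| ^ (2 * H - 2)) (Set.Icc (-R) R) := by
    have hm : Measurable fun x : ℝ => |x| ^ (2 * H - 2) := by fun_prop
    refine ⟨hm.aestronglyMeasurable, ?_⟩
    have hb : ∫⁻ x in Set.Icc (-R) R, ‖x‖ₑ ^ (-(2 - 2 * H)) < ∞ :=
      (lintegral_Icc_enorm_rpow (by linarith) hR0).trans_lt ENNReal.ofReal_lt_top
    refine lt_of_le_of_lt (lintegral_mono fun x => ?_) hb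
    rw [Real.enorm_eq_ofReal (by positivity)]
    have := ofReal_abs_rpow_le x (2 - 2 * H) (fun h => hH1 (by linarith))
    have e : -(2 - 2 * H) = 2 * H - 2 := by ring
    rw [e] at this ⊢
    exact this
  rw [intervalIntegrable_iff]
  refine hi.mono_set fun x hx => ?_
  rw [Set.mem_uIoc] at hx
  have h1 := le_max_left |a| |b|
  have h2 := le_max_right |a| |b|
  have h3 := abs_le.1 (h1.trans hR.ge)
  have h4 := abs_le.1 (h2.trans hR.ge)
  rcases hx with hx | hx
  · exact ⟨by linarith, by linarith⟩
  · exact ⟨by linarith, by linarith⟩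

/-- The antiderivative |r - s|^(2H-2) (r - s)/(2H-1) is continuous everywhere and differentiable off
r = s, which suffices for the fundamental theorem. -/
lemma integral_abs_sub_rpow {H : ℝ} (hH : 1 / 2 < H) {c d : ℝ} (hcd : c ≤ d) (s : ℝ) :
    IntervalIntegrable (fun r => |s - r| ^ (2 * H - 2)) volume c d ∧
    ∫ r in c..d, |s - r| ^ (2 * H - 2) =
      (|d - s| ^ (2 * H - 2) * (d - s) - |c - s| ^ (2 * H - 2) * (c - s)) / (2 * H - 1) := by
  have hne : 2 * H - 1 ≠ 0 := by linarith
  have hi : IntervalIntegrable (fun r => |s - r| ^ (2 * H - 2)) volume c d := by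
    have := (intervalIntegrable_abs_rpow hH (c - s) (d - s)).comp_sub_right s
    simp only [sub_add_cancel] at this
    simpa only [abs_sub_comm s] using this
  refine ⟨hi, ?_⟩
  rw [integral_eq_of_hasDerivAt_off_countable_of_le
    (fun r => (|r - s| ^ (2 * H - 2) * (r - s)) / (2 * H - 1)) _ hcd (Set.countable_singleton s)]
  · ring
  · exact (((continuous_abs_rpow_mul hH).comp (continuous_sub_right s)).div_const _).continuousOn
  · intro r hr
    have hrs : r - s ≠ 0 := sub_ne_zero.2 fun h => hr.2 h
    have h := ((hasDerivAt_abs_rpow_mul H hrs).comp r ((hasDerivAt_id r).sub_const s)).div_const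
      (2 * H - 1)
    convert! h using 1
    rw [abs_sub_comm]
    field_simp
  · exact hi

/-- The energy of a product of two time intervals. -/
lemma lintegral_Ioc_abs_sub_rpow {H : ℝ} (hH : 1 / 2 < H) {a b c d : ℝ} (hab : a ≤ b)
    (hcd : c ≤ d) :
    0 ≤ (|b - c| ^ (2 * H) + |a - d| ^ (2 * H) - |a - c| ^ (2 * H) - |b - d| ^ (2 * H)) /
        (2 * H * (2 * H - 1)) ∧
    ∫⁻ s in Set.Ioc a b, ∫⁻ r in Set.Ioc c d, ENNReal.ofReal (|s - r| ^ (2 * H - 2)) =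
      ENNReal.ofReal ((|b - c| ^ (2 * H) + |a - d| ^ (2 * H) - |a - c| ^ (2 * H)
        - |b - d| ^ (2 * H)) / (2 * H * (2 * H - 1))) := by
  have hne : 2 * H - 1 ≠ 0 := by linarith
  have hne2 : H ≠ 0 := by linarith
  set g : ℝ → ℝ := fun s => (|d - s| ^ (2 * H - 2) * (d - s) - |c - s| ^ (2 * H - 2) * (c - s)) /
    (2 * H - 1) with hg
  have hg0 (s : ℝ) : 0 ≤ g s := by
    rw [hg]
    simp only
    rw [← (integral_abs_sub_rpow hH hcd s).2]
    exact intervalIntegral.integral_nonneg hcd fun r _ => by positivity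
  have hgc : Continuous g :=
    (((continuous_abs_rpow_mul hH).comp (continuous_sub_left d)).sub
      ((continuous_abs_rpow_mul hH).comp (continuous_sub_left c))).div_const _
  have hinner (s : ℝ) : ∫⁻ r in Set.Ioc c d, ENNReal.ofReal (|s - r| ^ (2 * H - 2)) =
      ENNReal.ofReal (g s) := by
    obtain ⟨h1, h2⟩ := integral_abs_sub_rpow hH hcd s
    rw [← ofReal_integral_eq_lintegral_ofReal
      ((intervalIntegrable_iff_integrableOn_Ioc_of_le hcd).1 h1)
      (ae_of_all _ fun r => by positivity), ← intervalIntegral.integral_of_le hcd, h2]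
  have hi : IntervalIntegrable g volume a b := hgc.intervalIntegrable a b
  have hint : ∫ s in a..b, g s = (|b - c| ^ (2 * H) + |a - d| ^ (2 * H) - |a - c| ^ (2 * H)
        - |b - d| ^ (2 * H)) / (2 * H * (2 * H - 1)) := by
    -- The second antiderivative of the kernel is a multiple of |·|^(2H), so the double integral is
    -- a second difference of it, as in the covariance of fractional Brownian motion.
    have hd (s : ℝ) : HasDerivAt (fun s => (|c - s| ^ (2 * H) - |d - s| ^ (2 * H)) /
        (2 * H * (2 * H - 1))) (g s) s := by
      have h1 := (hasDerivAt_abs_rpow (c - s) (p := 2 * H) (by linarith)).comp s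
        ((hasDerivAt_id s).const_sub c)
      have h2 := (hasDerivAt_abs_rpow (d - s) (p := 2 * H) (by linarith)).comp s
        ((hasDerivAt_id s).const_sub d)
      convert! (h1.sub h2).div_const (2 * H * (2 * H - 1)) using 1
      rw [hg]
      field_simp
      ring
    rw [intervalIntegral.integral_eq_sub_of_hasDerivAt (fun s _ => hd s) hi, abs_sub_comm a d,
      abs_sub_comm a c, abs_sub_comm b c, abs_sub_comm b d]
    ring
  refine ⟨?_, ?_⟩
  · rw [← hint]
    exact intervalIntegral.integral_nonneg hab fun s _ => hg0 s
  · simp_rw [hinner]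
    rw [← ofReal_integral_eq_lintegral_ofReal
      ((intervalIntegrable_iff_integrableOn_Ioc_of_le hab).1 hi)
      (ae_of_all _ hg0), ← intervalIntegral.integral_of_le hab, hint]

/-- The indicator function of the rectangle `(a, b] × (y, z]`. -/
noncomputable def rectFun (a b y z s v : ℝ) : ℝ :=
  (Set.Ioc a b).indicator 1 s * (Set.Ioc y z).indicator 1 v

lemma measurable_rectFun (a b y z : ℝ) : Measurable (Function.uncurry (rectFun a b y z)) := by
  have h (a b : ℝ) : Measurable ((Set.Ioc a b).indicator (1 : ℝ → ℝ)) :=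
    measurable_one.indicator measurableSet_Ioc
  exact ((h a b).comp measurable_fst).mul ((h y z).comp measurable_snd)

lemma rectFun_nonneg (a b y z s v : ℝ) : 0 ≤ rectFun a b y z s v :=
  mul_nonneg (Set.indicator_nonneg (fun _ _ => zero_le_one) _)
    (Set.indicator_nonneg (fun _ _ => zero_le_one) _)

/-- The rectangular increment of the covariance `fbmCov`. -/
noncomputable def fbmRect (H a b a' b' : ℝ) : ℝ :=
  fbmCov H b b' - fbmCov H b a' - fbmCov H a b' + fbmCov H a a'

/-- The rectangular increment of the covariance `bmCov`. -/
noncomputable def bmRect (a b a' b' : ℝ) : ℝ :=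
  bmCov b b' - bmCov b a' - bmCov a b' + bmCov a a'

lemma bmRect_eq {a b a' b' : ℝ} (h : a ≤ b) (h' : a' ≤ b') :
    bmRect a b a' b' = max 0 (min b b' - max a a') := by
  unfold bmRect bmCov
  grind

/-- Time and space separate. In space only the overlap counts, of length `bmRect`. In time the
factor H(2H-1) cancels the denominator 2H(2H-1) up to the 1/2 in `fbmCov`, whose one-variable terms
drop out of the rectangular increment. -/
lemma integral_rectFun_mul {H T : ℝ} (hH : 1 / 2 < H) {a b y z a' b' y' z' : ℝ}
    (h0 : 0 ≤ a) (hab : a ≤ b) (hbT : b ≤ T) (hyz : y ≤ z) (h0' : 0 ≤ a') (hab' : a' ≤ b')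
    (hbT' : b' ≤ T) (hyz' : y' ≤ z') :
    Integrable (fun w : ℝ × ℝ × ℝ => rectFun a b y z w.1 w.2.2 * rectFun a' b' y' z' w.2.1 w.2.2)
      (energyMeasure H T) ∧
    H * (2 * H - 1) * ∫ w, rectFun a b y z w.1 w.2.2 * rectFun a' b' y' z' w.2.1 w.2.2
      ∂(energyMeasure H T) = fbmRect H a b a' b' * bmRect y z y' z' := by
  have hm : Measurable fun w : ℝ × ℝ × ℝ =>
      rectFun a b y z w.1 w.2.2 * rectFun a' b' y' z' w.2.1 w.2.2 :=
    ((measurable_rectFun a b y z).comp (f := fun w : ℝ × ℝ × ℝ => (w.1, w.2.2)) (by fun_prop)).mul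
      ((measurable_rectFun a' b' y' z').comp (f := fun w : ℝ × ℝ × ℝ => (w.2.1, w.2.2))
        (by fun_prop))
  have hnn (w : ℝ × ℝ × ℝ) : 0 ≤ rectFun a b y z w.1 w.2.2 * rectFun a' b' y' z' w.2.1 w.2.2 :=
    mul_nonneg (rectFun_nonneg _ _ _ _ _ _) (rectFun_nonneg _ _ _ _ _ _)
  obtain ⟨hF0, hF⟩ := lintegral_Ioc_abs_sub_rpow hH hab hab'
  set F := (|b - a'| ^ (2 * H) + |a - b'| ^ (2 * H) - |a - a'| ^ (2 * H) - |b - b'| ^ (2 * H)) /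
        (2 * H * (2 * H - 1)) with hFdef
  have hl : ∫⁻ w, ENNReal.ofReal (rectFun a b y z w.1 w.2.2 * rectFun a' b' y' z' w.2.1 w.2.2)
      ∂(energyMeasure H T) = ENNReal.ofReal (F * bmRect y z y' z') := by
    rw [lintegral_energyMeasure _ _ hm.ennreal_ofReal]
    have hpt (s r v : ℝ) : ENNReal.ofReal (rectFun a b y z s v * rectFun a' b' y' z' r v) *
        ENNReal.ofReal (|s - r| ^ (2 * H - 2)) = (Set.Ioc a b).indicator (fun s =>
          (Set.Ioc a' b').indicator (fun r => ENNReal.ofReal (|s - r| ^ (2 * H - 2)) *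
            (Set.Ioc (max y y') (min z z')).indicator 1 v) r) s := by
      simp only [rectFun, Set.indicator_apply, Set.mem_Ioc, max_lt_iff, le_min_iff, Pi.one_apply]
      split_ifs <;> first | (simp; done) | (exfalso; tauto)
    have hv : ∫⁻ v : ℝ, (Set.Ioc (max y y') (min z z')).indicator 1 v =
        ENNReal.ofReal (bmRect y z y' z') := by
      rw [lintegral_indicator_one measurableSet_Ioc, Real.volume_Ioc, bmRect_eq hyz hyz']
      rcases le_total 0 (min z z' - max y y') with h | h
      · rw [max_eq_right h]
      · rw [max_eq_left h, ENNReal.ofReal_of_nonpos h, ENNReal.ofReal_zero]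
    have hIn (s r : ℝ) : ∫⁻ v, ENNReal.ofReal (rectFun a b y z s v * rectFun a' b' y' z' r v) *
        ENNReal.ofReal (|s - r| ^ (2 * H - 2)) = (Set.Ioc a b).indicator (fun s =>
          (Set.Ioc a' b').indicator (fun r => ENNReal.ofReal (|s - r| ^ (2 * H - 2)) *
            ENNReal.ofReal (bmRect y z y' z')) r) s := by
      simp_rw [hpt]
      by_cases hs : s ∈ Set.Ioc a b
      · by_cases hr : r ∈ Set.Ioc a' b'
        · simp only [Set.indicator_of_mem hs, Set.indicator_of_mem hr]
          rw [lintegral_const_mul' _ _ ENNReal.ofReal_ne_top, hv]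
        · simp only [Set.indicator_of_mem hs, Set.indicator_of_notMem hr, lintegral_zero]
      · simp only [Set.indicator_of_notMem hs, lintegral_zero]
    have hsub {p q : ℝ} (hp : 0 ≤ p) (hq : q ≤ T) : Set.Ioc p q ∩ Set.Icc 0 T = Set.Ioc p q :=
      Set.inter_eq_left.2 fun t ht => ⟨hp.trans ht.1.le, ht.2.trans hq⟩
    simp_rw [hIn]
    have hswap (s : ℝ) : ∫⁻ r in Set.Icc 0 T, (Set.Ioc a b).indicator (fun s =>
          (Set.Ioc a' b').indicator (fun r => ENNReal.ofReal (|s - r| ^ (2 * H - 2)) *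
            ENNReal.ofReal (bmRect y z y' z')) r) s = (Set.Ioc a b).indicator (fun s =>
            (∫⁻ r in Set.Ioc a' b', ENNReal.ofReal (|s - r| ^ (2 * H - 2))) *
              ENNReal.ofReal (bmRect y z y' z')) s := by
      by_cases hs : s ∈ Set.Ioc a b
      · simp only [Set.indicator_of_mem hs]
        rw [setLIntegral_indicator measurableSet_Ioc, hsub h0' hbT',
          lintegral_mul_const' _ _ ENNReal.ofReal_ne_top]
      · simp only [Set.indicator_of_notMem hs, lintegral_zero]
    simp_rw [hswap]
    rw [setLIntegral_indicator measurableSet_Ioc, hsub h0 hbT,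
      lintegral_mul_const' _ _ ENNReal.ofReal_ne_top, hF, ENNReal.ofReal_mul hF0]
  have hB0 : 0 ≤ bmRect y z y' z' := by rw [bmRect_eq hyz hyz']; exact le_max_left _ _
  refine ⟨⟨hm.aestronglyMeasurable, ?_⟩, ?_⟩
  · rw [hasFiniteIntegral_iff_ofReal (ae_of_all _ hnn), hl]
    exact ENNReal.ofReal_lt_top
  · rw [integral_eq_lintegral_of_nonneg_ae (ae_of_all _ hnn) hm.aestronglyMeasurable, hl,
      ENNReal.toReal_ofReal (mul_nonneg hF0 hB0), hFdef, fbmRect]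
    have hne : 2 * H - 1 ≠ 0 := by linarith
    have hne2 : H ≠ 0 := by linarith
    unfold fbmCov
    generalize 2 * H - 1 = D at hne ⊢
    field_simp
    ring

end Isometry

end WaveQV

namespace WaveQV

/-! ### The Wiener integral and its isometry -/

section WienerIntegral

variable {Ω : Type*} [MeasurableSpace Ω] {P : Measure Ω}
  {H T : ℝ} {W : ℝ → ℝ → Ω → ℝ}

lemma inner_toLp {X Y : Ω → ℝ} (hX : MemLp X 2 P) (hY : MemLp Y 2 P) :
    inner ℝ (hX.toLp X) (hY.toLp Y) = ∫ ω, X ω * Y ω ∂P := by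
  rw [L2.inner_def]
  refine integral_congr_ae ?_
  filter_upwards [hX.coeFn_toLp, hY.coeFn_toLp] with ω h1 h2
  rw [h1, h2]
  simp [mul_comm]

lemma inner_noiseLp (hW : IsFractionalWhiteNoise P H T W) (p q : Set.Icc (0 : ℝ) T × ℝ) :
    inner ℝ (noiseLp hW p) (noiseLp hW q) = fbmCov H p.1 q.1 * bmCov p.2 q.2 := by
  rw [noiseLp, noiseLp, inner_toLp, hW.covariance _ p.1.2 _ q.1.2]

namespace Elementary

variable (g : Elementary T)

lemma t₀_mem (i : Fin g.n) : g.t₀ i ∈ Set.Icc 0 T :=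
  ⟨g.zero_le i, (g.t_le i).trans (g.le_T i)⟩

lemma t₁_mem (i : Fin g.n) : g.t₁ i ∈ Set.Icc 0 T :=
  ⟨(g.zero_le i).trans (g.t_le i), g.le_T i⟩

/-- The rectangular increment of the noise over the `i`-th rectangle. -/
noncomputable def rectLp (hW : IsFractionalWhiteNoise P H T W) (i : Fin g.n) : Lp ℝ 2 P :=
  noiseLp hW (⟨g.t₁ i, g.t₁_mem i⟩, g.y₁ i) - noiseLp hW (⟨g.t₁ i, g.t₁_mem i⟩, g.y₀ i)
    - noiseLp hW (⟨g.t₀ i, g.t₀_mem i⟩, g.y₁ i) + noiseLp hW (⟨g.t₀ i, g.t₀_mem i⟩, g.y₀ i)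

/-- The Wiener integral of an elementary integrand, as an element of `L²`. -/
noncomputable def integralLp (hW : IsFractionalWhiteNoise P H T W) : Lp ℝ 2 P :=
  ∑ i, g.coef i • g.rectLp hW i

lemma coeFn_integralLp (hW : IsFractionalWhiteNoise P H T W) :
    g.integralLp hW =ᵐ[P] g.integral W := by
  have h : ∀ᵐ ω ∂P, ∀ i, g.rectLp hW i ω = W (g.t₁ i) (g.y₁ i) ω - W (g.t₁ i) (g.y₀ i) ω
      - W (g.t₀ i) (g.y₁ i) ω + W (g.t₀ i) (g.y₀ i) ω := by
    rw [ae_all_iff]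
    intro i
    have hn (p : Set.Icc (0 : ℝ) T × ℝ) : noiseLp hW p =ᵐ[P] W p.1 p.2 :=
      MemLp.coeFn_toLp (hW.memLp p.1.2 p.2)
    filter_upwards [Lp.coeFn_add (noiseLp hW (⟨g.t₁ i, g.t₁_mem i⟩, g.y₁ i)
        - noiseLp hW (⟨g.t₁ i, g.t₁_mem i⟩, g.y₀ i) - noiseLp hW (⟨g.t₀ i, g.t₀_mem i⟩, g.y₁ i))
        (noiseLp hW (⟨g.t₀ i, g.t₀_mem i⟩, g.y₀ i)),
      Lp.coeFn_sub (noiseLp hW (⟨g.t₁ i, g.t₁_mem i⟩, g.y₁ i)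
        - noiseLp hW (⟨g.t₁ i, g.t₁_mem i⟩, g.y₀ i)) (noiseLp hW (⟨g.t₀ i, g.t₀_mem i⟩, g.y₁ i)),
      Lp.coeFn_sub (noiseLp hW (⟨g.t₁ i, g.t₁_mem i⟩, g.y₁ i))
        (noiseLp hW (⟨g.t₁ i, g.t₁_mem i⟩, g.y₀ i)),
      hn (⟨g.t₁ i, g.t₁_mem i⟩, g.y₁ i), hn (⟨g.t₁ i, g.t₁_mem i⟩, g.y₀ i),
      hn (⟨g.t₀ i, g.t₀_mem i⟩, g.y₁ i), hn (⟨g.t₀ i, g.t₀_mem i⟩, g.y₀ i)]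
      with ω h1 h2 h3 h4 h5 h6 h7
    rw [rectLp, h1, Pi.add_apply, h2, Pi.sub_apply, h3, Pi.sub_apply, h4, h5, h6, h7]
  filter_upwards [h, IsGaussianSpace.coeFn_sum_smul Finset.univ g.coef (g.rectLp hW)] with ω h1 h2
  rw [integralLp, h2, integral]
  exact Finset.sum_congr rfl fun i _ => by rw [h1]

lemma integralLp_mem (hW : IsFractionalWhiteNoise P H T W) :
    g.integralLp hW ∈ firstChaos P T W := by
  have h := noiseLp_mem_firstChaos hW
  refine Submodule.sum_mem _ fun i _ => Submodule.smul_mem _ _ ?_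
  exact Submodule.add_mem _ (Submodule.sub_mem _ (Submodule.sub_mem _ (h _) (h _)) (h _)) (h _)

lemma toFun_eq (s y : ℝ) : g.toFun s y =
    ∑ i, g.coef i * rectFun (g.t₀ i) (g.t₁ i) (g.y₀ i) (g.y₁ i) s y := by
  simp only [toFun, rectFun, mul_assoc]

lemma measurable_toFun : Measurable (Function.uncurry g.toFun) := by
  have : Function.uncurry g.toFun = fun p : ℝ × ℝ =>
      ∑ i, g.coef i * rectFun (g.t₀ i) (g.t₁ i) (g.y₀ i) (g.y₁ i) p.1 p.2 := by
    ext p; exact g.toFun_eq p.1 p.2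
  rw [this]
  exact Finset.measurable_fun_sum _ fun i _ => (measurable_rectFun _ _ _ _).const_mul _

lemma inner_rectLp (hW : IsFractionalWhiteNoise P H T W) (h : Elementary T) (i : Fin g.n)
    (j : Fin h.n) : inner ℝ (g.rectLp hW i) (h.rectLp hW j) =
      fbmRect H (g.t₀ i) (g.t₁ i) (h.t₀ j) (h.t₁ j) *
        bmRect (g.y₀ i) (g.y₁ i) (h.y₀ j) (h.y₁ j) := by
  simp only [rectLp, inner_add_left, inner_sub_left, inner_add_right, inner_sub_right,
    inner_noiseLp, fbmRect, bmRect]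
  ring

/-- The isometry property for elementary integrands. -/
lemma inner_integralLp (hH : 1 / 2 < H) (hW : IsFractionalWhiteNoise P H T W)
    (h : Elementary T) :
    Integrable (fun w : ℝ × ℝ × ℝ => g.toFun w.1 w.2.2 * h.toFun w.2.1 w.2.2)
      (energyMeasure H T) ∧
    inner ℝ (g.integralLp hW) (h.integralLp hW) = H * (2 * H - 1) *
      ∫ w, g.toFun w.1 w.2.2 * h.toFun w.2.1 w.2.2 ∂(energyMeasure H T) := by
  have hr (i : Fin g.n) (j : Fin h.n) := integral_rectFun_mul hH (g.zero_le i) (g.t_le i)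
    (g.le_T i) (g.y_le i) (h.zero_le j) (h.t_le j) (h.le_T j) (h.y_le j)
  have e (w : ℝ × ℝ × ℝ) : g.toFun w.1 w.2.2 * h.toFun w.2.1 w.2.2 =
      ∑ i, ∑ j, (g.coef i * h.coef j) *
        (rectFun (g.t₀ i) (g.t₁ i) (g.y₀ i) (g.y₁ i) w.1 w.2.2 *
          rectFun (h.t₀ j) (h.t₁ j) (h.y₀ j) (h.y₁ j) w.2.1 w.2.2) := by
    rw [toFun_eq, toFun_eq, Finset.sum_mul_sum]
    exact Finset.sum_congr rfl fun i _ => Finset.sum_congr rfl fun j _ => by ring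
  simp_rw [e]
  have hi (i : Fin g.n) (j : Fin h.n) := (hr i j).1.const_mul (g.coef i * h.coef j)
  refine ⟨integrable_finsetSum _ fun i _ => integrable_finsetSum _ fun j _ => hi i j, ?_⟩
  rw [integral_finsetSum _ fun i _ => integrable_finsetSum _ fun j _ => hi i j, integralLp,
    integralLp, sum_inner, Finset.mul_sum]
  refine Finset.sum_congr rfl fun i _ => ?_
  rw [integral_finsetSum _ fun j _ => hi i j, inner_sum, Finset.mul_sum]
  refine Finset.sum_congr rfl fun j _ => ?_
  rw [integral_const_mul, inner_smul_left, inner_smul_right, inner_rectLp, ← (hr i j).2]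
  simp only [conj_trivial]
  ring

end Elementary

lemma noiseNormSq_eq (H T : ℝ) {f : ℝ → ℝ → ℝ} (hf : Measurable (Function.uncurry f)) :
    noiseNormSq H T f = ENNReal.ofReal (H * (2 * H - 1)) *
      energy H T (fun s y => ‖f s y‖ₑ) (fun s y => ‖f s y‖ₑ) := by
  have hm : Measurable (Function.uncurry fun s y => ‖f s y‖ₑ) := hf.enorm
  rw [noiseNormSq, energy, lintegral_energyMeasure _ _ (measurable_energy_integrand hm hm)]
  congr 1
  refine lintegral_congr fun s => lintegral_congr fun r => lintegral_congr fun y => ?_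
  rw [ENNReal.ofReal_mul (by positivity), ENNReal.ofReal_mul (by positivity),
    Real.enorm_eq_ofReal_abs, Real.enorm_eq_ofReal_abs]

lemma tendsto_energy_of_tendsto_noiseNormSq (hH : 1 / 2 < H) {f : ℕ → ℝ → ℝ → ℝ}
    (hf : ∀ n, Measurable (Function.uncurry (f n)))
    (h : Tendsto (fun n => noiseNormSq H T (f n)) atTop (𝓝 0)) :
    Tendsto (fun n => energy H T (fun s y => ‖f n s y‖ₑ) (fun s y => ‖f n s y‖ₑ)) atTop (𝓝 0) := by
  simp_rw [noiseNormSq_eq H T (hf _)] at h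
  have hpos : 0 < H * (2 * H - 1) := mul_pos (by linarith) (by linarith)
  have h2 := ENNReal.Tendsto.const_mul (a := (ENNReal.ofReal (H * (2 * H - 1)))⁻¹) h
    (Or.inr (by simpa using hpos))
  rw [mul_zero] at h2
  refine h2.congr fun n => ?_
  rw [← mul_assoc, ENNReal.inv_mul_cancel (by simpa using hpos) ENNReal.ofReal_ne_top, one_mul]

lemma measurable_uncurry_enorm {f : ℝ → ℝ → ℝ} (hf : Measurable (Function.uncurry f)) :
    Measurable (Function.uncurry fun s y => ‖f s y‖ₑ) := hf.enorm

/-- Cauchy-Schwarz for the energies of the absolute values. -/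
lemma integrable_mul_of_energy_lt_top (hH1 : H < 1) {f f' : ℝ → ℝ → ℝ}
    (hf : Measurable (Function.uncurry f)) (hf' : Measurable (Function.uncurry f'))
    (he : energy H T (fun s y => ‖f s y‖ₑ) (fun s y => ‖f s y‖ₑ) < ∞)
    (he' : energy H T (fun s y => ‖f' s y‖ₑ) (fun s y => ‖f' s y‖ₑ) < ∞) :
    Integrable (fun w : ℝ × ℝ × ℝ => f w.1 w.2.2 * f' w.2.1 w.2.2) (energyMeasure H T) := by
  refine ⟨?_, ?_⟩
  · exact ((hf.comp (f := fun w : ℝ × ℝ × ℝ => (w.1, w.2.2)) (by fun_prop)).mul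
      (hf'.comp (f := fun w : ℝ × ℝ × ℝ => (w.2.1, w.2.2)) (by fun_prop))).aestronglyMeasurable
  · rw [hasFiniteIntegral_iff_enorm]
    simp_rw [enorm_mul]
    refine (energy_le T hH1 (measurable_uncurry_enorm hf) (measurable_uncurry_enorm hf')).trans_lt ?_
    exact ENNReal.mul_lt_top (ENNReal.rpow_lt_top_of_nonneg (by norm_num) he.ne)
      (ENNReal.rpow_lt_top_of_nonneg (by norm_num) he'.ne)

/-- Write gg' - ff' = (g-f)(g'-f') + (g-f)f' + f(g'-f') and bound each term by `energy_le`: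
convergence in the noise norm gives L¹ convergence of the products. -/
lemma tendsto_integral_mul_of_energy (hH1 : H < 1) {f f' : ℝ → ℝ → ℝ} {g g' : ℕ → ℝ → ℝ → ℝ}
    (hf : Measurable (Function.uncurry f)) (hf' : Measurable (Function.uncurry f'))
    (hg : ∀ n, Measurable (Function.uncurry (g n)))
    (hg' : ∀ n, Measurable (Function.uncurry (g' n)))
    (he : energy H T (fun s y => ‖f s y‖ₑ) (fun s y => ‖f s y‖ₑ) < ∞)
    (he' : energy H T (fun s y => ‖f' s y‖ₑ) (fun s y => ‖f' s y‖ₑ) < ∞)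
    (hi : ∀ n, Integrable (fun w : ℝ × ℝ × ℝ => g n w.1 w.2.2 * g' n w.2.1 w.2.2)
      (energyMeasure H T))
    (h : Tendsto (fun n => energy H T (fun s y => ‖g n s y - f s y‖ₑ)
      (fun s y => ‖g n s y - f s y‖ₑ)) atTop (𝓝 0))
    (h' : Tendsto (fun n => energy H T (fun s y => ‖g' n s y - f' s y‖ₑ)
      (fun s y => ‖g' n s y - f' s y‖ₑ)) atTop (𝓝 0)) :
    Tendsto (fun n => ∫ w, g n w.1 w.2.2 * g' n w.2.1 w.2.2 ∂(energyMeasure H T)) atTop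
      (𝓝 (∫ w, f w.1 w.2.2 * f' w.2.1 w.2.2 ∂(energyMeasure H T))) := by
  refine tendsto_integral_of_L1 _ (integrable_mul_of_energy_lt_top hH1 hf hf' he he').1
    (Eventually.of_forall hi) ?_
  have hd (n) : Measurable (Function.uncurry fun s y => ‖g n s y - f s y‖ₑ) :=
    ((hg n).sub hf).enorm
  have hd' (n) : Measurable (Function.uncurry fun s y => ‖g' n s y - f' s y‖ₑ) :=
    ((hg' n).sub hf').enorm
  set E := energy H T (fun s y => ‖f s y‖ₑ) (fun s y => ‖f s y‖ₑ) with hE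
  set E' := energy H T (fun s y => ‖f' s y‖ₑ) (fun s y => ‖f' s y‖ₑ) with hE'
  set D := fun n => energy H T (fun s y => ‖g n s y - f s y‖ₑ) (fun s y => ‖g n s y - f s y‖ₑ)
    with hD
  set D' := fun n => energy H T (fun s y => ‖g' n s y - f' s y‖ₑ)
    (fun s y => ‖g' n s y - f' s y‖ₑ) with hD'
  have hEt : E ^ (1 / 2 : ℝ) ≠ ∞ := ENNReal.rpow_ne_top_of_nonneg (by norm_num) he.ne
  have hEt' : E' ^ (1 / 2 : ℝ) ≠ ∞ := ENNReal.rpow_ne_top_of_nonneg (by norm_num) he'.ne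
  have hroot {D : ℕ → ℝ≥0∞} (h : Tendsto D atTop (𝓝 0)) :
      Tendsto (fun n => D n ^ (1 / 2 : ℝ)) atTop (𝓝 0) := by
    have := (ENNReal.continuous_rpow_const (y := (1 / 2 : ℝ))).tendsto 0 |>.comp h
    simpa [Function.comp_def] using this
  have hlim : Tendsto (fun n => D n ^ (1 / 2 : ℝ) * D' n ^ (1 / 2 : ℝ)
      + D n ^ (1 / 2 : ℝ) * E' ^ (1 / 2 : ℝ) + E ^ (1 / 2 : ℝ) * D' n ^ (1 / 2 : ℝ)) atTop
      (𝓝 0) := by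
    have h1 := ENNReal.Tendsto.mul (hroot h) (Or.inr ENNReal.zero_ne_top) (hroot h')
      (Or.inr ENNReal.zero_ne_top)
    have h2 := ENNReal.Tendsto.mul_const (hroot h) (Or.inr hEt')
    have h3 := ENNReal.Tendsto.const_mul (hroot h') (Or.inr hEt)
    simpa using (h1.add h2).add h3
  refine tendsto_of_tendsto_of_tendsto_of_le_of_le tendsto_const_nhds hlim (fun _ => zero_le)
    fun n => ?_
  calc ∫⁻ w, ‖g n w.1 w.2.2 * g' n w.2.1 w.2.2 - f w.1 w.2.2 * f' w.2.1 w.2.2‖ₑ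
        ∂(energyMeasure H T)
      ≤ ∫⁻ w, (‖g n w.1 w.2.2 - f w.1 w.2.2‖ₑ * ‖g' n w.2.1 w.2.2 - f' w.2.1 w.2.2‖ₑ
        + ‖g n w.1 w.2.2 - f w.1 w.2.2‖ₑ * ‖f' w.2.1 w.2.2‖ₑ
        + ‖f w.1 w.2.2‖ₑ * ‖g' n w.2.1 w.2.2 - f' w.2.1 w.2.2‖ₑ) ∂(energyMeasure H T) := by
        refine lintegral_mono fun w => ?_
        have e : g n w.1 w.2.2 * g' n w.2.1 w.2.2 - f w.1 w.2.2 * f' w.2.1 w.2.2 =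
            (g n w.1 w.2.2 - f w.1 w.2.2) * (g' n w.2.1 w.2.2 - f' w.2.1 w.2.2)
            + (g n w.1 w.2.2 - f w.1 w.2.2) * f' w.2.1 w.2.2
            + f w.1 w.2.2 * (g' n w.2.1 w.2.2 - f' w.2.1 w.2.2) := by ring
        rw [e]
        refine (enorm_add_le _ _).trans (add_le_add ((enorm_add_le _ _).trans ?_) ?_)
        · rw [enorm_mul, enorm_mul]
        · rw [enorm_mul]
    _ = energy H T (fun s y => ‖g n s y - f s y‖ₑ) (fun s y => ‖g' n s y - f' s y‖ₑ)
        + energy H T (fun s y => ‖g n s y - f s y‖ₑ) (fun s y => ‖f' s y‖ₑ)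
        + energy H T (fun s y => ‖f s y‖ₑ) (fun s y => ‖g' n s y - f' s y‖ₑ) := by
        have m1 := measurable_energy_integrand (hd n) (hd' n)
        have m2 := measurable_energy_integrand (hd n) (measurable_uncurry_enorm hf')
        have m12 : Measurable fun w : ℝ × ℝ × ℝ =>
            ‖g n w.1 w.2.2 - f w.1 w.2.2‖ₑ * ‖g' n w.2.1 w.2.2 - f' w.2.1 w.2.2‖ₑ
              + ‖g n w.1 w.2.2 - f w.1 w.2.2‖ₑ * ‖f' w.2.1 w.2.2‖ₑ := m1.add m2
        rw [lintegral_add_left m12, lintegral_add_left m1]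
        rfl
    _ ≤ _ := add_le_add (add_le_add (energy_le T hH1 (hd n) (hd' n))
        (energy_le T hH1 (hd n) (measurable_uncurry_enorm hf')))
        (energy_le T hH1 (measurable_uncurry_enorm hf) (hd' n))

lemma IsWienerIntegral.exists_tendsto {f : ℝ → ℝ → ℝ} {Z : Ω → ℝ}
    (hW : IsFractionalWhiteNoise P H T W) (h : IsWienerIntegral P H T W f Z) :
    ∃ g : ℕ → Elementary T,
      Tendsto (fun n => noiseNormSq H T (fun s y => (g n).toFun s y - f s y)) atTop (𝓝 0) ∧
      Tendsto (fun n => (g n).integralLp hW) atTop (𝓝 (h.1.toLp Z)) := by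
  obtain ⟨hZ, g, hg, hl⟩ := h
  refine ⟨g, hg, ?_⟩
  rw [Lp.tendsto_Lp_iff_tendsto_eLpNorm']
  refine hl.congr fun n => eLpNorm_congr_ae ?_
  filter_upwards [(g n).coeFn_integralLp hW, hZ.coeFn_toLp] with ω h1 h2
  rw [Pi.sub_apply, h1, h2]

lemma IsWienerIntegral.toLp_mem {f : ℝ → ℝ → ℝ} {Z : Ω → ℝ}
    (hW : IsFractionalWhiteNoise P H T W) (h : IsWienerIntegral P H T W f Z) :
    h.1.toLp Z ∈ firstChaos P T W := by
  obtain ⟨g, -, hl⟩ := h.exists_tendsto hW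
  exact (Submodule.isClosed_topologicalClosure _).mem_of_tendsto hl
    (Eventually.of_forall fun n => (g n).integralLp_mem hW)

/-- The isometry property of the Wiener integral. -/
lemma IsWienerIntegral.inner_eq (hH : 1 / 2 < H) (hH1 : H < 1) {f f' : ℝ → ℝ → ℝ} {Z Z' : Ω → ℝ}
    (hW : IsFractionalWhiteNoise P H T W) (h : IsWienerIntegral P H T W f Z)
    (h' : IsWienerIntegral P H T W f' Z')
    (hf : Measurable (Function.uncurry f)) (hf' : Measurable (Function.uncurry f'))
    (he : energy H T (fun s y => ‖f s y‖ₑ) (fun s y => ‖f s y‖ₑ) < ∞)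
    (he' : energy H T (fun s y => ‖f' s y‖ₑ) (fun s y => ‖f' s y‖ₑ) < ∞) :
    inner ℝ (h.1.toLp Z) (h'.1.toLp Z') = H * (2 * H - 1) *
      ∫ w, f w.1 w.2.2 * f' w.2.1 w.2.2 ∂(energyMeasure H T) := by
  obtain ⟨g, hg, hl⟩ := h.exists_tendsto hW
  obtain ⟨g', hg', hl'⟩ := h'.exists_tendsto hW
  have h1 := hl.inner (𝕜 := ℝ) hl'
  have hm (n) := (g n).measurable_toFun
  have hm' (n) := (g' n).measurable_toFun
  have h2 := tendsto_integral_mul_of_energy hH1 hf hf' hm hm' he he'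
    (fun n => ((g n).inner_integralLp hH hW (g' n)).1)
    (tendsto_energy_of_tendsto_noiseNormSq hH (fun n => (hm n).sub hf) hg)
    (tendsto_energy_of_tendsto_noiseNormSq hH (fun n => (hm' n).sub hf') hg')
  refine tendsto_nhds_unique h1 ((h2.const_mul (H * (2 * H - 1))).congr fun n => ?_)
  rw [((g n).inner_integralLp hH hW (g' n)).2]

end WienerIntegral

end WaveQV

namespace WaveQV

/-! ### Covariance of the increments of the wave solution -/

section WaveIncrements

/-- Half of the indicator function of the band `a ≤ s + |x - y| < b`: the integrand of the increment
of the solution over `[a, b]`. -/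
noncomputable def bandFun (x a b s y : ℝ) : ℝ :=
  if a ≤ s + |x - y| ∧ s + |x - y| < b then 1 / 2 else 0

lemma measurable_waveKernel (t x : ℝ) :
    Measurable (Function.uncurry fun s y => waveKernel (t - s) (x - y)) := by
  have h : MeasurableSet {p : ℝ × ℝ | |x - p.2| < t - p.1} :=
    measurableSet_lt (by fun_prop) (by fun_prop)
  exact Measurable.ite h measurable_const measurable_const

lemma waveKernel_sub_waveKernel {a b : ℝ} (hab : a ≤ b) (x s y : ℝ) :
    waveKernel (b - s) (x - y) - waveKernel (a - s) (x - y) = bandFun x a b s y := by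
  unfold waveKernel bandFun
  split_ifs with h1 h2 h3 h4 h5 <;> first | (norm_num; done) | (exfalso; grind)

lemma waveKernel_zero_sub {s : ℝ} (hs : 0 ≤ s) (x y : ℝ) : waveKernel (0 - s) (x - y) = 0 := by
  rw [waveKernel, if_neg]
  have := abs_nonneg (x - y)
  linarith

lemma measurable_bandFun {a b : ℝ} (hab : a ≤ b) (x : ℝ) :
    Measurable (Function.uncurry (bandFun x a b)) := by
  have := (measurable_waveKernel b x).sub (measurable_waveKernel a x)
  convert! this using 1
  ext p
  exact (waveKernel_sub_waveKernel hab x p.1 p.2).symm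

lemma bandFun_nonneg (x a b s y : ℝ) : 0 ≤ bandFun x a b s y := by
  unfold bandFun; split_ifs <;> norm_num

lemma lintegral_rotate {Φ : ℝ → ℝ → ℝ → ℝ≥0∞}
    (hΦ : Measurable fun w : ℝ × ℝ × ℝ => Φ w.1 w.2.1 w.2.2) :
    ∫⁻ s, ∫⁻ r, ∫⁻ y, Φ s r y = ∫⁻ y, ∫⁻ s, ∫⁻ r, Φ s r y := by
  have h1 (s : ℝ) : ∫⁻ r, ∫⁻ y, Φ s r y = ∫⁻ y, ∫⁻ r, Φ s r y :=
    lintegral_lintegral_swap (hΦ.comp (f := fun p : ℝ × ℝ => (s, p.1, p.2))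
      (by fun_prop)).aemeasurable
  simp_rw [h1]
  refine lintegral_lintegral_swap (Measurable.aemeasurable ?_)
  exact Measurable.lintegral_prod_right' (f := fun p : (ℝ × ℝ) × ℝ => Φ p.1.1 p.2 p.1.2)
    (hΦ.comp (f := fun p : (ℝ × ℝ) × ℝ => (p.1.1, p.2, p.1.2)) (by fun_prop))

/-- For fixed y, shift both times by |x - y|. The bands become the intervals [a, b) and [c, d), the
kernel is unchanged, and nonnegativity of the original times confines y to an interval of length 2
min(p, q). With the two factors 1/2 of the wave kernels this gives 1/2 · min(p, q). -/
lemma lintegral_bandFun_mul (H : ℝ) {T x a b c d : ℝ} (hab : a ≤ b) (hb : b ≤ T)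
    (hcd : c ≤ d) (hd : d ≤ T) :
    ∫⁻ w, ENNReal.ofReal (bandFun x a b w.1 w.2.2 * bandFun x c d w.2.1 w.2.2)
      ∂(energyMeasure H T) =
    ∫⁻ w in Set.Ico a b ×ˢ Set.Ico c d,
      ENNReal.ofReal (1 / 2 * (|w.1 - w.2| ^ (2 * H - 2) * min w.1 w.2)) := by
  have hm : Measurable fun w : ℝ × ℝ × ℝ => bandFun x a b w.1 w.2.2 * bandFun x c d w.2.1 w.2.2 :=
    ((measurable_bandFun hab x).comp (f := fun w : ℝ × ℝ × ℝ => (w.1, w.2.2)) (by fun_prop)).mul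
      ((measurable_bandFun hcd x).comp (f := fun w : ℝ × ℝ × ℝ => (w.2.1, w.2.2)) (by fun_prop))
  -- Only the lower bound 0 on the times has to be recorded: membership in a band already forces
  -- them below b ≤ T or d ≤ T.
  set Φ : ℝ → ℝ → ℝ → ℝ≥0∞ := fun s r y => (Set.Ici (0 : ℝ)).indicator 1 s *
    ((Set.Ici (0 : ℝ)).indicator 1 r * (ENNReal.ofReal (bandFun x a b s y * bandFun x c d r y) *
      ENNReal.ofReal (|s - r| ^ (2 * H - 2)))) with hΦ
  have hI : Measurable ((Set.Ici (0 : ℝ)).indicator (1 : ℝ → ℝ≥0∞)) :=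
    measurable_one.indicator measurableSet_Ici
  have hΦm : Measurable fun w : ℝ × ℝ × ℝ => Φ w.1 w.2.1 w.2.2 :=
    (hI.comp measurable_fst).mul ((hI.comp (measurable_fst.comp measurable_snd)).mul
      (hm.ennreal_ofReal.mul (by fun_prop)))
  have hlow {s y b : ℝ} (h : s + |x - y| < b) (hb : b ≤ T) : s ≤ T := by
    have := abs_nonneg (x - y); linarith
  have e1 : ∫⁻ w, ENNReal.ofReal (bandFun x a b w.1 w.2.2 * bandFun x c d w.2.1 w.2.2)
      ∂(energyMeasure H T) = ∫⁻ s, ∫⁻ r, ∫⁻ y, Φ s r y := by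
    rw [lintegral_energyMeasure _ _ hm.ennreal_ofReal, ← lintegral_indicator measurableSet_Icc]
    refine lintegral_congr fun s => ?_
    by_cases hs : s ∈ Set.Icc 0 T
    · rw [Set.indicator_of_mem hs, ← lintegral_indicator measurableSet_Icc]
      refine lintegral_congr fun r => ?_
      by_cases hr : r ∈ Set.Icc 0 T
      · rw [Set.indicator_of_mem hr]
        refine lintegral_congr fun y => ?_
        simp [hΦ, hs.1, hr.1]
      · rw [Set.indicator_of_notMem hr, ← lintegral_zero (μ := (volume : Measure ℝ))]
        refine lintegral_congr fun y => ?_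
        by_cases hr0 : 0 ≤ r
        · have : bandFun x c d r y = 0 := by
            rw [bandFun, if_neg]
            exact fun h => hr ⟨hr0, hlow h.2 hd⟩
          simp [hΦ, this]
        · simp [hΦ, hr0]
    · rw [Set.indicator_of_notMem hs]
      symm
      rw [← lintegral_zero (μ := (volume : Measure ℝ))]
      refine lintegral_congr fun r => ?_
      rw [← lintegral_zero (μ := (volume : Measure ℝ))]
      refine lintegral_congr fun y => ?_
      by_cases hs0 : 0 ≤ s
      · have : bandFun x a b s y = 0 := by
          rw [bandFun, if_neg]
          exact fun h => hs ⟨hs0, hlow h.2 hb⟩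
        simp [hΦ, this]
      · simp [hΦ, hs0]
  have e2 (y : ℝ) : ∫⁻ s, ∫⁻ r, Φ s r y =
      ∫⁻ p, ∫⁻ q, Φ (p - |x - y|) (q - |x - y|) y := by
    rw [← lintegral_sub_right_eq_self _ |x - y|]
    refine lintegral_congr fun p => ?_
    rw [← lintegral_sub_right_eq_self _ |x - y|]
  have hΨm : Measurable fun w : ℝ × ℝ × ℝ =>
      Φ (w.1 - |x - w.2.2|) (w.2.1 - |x - w.2.2|) w.2.2 :=
    hΦm.comp (f := fun w : ℝ × ℝ × ℝ => (w.1 - |x - w.2.2|, w.2.1 - |x - w.2.2|, w.2.2))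
      (by fun_prop)
  rw [e1, lintegral_rotate hΦm]
  simp_rw [e2]
  rw [← lintegral_rotate (Φ := fun p q y => Φ (p - |x - y|) (q - |x - y|) y) hΨm,
    Measure.volume_eq_prod, ← Measure.prod_restrict, lintegral_prod _ (by fun_prop),
    ← lintegral_indicator measurableSet_Ico]
  refine lintegral_congr fun p => ?_
  have hpt (p q y : ℝ) : Φ (p - |x - y|) (q - |x - y|) y = (Set.Ico a b).indicator (fun p =>
      (Set.Ico c d).indicator (fun q => ENNReal.ofReal (1 / 4 * |p - q| ^ (2 * H - 2)) *
        (Set.Icc (x - min p q) (x + min p q)).indicator 1 y) q) p := by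
    have hiff : y ∈ Set.Icc (x - min p q) (x + min p q) ↔ |x - y| ≤ p ∧ |x - y| ≤ q := by
      rw [← le_min_iff, abs_le, Set.mem_Icc]
      constructor <;> rintro ⟨h1, h2⟩ <;> constructor <;> linarith
    simp only [hΦ, Set.indicator_apply, bandFun, sub_add_cancel, Set.mem_Ici, sub_nonneg, hiff,
      Set.mem_Ico, Pi.one_apply, sub_sub_sub_cancel_right]
    by_cases h1 : |x - y| ≤ p <;> by_cases h2 : |x - y| ≤ q <;>
    by_cases h3 : a ≤ p ∧ p < b <;> by_cases h4 : c ≤ q ∧ q < d <;> simp [h1, h2, h3, h4]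
    congr 1
    rw [← ENNReal.mul_inv (by simp) (by simp)]
    norm_num
  simp_rw [hpt]
  by_cases hp : p ∈ Set.Ico a b
  · simp only [Set.indicator_of_mem hp]
    rw [← lintegral_indicator measurableSet_Ico]
    refine lintegral_congr fun q => ?_
    by_cases hq : q ∈ Set.Ico c d
    · simp only [Set.indicator_of_mem hq]
      rw [lintegral_const_mul' _ _ ENNReal.ofReal_ne_top, lintegral_indicator_one measurableSet_Icc,
        Real.volume_Icc, ← ENNReal.ofReal_mul (by positivity)]
      congr 1
      ring
    · simp only [Set.indicator_of_notMem hq, lintegral_zero]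
  · simp only [Set.indicator_of_notMem hp, lintegral_zero]

variable {Ω : Type*} [MeasurableSpace Ω] {P : Measure Ω} {H T : ℝ} {W u : ℝ → ℝ → Ω → ℝ}

lemma ae_energyMeasure_nonneg (H T : ℝ) : ∀ᵐ w ∂(energyMeasure H T), 0 ≤ w.1 ∧ 0 ≤ w.2.1 := by
  have h : ∀ᵐ t ∂(volume.restrict (Set.Icc 0 T)), (0 : ℝ) ≤ t := by
    filter_upwards [ae_restrict_mem measurableSet_Icc] with t ht using ht.1
  refine (withDensity_absolutelyContinuous _ _).ae_le ?_
  have h1 := Measure.quasiMeasurePreserving_fst (μ := volume.restrict (Set.Icc 0 T))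
    (ν := (volume.restrict (Set.Icc 0 T)).prod (volume : Measure ℝ)) |>.ae h
  have h2 := Measure.quasiMeasurePreserving_snd (μ := volume.restrict (Set.Icc 0 T))
    (ν := (volume.restrict (Set.Icc 0 T)).prod (volume : Measure ℝ)) |>.ae
      (Measure.quasiMeasurePreserving_fst.ae h)
  filter_upwards [h1, h2] with w a b using ⟨a, b⟩

lemma lintegral_Ico_prod_lt_top (hH : 1 / 2 < H) (hH1 : H < 1) {a b c d : ℝ} (ha : 0 ≤ a)
    (hab : a ≤ b) (hcd : c ≤ d) :
    ∫⁻ w in Set.Ico a b ×ˢ Set.Ico c d,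
      ENNReal.ofReal (1 / 2 * (|w.1 - w.2| ^ (2 * H - 2) * min w.1 w.2)) < ∞ := by
  calc _ ≤ ∫⁻ w in Set.Ico a b ×ˢ Set.Ico c d,
        ENNReal.ofReal (1 / 2 * b) * ENNReal.ofReal (|w.1 - w.2| ^ (2 * H - 2)) := by
        refine setLIntegral_mono' (measurableSet_Ico.prod measurableSet_Ico) fun w hw => ?_
        have hb : 0 ≤ b := ha.trans hab
        rw [← ENNReal.ofReal_mul (by positivity)]
        refine ENNReal.ofReal_le_ofReal ?_
        have h1 : min w.1 w.2 ≤ b := (min_le_left _ _).trans hw.1.2.le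
        have h2 : 0 ≤ |w.1 - w.2| ^ (2 * H - 2) := by positivity
        nlinarith
    _ < ∞ := by
        rw [lintegral_const_mul' _ _ ENNReal.ofReal_ne_top]
        refine ENNReal.mul_lt_top ENNReal.ofReal_lt_top ?_
        rw [Measure.volume_eq_prod, ← Measure.prod_restrict, lintegral_prod _ (by fun_prop)]
        simp_rw [restrict_Ico_eq_restrict_Ioc]
        rw [(lintegral_Ioc_abs_sub_rpow hH hab hcd).2]
        exact ENNReal.ofReal_lt_top

/-- The covariance of the increments integrands. -/
lemma integral_bandFun_mul (hH : 1 / 2 < H) (hH1 : H < 1) {x a b c d : ℝ} (ha : 0 ≤ a)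
    (hab : a ≤ b) (hb : b ≤ T) (hc : 0 ≤ c) (hcd : c ≤ d) (hd : d ≤ T) :
    Integrable (fun w : ℝ × ℝ × ℝ => bandFun x a b w.1 w.2.2 * bandFun x c d w.2.1 w.2.2)
      (energyMeasure H T) ∧
    H * (2 * H - 1) * ∫ w, bandFun x a b w.1 w.2.2 * bandFun x c d w.2.1 w.2.2
      ∂(energyMeasure H T) = ∫ w in Set.Ico a b ×ˢ Set.Ico c d, waveCov H w.1 w.2 := by
  have hm : Measurable fun w : ℝ × ℝ × ℝ => bandFun x a b w.1 w.2.2 * bandFun x c d w.2.1 w.2.2 :=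
    ((measurable_bandFun hab x).comp (f := fun w : ℝ × ℝ × ℝ => (w.1, w.2.2)) (by fun_prop)).mul
      ((measurable_bandFun hcd x).comp (f := fun w : ℝ × ℝ × ℝ => (w.2.1, w.2.2)) (by fun_prop))
  have hnn (w : ℝ × ℝ × ℝ) : 0 ≤ bandFun x a b w.1 w.2.2 * bandFun x c d w.2.1 w.2.2 :=
    mul_nonneg (bandFun_nonneg _ _ _ _ _) (bandFun_nonneg _ _ _ _ _)
  have hl := lintegral_bandFun_mul H (x := x) hab hb hcd hd
  refine ⟨⟨hm.aestronglyMeasurable, ?_⟩, ?_⟩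
  · rw [hasFiniteIntegral_iff_ofReal (ae_of_all _ hnn), hl]
    exact lintegral_Ico_prod_lt_top hH hH1 ha hab hcd
  · have hnn2 : ∀ᵐ w ∂((volume : Measure (ℝ × ℝ)).restrict (Set.Ico a b ×ˢ Set.Ico c d)),
        0 ≤ 1 / 2 * (|w.1 - w.2| ^ (2 * H - 2) * min w.1 w.2) := by
      filter_upwards [ae_restrict_mem (measurableSet_Ico.prod measurableSet_Ico)] with w hw
      have : 0 ≤ min w.1 w.2 := le_min (ha.trans hw.1.1) (hc.trans hw.2.1)
      positivity
    have hm2 : Measurable fun w : ℝ × ℝ => 1 / 2 * (|w.1 - w.2| ^ (2 * H - 2) * min w.1 w.2) := by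
      fun_prop
    rw [integral_eq_lintegral_of_nonneg_ae (ae_of_all _ hnn) hm.aestronglyMeasurable, hl,
      ← integral_eq_lintegral_of_nonneg_ae hnn2 hm2.aestronglyMeasurable, ← integral_const_mul]
    refine integral_congr_ae (ae_of_all _ fun w => ?_)
    simp only [waveCov]
    ring

/-- The measure lives on nonnegative times, where the wave kernel at t is the band over [0, t); its
energy is therefore a case of the band computation. -/
lemma energy_waveKernel_lt_top (hH : 1 / 2 < H) (hH1 : H < 1) {t : ℝ} (ht : t ∈ Set.Icc 0 T)
    (x : ℝ) : energy H T (fun s y => ‖waveKernel (t - s) (x - y)‖ₑ)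
      (fun s y => ‖waveKernel (t - s) (x - y)‖ₑ) < ∞ := by
  have h := (integral_bandFun_mul hH hH1 (x := x) le_rfl ht.1 ht.2 le_rfl ht.1 ht.2).1.2
  rw [hasFiniteIntegral_iff_enorm] at h
  refine lt_of_eq_of_lt (lintegral_congr_ae ?_) h
  filter_upwards [ae_energyMeasure_nonneg H T] with w hw
  rw [enorm_mul, ← waveKernel_sub_waveKernel ht.1, ← waveKernel_sub_waveKernel ht.1,
    waveKernel_zero_sub hw.1, waveKernel_zero_sub hw.2, sub_zero, sub_zero]

/-- The covariance of the time increments of the mild solution. -/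
theorem inner_increment (hH : 1 / 2 < H) (hH1 : H < 1) (hW : IsFractionalWhiteNoise P H T W)
    (hu : IsMildSolution P H T W u) {x a b c d : ℝ} (ha : a ∈ Set.Icc 0 T) (hb : b ∈ Set.Icc 0 T)
    (hc : c ∈ Set.Icc 0 T) (hd : d ∈ Set.Icc 0 T) (hab : a ≤ b) (hcd : c ≤ d) :
    inner ℝ ((hu b hb x).1.toLp (u b x) - (hu a ha x).1.toLp (u a x))
      ((hu d hd x).1.toLp (u d x) - (hu c hc x).1.toLp (u c x)) =
      ∫ w in Set.Ico a b ×ˢ Set.Ico c d, waveCov H w.1 w.2 := by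
  have hin {t s : ℝ} (ht : t ∈ Set.Icc 0 T) (hs : s ∈ Set.Icc 0 T) :=
    (hu t ht x).inner_eq hH hH1 hW (hu s hs x) (measurable_waveKernel t x)
      (measurable_waveKernel s x) (energy_waveKernel_lt_top hH hH1 ht x)
      (energy_waveKernel_lt_top hH hH1 hs x)
  have hi {t s : ℝ} (ht : t ∈ Set.Icc 0 T) (hs : s ∈ Set.Icc 0 T) :=
    integrable_mul_of_energy_lt_top hH1 (measurable_waveKernel t x)
      (measurable_waveKernel s x) (energy_waveKernel_lt_top hH hH1 ht x)
      (energy_waveKernel_lt_top hH hH1 hs x)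
  rw [← (integral_bandFun_mul hH hH1 (x := x) ha.1 hab hb.2 hc.1 hcd hd.2).2]
  simp only [inner_sub_left, inner_sub_right]
  rw [hin hb hd, hin ha hd, hin hb hc, hin ha hc]
  simp_rw [← waveKernel_sub_waveKernel hab, ← waveKernel_sub_waveKernel hcd, sub_mul, mul_sub]
  rw [integral_sub, integral_sub (hi hb hd) (hi hb hc), integral_sub (hi ha hd) (hi ha hc)]
  · ring
  · exact (hi hb hd).sub (hi hb hc)
  · exact (hi ha hd).sub (hi ha hc)

end WaveIncrements

end WaveQV

namespace WaveQV

/-! ### Cumulant series and their passage to L² limits -/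

section Cumulants

/-- Each factor has logarithm -log(1 - 2tl)/2 - tl; the centring term cancels the linear term of the
expansion, so the series starts at order 2. -/
lemma hasSum_log_prod {ι : Type*} [Fintype ι] {l : ι → ℝ} {t : ℝ} (ht : ∀ a, |2 * t * l a| < 1) :
    HasSum (fun n : ℕ => (2 * t) ^ (n + 2) / (2 * (n + 2)) * ∑ a, l a ^ (n + 2))
      (Real.log (∏ a, (Real.exp (-(t * l a)) * (√(1 - 2 * t * l a))⁻¹))) := by
  have hpos (a) : 0 < 1 - 2 * t * l a := by linarith [(abs_lt.1 (ht a)).2]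
  rw [Real.log_prod fun a _ => (mul_pos (Real.exp_pos _)
    (inv_pos.2 (Real.sqrt_pos.2 (hpos a)))).ne']
  simp_rw [Finset.mul_sum]
  refine hasSum_sum fun a _ => ?_
  have h := (hasSum_nat_add_iff' 1).2 (Real.hasSum_pow_div_log_of_abs_lt_one (ht a))
  rw [Real.log_mul (Real.exp_pos _).ne' (inv_pos.2 (Real.sqrt_pos.2 (hpos a))).ne', Real.log_exp,
    Real.log_inv, Real.log_sqrt (hpos a).le]
  convert! h.mul_left (1 / 2) using 1
  · ext n
    push_cast
    field_simp
    ring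
  · simp
    ring

lemma abs_le_of_sum_sq_le {ι : Type*} [Fintype ι] {l : ι → ℝ} {ρ : ℝ} (hρ : 0 ≤ ρ)
    (h : ∑ a, l a ^ 2 ≤ ρ ^ 2) (a : ι) : |l a| ≤ ρ :=
  abs_le_of_sq_le_sq ((Finset.single_le_sum
    (f := fun a => l a ^ 2) (fun _ _ => sq_nonneg _) (Finset.mem_univ a)).trans h) hρ

/-- Since |l_a| ≤ ρ, the sum of squares controls all higher power sums, however many eigenvalues
there are. -/
lemma abs_sum_pow_le {ι : Type*} [Fintype ι] {l : ι → ℝ} {ρ : ℝ} (hρ : 0 ≤ ρ)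
    (h : ∑ a, l a ^ 2 ≤ ρ ^ 2) (n : ℕ) : |∑ a, l a ^ (n + 2)| ≤ ρ ^ (n + 2) := by
  have hl := abs_le_of_sum_sq_le hρ h
  calc |∑ a, l a ^ (n + 2)| ≤ ∑ a, |l a ^ (n + 2)| := Finset.abs_sum_le_sum_abs _ _
    _ ≤ ∑ a, ρ ^ n * l a ^ 2 := by
        refine Finset.sum_le_sum fun a _ => ?_
        rw [abs_pow, pow_add, sq_abs]
        gcongr
        exact hl a
    _ ≤ ρ ^ (n + 2) := by
        rw [← Finset.mul_sum, pow_add]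
        gcongr

/-- A geometric majorant depending on the eigenvalues only through ρ, which serves both to bound
exponential moments and to take limits term by term. -/
lemma norm_cumulant_term_le {t ρ p : ℝ} {n : ℕ} (hρ : 0 ≤ ρ) (ht : 4 * |t| * ρ ≤ 1)
    (hp : |p| ≤ ρ ^ (n + 2)) : ‖(2 * t) ^ (n + 2) / (2 * (n + 2)) * p‖ ≤ (1 / 2 : ℝ) ^ (n + 2) := by
  rw [norm_mul, norm_div, norm_pow, norm_mul, Real.norm_eq_abs, Real.norm_eq_abs,
    Real.norm_eq_abs, Real.norm_eq_abs, abs_two, abs_of_nonneg (by positivity : (0 : ℝ) ≤ 2 * (n + 2))]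
  calc (2 * |t|) ^ (n + 2) / (2 * (n + 2)) * |p| ≤ (2 * |t|) ^ (n + 2) * ρ ^ (n + 2) := by
        gcongr
        refine div_le_self (by positivity) ?_
        have : (0 : ℝ) ≤ n := n.cast_nonneg
        linarith
    _ = (2 * |t| * ρ) ^ (n + 2) := (mul_pow _ _ _).symm
    _ ≤ (1 / 2) ^ (n + 2) := by
        gcongr
        linarith

lemma summable_half_pow : Summable fun n : ℕ => (1 / 2 : ℝ) ^ (n + 2) :=
  (summable_nat_add_iff 2).2 summable_geometric_two

lemma tsum_half_pow_le : ∑' n : ℕ, (1 / 2 : ℝ) ^ (n + 2) ≤ 1 := by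
  have h := summable_geometric_two.sum_add_tsum_nat_add 2
  rw [tsum_geometric_two] at h
  norm_num [Finset.sum_range_succ] at h ⊢
  linarith

/-- Power series of a function determine its iterated derivatives. -/
lemma iteratedDeriv_eq_of_hasSum {f : ℝ → ℝ} {c : ℕ → ℝ} {δ : ℝ} (hδ : 0 < δ)
    (h : ∀ t, |t| < δ → HasSum (fun n => t ^ n * c n) (f t)) (n : ℕ) :
    iteratedDeriv n f 0 = n.factorial * c n := by
  have hf : HasFPowerSeriesAt f (FormalMultilinearSeries.ofScalars ℝ c) 0 := by
    rw [hasFPowerSeriesAt_iff]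
    filter_upwards [Metric.ball_mem_nhds 0 hδ] with t ht
    rw [mem_ball_zero_iff, Real.norm_eq_abs] at ht
    simpa [FormalMultilinearSeries.coeff_ofScalars] using h t ht
  have h2 := hf.analyticAt.hasFPowerSeriesAt.eq_formalMultilinearSeries hf
  have h3 := congrArg (fun p => FormalMultilinearSeries.coeff p n) h2
  simp only [FormalMultilinearSeries.coeff_ofScalars] at h3
  rw [← h3]
  field_simp

variable {Ω : Type*} [MeasurableSpace Ω] {P : Measure Ω}

lemma abs_exp_sub_exp_le (a b : ℝ) :
    |Real.exp a - Real.exp b| ≤ |a - b| * (Real.exp a + Real.exp b) := by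
  wlog hab : b ≤ a generalizing a b
  · rw [abs_sub_comm, abs_sub_comm a, add_comm]
    exact this b a (le_of_not_ge hab)
  have h1 := Real.exp_pos a
  have h2 := Real.exp_pos b
  rw [abs_of_nonneg (by linarith [Real.exp_le_exp.2 hab]), abs_of_nonneg (by linarith)]
  have h3 := Real.add_one_le_exp (b - a)
  rw [Real.exp_sub] at h3
  have h4 : (b - a + 1) * Real.exp a ≤ Real.exp b := by
    rw [le_div_iff₀ h1] at h3
    exact h3
  nlinarith [mul_nonneg (sub_nonneg.2 hab) h2.le]

/-- `L²` convergence together with a bound on the exponential moments at `2t` gives convergence of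
the exponential moments at `t`. -/
lemma tendsto_mgf_of_tendsto_Lp {S : ℕ → Lp ℝ 2 P} {ζ : Lp ℝ 2 P} (h : Tendsto S atTop (𝓝 ζ))
    {t C : ℝ} (hC : ∀ N, ∫⁻ ω, ENNReal.ofReal (Real.exp (2 * t * S N ω)) ∂P ≤ ENNReal.ofReal C)
    [IsFiniteMeasure P] :
    Integrable (fun ω => Real.exp (t * ζ ω)) P ∧
      Tendsto (fun N => mgf (S N) P t) atTop (𝓝 (mgf ζ P t)) := by
  have h1 := (Lp.tendsto_Lp_iff_tendsto_eLpNorm' S ζ).1 h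
  have hm (ξ : Lp ℝ 2 P) : Measurable ξ := (Lp.stronglyMeasurable ξ).measurable
  have hme (ξ : Lp ℝ 2 P) : Measurable fun ω => Real.exp (t * ξ ω) := by
    have := hm ξ; fun_prop
  -- Fatou along an almost surely convergent subsequence carries the bound to the limit.
  have hζ : ∫⁻ ω, ENNReal.ofReal (Real.exp (2 * t * ζ ω)) ∂P ≤ ENNReal.ofReal C := by
    obtain ⟨φ, -, hφ⟩ := (tendstoInMeasure_of_tendsto_Lp h).exists_seq_tendsto_ae
    have e : ∫⁻ ω, ENNReal.ofReal (Real.exp (2 * t * ζ ω)) ∂P =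
        ∫⁻ ω, liminf (fun n => ENNReal.ofReal (Real.exp (2 * t * S (φ n) ω))) atTop ∂P := by
      refine lintegral_congr_ae ?_
      filter_upwards [hφ] with ω hω
      refine (Tendsto.liminf_eq ?_).symm
      exact ENNReal.tendsto_ofReal ((Real.continuous_exp.tendsto _).comp (hω.const_mul (2 * t)))
    rw [e]
    refine (lintegral_liminf_le fun n => ?_).trans ?_
    · have := hm (S (φ n)); fun_prop
    · refine liminf_le_of_frequently_le' (Frequently.of_forall fun n => hC (φ n))
  have hnorm {ξ : Lp ℝ 2 P}
      (hξ : ∫⁻ ω, ENNReal.ofReal (Real.exp (2 * t * ξ ω)) ∂P ≤ ENNReal.ofReal C) :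
      eLpNorm (fun ω => Real.exp (t * ξ ω)) 2 P ≤ ENNReal.ofReal C ^ (1 / 2 : ℝ) := by
    rw [eLpNorm_eq_lintegral_rpow_enorm_toReal (by simp) (by simp)]
    simp only [ENNReal.toReal_ofNat]
    gcongr
    refine le_trans (le_of_eq (lintegral_congr fun ω => ?_)) hξ
    rw [Real.enorm_eq_ofReal (Real.exp_pos _).le, ENNReal.ofReal_rpow_of_nonneg (Real.exp_pos _).le
      (by norm_num), ← Real.exp_mul]
    ring_nf
  have hmem {ξ : Lp ℝ 2 P}
      (hξ : ∫⁻ ω, ENNReal.ofReal (Real.exp (2 * t * ξ ω)) ∂P ≤ ENNReal.ofReal C) :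
      MemLp (fun ω => Real.exp (t * ξ ω)) 2 P :=
    ⟨(hme ξ).aestronglyMeasurable, (hnorm hξ).trans_lt
      (ENNReal.rpow_lt_top_of_nonneg (by norm_num) ENNReal.ofReal_ne_top)⟩
  refine ⟨(hmem hζ).integrable (by norm_num), ?_⟩
  refine tendsto_integral_of_L1 _ (hme ζ).aestronglyMeasurable
    (Eventually.of_forall fun N => (hmem (hC N)).integrable (by norm_num)) ?_
  set D : ℝ≥0∞ := ENNReal.ofReal C ^ (1 / 2 : ℝ) + ENNReal.ofReal C ^ (1 / 2 : ℝ) with hD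
  have hDtop : D ≠ ∞ := by
    simp [hD]
  have hlim : Tendsto (fun N => ‖t‖ₑ * (D * eLpNorm (⇑(S N) - ⇑ζ) 2 P)) atTop (𝓝 0) := by
    have := ENNReal.Tendsto.const_mul (a := ‖t‖ₑ)
      (ENNReal.Tendsto.const_mul (a := D) h1 (Or.inr hDtop)) (Or.inr enorm_ne_top)
    simpa using this
  refine tendsto_of_tendsto_of_tendsto_of_le_of_le tendsto_const_nhds hlim
    (fun _ => zero_le) fun N => ?_
  -- The factor |S N - ζ| tends to 0 in L², and the sum of exponentials is bounded in L² by the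
  -- moments at 2t; Hölder then gives L¹ convergence.
  have hb (ω : Ω) : ‖Real.exp (t * S N ω) - Real.exp (t * ζ ω)‖ₑ ≤
      ‖t‖ₑ * ‖((fun ω => Real.exp (t * S N ω) + Real.exp (t * ζ ω)) • (⇑(S N) - ⇑ζ)) ω‖ₑ := by
    rw [← enorm_mul, ← ofReal_norm, ← ofReal_norm]
    refine ENNReal.ofReal_le_ofReal ((abs_exp_sub_exp_le _ _).trans (le_of_eq ?_))
    have hpos := add_pos (Real.exp_pos (t * S N ω)) (Real.exp_pos (t * ζ ω))
    simp only [Pi.smul_apply', Pi.sub_apply, smul_eq_mul, norm_mul, Real.norm_eq_abs]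
    rw [← mul_sub, abs_mul, abs_of_pos hpos]
    ring
  refine (lintegral_mono hb).trans ?_
  rw [lintegral_const_mul' _ _ enorm_ne_top, ← eLpNorm_one_eq_lintegral_enorm]
  gcongr
  refine (eLpNorm_smul_le_mul_eLpNorm (p := 2) (q := 2) (r := 1) ?_ ?_).trans ?_
  · exact ((hm _).sub (hm _)).aestronglyMeasurable
  · exact ((hme _).add (hme _)).aestronglyMeasurable
  · gcongr
    refine (eLpNorm_add_le (hme _).aestronglyMeasurable (hme _).aestronglyMeasurable
      (by norm_num)).trans ?_
    rw [hD]
    gcongr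
    · exact hnorm (hC N)
    · exact hnorm hζ

/-- The cumulant generating function of an `L²` limit of quadratic Gaussian functionals. -/
theorem hasSum_cgf_of_tendsto_Lp [IsProbabilityMeasure P] {S : ℕ → Lp ℝ 2 P} {ζ : Lp ℝ 2 P}
    (h : Tendsto S atTop (𝓝 ζ)) {l : ∀ N : ℕ, Fin N → ℝ} {p : ℕ → ℝ} {ρ : ℝ} (hρ : 0 ≤ ρ)
    (hS : ∀ N t, (∀ a, 2 * t * l N a < 1) → Integrable (fun ω => Real.exp (t * S N ω)) P ∧
      mgf (S N) P t = ∏ a, (Real.exp (-(t * l N a)) * (√(1 - 2 * t * l N a))⁻¹))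
    (hl : ∀ N, ∑ a, l N a ^ 2 ≤ ρ ^ 2)
    (hp : ∀ n, Tendsto (fun N => ∑ a, l N a ^ (n + 2)) atTop (𝓝 (p n))) {t : ℝ}
    (ht : 8 * |t| * ρ ≤ 1) :
    Integrable (fun ω => Real.exp (t * ζ ω)) P ∧
      HasSum (fun n : ℕ => (2 * t) ^ (n + 2) / (2 * (n + 2)) * p n) (cgf ζ P t) := by
  have hsmall {s : ℝ} (hs : 4 * |s| * ρ ≤ 1) (N) (a) : |2 * s * l N a| < 1 := by
    have h1 := abs_le_of_sum_sq_le hρ (hl N) a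
    rw [abs_mul, abs_mul, abs_two]
    have : 2 * |s| * |l N a| ≤ 2 * |s| * ρ := by gcongr
    linarith
  have hsum {s : ℝ} (hs : 4 * |s| * ρ ≤ 1) (N : ℕ) : HasSum
      (fun n : ℕ => (2 * s) ^ (n + 2) / (2 * (n + 2)) * ∑ a, l N a ^ (n + 2)) (cgf (S N) P s) := by
    rw [cgf, (hS N s fun a => (abs_lt.1 (hsmall hs N a)).2).2]
    exact hasSum_log_prod (hsmall hs N)
  have hterm {s : ℝ} (hs : 4 * |s| * ρ ≤ 1) (N n : ℕ) :
      ‖(2 * s) ^ (n + 2) / (2 * (n + 2)) * ∑ a, l N a ^ (n + 2)‖ ≤ (1 / 2 : ℝ) ^ (n + 2) :=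
    norm_cumulant_term_le hρ hs (abs_sum_pow_le hρ (hl N) n)
  have ht4 : 4 * |t| * ρ ≤ 1 := by nlinarith [mul_nonneg (abs_nonneg t) hρ]
  have ht2 : 4 * |2 * t| * ρ ≤ 1 := by
    rw [abs_mul, abs_two]
    linarith
  -- At 2t the cumulant series is at most the sum of (1/2)^(n+2), hence at most 1, so e bounds the
  -- moments uniformly in N. The moments at 2t are why 8|t|ρ ≤ 1 is assumed, not only 4|t|ρ ≤ 1.
  have hlim := tendsto_mgf_of_tendsto_Lp h (t := t) (C := Real.exp 1) fun N => by
    have hi := (hS N (2 * t) fun a => (abs_lt.1 (hsmall ht2 N a)).2).1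
    rw [← ofReal_integral_eq_lintegral_ofReal hi (ae_of_all _ fun _ => (Real.exp_pos _).le)]
    refine ENNReal.ofReal_le_ofReal ?_
    change mgf (S N) P (2 * t) ≤ _
    rw [← Real.exp_log (mgf_pos hi)]
    refine Real.exp_le_exp.2 ?_
    change cgf (S N) P (2 * t) ≤ 1
    rw [← (hsum ht2 N).tsum_eq]
    exact ((hsum ht2 N).summable.tsum_le_tsum (fun n => (le_abs_self _).trans (hterm ht2 N n))
      summable_half_pow).trans tsum_half_pow_le
  refine ⟨hlim.1, ?_⟩
  have hpn (n) : |p n| ≤ ρ ^ (n + 2) :=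
    le_of_tendsto (hp n).abs (Eventually.of_forall fun N => abs_sum_pow_le hρ (hl N) n)
  have hs : Summable fun n : ℕ => (2 * t) ^ (n + 2) / (2 * (n + 2)) * p n :=
    Summable.of_norm_bounded summable_half_pow fun n => norm_cumulant_term_le hρ ht4 (hpn n)
  have h1 := tendsto_tsum_of_dominated_convergence summable_half_pow
    (fun n => (hp n).const_mul ((2 * t) ^ (n + 2) / (2 * (n + 2))))
    (Eventually.of_forall fun N n => hterm ht4 N n)
  simp_rw [fun N => (hsum ht4 N).tsum_eq] at h1
  have h2 : Tendsto (fun N => cgf (S N) P t) atTop (𝓝 (cgf ζ P t)) :=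
    (Real.continuousAt_log (mgf_pos hlim.1).ne').tendsto.comp hlim.2
  rw [tendsto_nhds_unique h2 h1]
  exact hs.hasSum

end Cumulants

end WaveQV

namespace WaveQV

/-! ### Reading off cumulants; the Gaussian test -/

section Cumulants

variable {Ω : Type*} [MeasurableSpace Ω] {P : Measure Ω}

lemma zero_mem_interior_integrableExpSet {X : Ω → ℝ} {δ : ℝ} (hδ : 0 < δ)
    (h : ∀ t, |t| < δ → Integrable (fun ω => Real.exp (t * X ω)) P) :
    (0 : ℝ) ∈ interior (integrableExpSet X P) := by
  rw [mem_interior_iff_mem_nhds]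
  filter_upwards [Metric.ball_mem_nhds 0 hδ] with t ht
  rw [mem_ball_zero_iff, Real.norm_eq_abs] at ht
  exact h t ht

/-- The coefficient of t^m with m = n + 2 is (2c)^m/(2m) · p n, and multiplying by m! leaves 2^(m-1)
c^m (m-1)! p n. -/
lemma cumulant_const_mul_eq {X : Ω → ℝ} {p : ℕ → ℝ} {δ : ℝ} (hδ : 0 < δ)
    (h : ∀ t, |t| < δ →
      HasSum (fun n : ℕ => (2 * t) ^ (n + 2) / (2 * (n + 2)) * p n) (cgf X P t))
    {c : ℝ} (hc : 0 < c) (n : ℕ) :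
    cumulant (fun ω => c * X ω) P (n + 2) =
      2 ^ (n + 1) * c ^ (n + 2) * ((n + 1).factorial : ℝ) * p n := by
  have hs (t : ℝ) (ht : |t| < δ / c) : HasSum (fun n : ℕ => t ^ n *
      (if n < 2 then 0 else (2 * c) ^ n / (2 * n) * p (n - 2)))
      (cgf (fun ω => c * X ω) P t) := by
    have h1 := h (c * t) (by rw [abs_mul, abs_of_pos hc]; rwa [lt_div_iff₀' hc] at ht)
    rw [← hasSum_nat_add_iff' 2]
    have e : cgf (fun ω => c * X ω) P t = cgf X P (c * t) := by
      rw [cgf, cgf, mgf_const_mul]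
    rw [e]
    convert! h1 using 1
    · ext n
      simp only [Nat.add_sub_cancel, if_neg (by omega : ¬ n + 2 < 2)]
      push_cast
      ring
    · simp [Finset.sum_range_succ]
  rw [cumulant, iteratedDeriv_eq_of_hasSum (div_pos hδ hc) hs, if_neg (by omega),
    Nat.factorial_succ, Nat.add_sub_cancel]
  push_cast
  have : (n : ℝ) + 1 + 1 ≠ 0 := by positivity
  have : (n : ℝ) + 2 ≠ 0 := by positivity
  field_simp
  ring

/-- The cumulant generating function of a Gaussian variable is a polynomial of degree at most 2. -/
lemma not_hasGaussianLaw_of_cumulant_ne_zero {X : Ω → ℝ} (h : cumulant X P 3 ≠ 0) :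
    ¬ HasGaussianLaw X P := by
  intro hX
  apply h
  have e : cgf X P = fun t => (∫ ω, X ω ∂P) * t + Var[X; P].toNNReal * t ^ 2 / 2 :=
    funext (cgf_gaussianReal hX.map_eq_gaussianReal)
  rw [cumulant, e]
  generalize ∫ ω, X ω ∂P = a
  generalize (Var[X; P].toNNReal : ℝ) = v
  have h1 := iteratedDeriv_eq_of_hasSum (n := 3) (δ := 1) one_pos
    (f := fun t => a * t + v * t ^ 2 / 2)
    (c := fun n => if n = 1 then a else if n = 2 then v / 2 else 0) fun t _ => by
      have h2 := hasSum_sum_of_ne_finset_zero (L := SummationFilter.unconditional ℕ)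
        (f := fun n => t ^ n * (if n = 1 then a else if n = 2 then v / 2 else 0))
        (s := Finset.range 3) fun n hn => by
          simp only [Finset.mem_range, not_lt] at hn
          rw [if_neg (by omega), if_neg (by omega), mul_zero]
      convert! h2 using 1
      simp [Finset.sum_range_succ]
      ring
  simpa using h1

lemma cumulant_congr {X Y : Ω → ℝ} (h : X =ᵐ[P] Y) (m : ℕ) : cumulant X P m = cumulant Y P m := by
  have : cgf X P = cgf Y P := funext fun t => by rw [cgf, cgf, mgf_congr h]
  rw [cumulant, this, cumulant]

end Cumulants

end WaveQV

namespace WaveQV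

/-! ### L² convergence of the quadratic functionals -/

section Limit

local notation "⟪" x ", " y "⟫" => inner ℝ x y

variable {Ω : Type*} [MeasurableSpace Ω] {P : Measure Ω} {G : Submodule ℝ (Lp ℝ 2 P)}

lemma IsGaussianSpace.memLp_sq (hG : IsGaussianSpace P G) {ξ : Lp ℝ 2 P} (hξ : ξ ∈ G) :
    MemLp (fun ω => ξ ω ^ 2) 2 P := by
  have hm : Measurable ξ := (Lp.stronglyMeasurable ξ).measurable
  rw [memLp_two_iff_integrable_sq (by fun_prop)]
  refine (hG.integrable_sq_mul_sq hξ hξ).congr (ae_of_all _ fun ω => ?_)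
  simp only
  ring

variable [IsProbabilityMeasure P]

lemma IsGaussianSpace.memLp_wickSq (hG : IsGaussianSpace P G) {ξ : Lp ℝ 2 P} (hξ : ξ ∈ G) :
    MemLp (fun ω => ξ ω ^ 2 - ‖ξ‖ ^ 2) 2 P :=
  (hG.memLp_sq hξ).sub (memLp_const _)

/-- The centred square `ξ² - ‖ξ‖²` of an element of a Gaussian space. -/
noncomputable def wickSq (hG : IsGaussianSpace P G) (ξ : G) : Lp ℝ 2 P :=
  (hG.memLp_wickSq ξ.2).toLp _

lemma coeFn_wickSq (hG : IsGaussianSpace P G) (ξ : G) :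
    wickSq hG ξ =ᵐ[P] fun ω => (ξ : Lp ℝ 2 P) ω ^ 2 - ‖(ξ : Lp ℝ 2 P)‖ ^ 2 :=
  MemLp.coeFn_toLp _

/-- Centring removes the product of the variances from `integral_sq_mul_sq`. -/
lemma inner_wickSq (hG : IsGaussianSpace P G) (ξ η : G) :
    ⟪wickSq hG ξ, wickSq hG η⟫ = 2 * ⟪(ξ : Lp ℝ 2 P), (η : Lp ℝ 2 P)⟫ ^ 2 := by
  obtain ⟨ξ, hξ⟩ := ξ
  obtain ⟨η, hη⟩ := η
  have e : (fun ω => ⟪wickSq hG ⟨ξ, hξ⟩ ω, wickSq hG ⟨η, hη⟩ ω⟫) =ᵐ[P] fun ω =>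
      (ξ ω ^ 2 * η ω ^ 2 - ‖ξ‖ ^ 2 * η ω ^ 2) - (‖η‖ ^ 2 * ξ ω ^ 2 - ‖ξ‖ ^ 2 * ‖η‖ ^ 2) := by
    filter_upwards [coeFn_wickSq hG ⟨ξ, hξ⟩, coeFn_wickSq hG ⟨η, hη⟩] with ω h1 h2
    rw [h1, h2]
    simp only [RCLike.inner_apply, conj_trivial]
    ring
  have i1 := hG.integrable_sq_mul_sq hξ hη
  have i2 : Integrable (fun ω => ‖η‖ ^ 2 * ξ ω ^ 2) P :=
    ((hG.memLp_sq hξ).integrable (by norm_num)).const_mul _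
  have i3 : Integrable (fun ω => ‖ξ‖ ^ 2 * η ω ^ 2) P :=
    ((hG.memLp_sq hη).integrable (by norm_num)).const_mul _
  have i4 : Integrable (fun _ : Ω => ‖ξ‖ ^ 2 * ‖η‖ ^ 2) P := integrable_const _
  have i5 : Integrable (fun ω => ξ ω ^ 2 * η ω ^ 2 - ‖ξ‖ ^ 2 * η ω ^ 2) P := i1.sub i3
  have i6 : Integrable (fun ω => ‖η‖ ^ 2 * ξ ω ^ 2 - ‖ξ‖ ^ 2 * ‖η‖ ^ 2) P := i2.sub i4
  rw [L2.inner_def, integral_congr_ae e, integral_sub i5 i6, integral_sub i1 i3,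
    integral_sub i2 i4, hG.integral_sq_mul_sq hξ hη, integral_const_mul, integral_const_mul,
    integral_sq_eq_norm_sq, integral_sq_eq_norm_sq]
  simp only [integral_const, probReal_univ, one_smul]
  ring

/-- By homogeneity a nonzero element can be rescaled to unit norm, as the generators of the chaos
require. -/
lemma wickSq_mem_secondChaos {T : ℝ} {W : ℝ → ℝ → Ω → ℝ}
    (hG : IsGaussianSpace P (firstChaos P T W)) (ξ : firstChaos P T W) :
    wickSq hG ξ ∈ secondChaos P T W := by
  obtain ⟨ξ, hξ⟩ := ξ
  rcases eq_or_ne ξ 0 with rfl | h0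
  · have : wickSq hG ⟨0, hξ⟩ = 0 := by
      have h := inner_wickSq hG ⟨0, hξ⟩ ⟨0, hξ⟩
      rw [inner_zero_left] at h
      simpa using h
    rw [this]
    exact Submodule.zero_mem _
  · have hn : ‖ξ‖ ≠ 0 := norm_ne_zero_iff.2 h0
    set η : Lp ℝ 2 P := ‖ξ‖⁻¹ • ξ with hη
    have hηG : η ∈ firstChaos P T W := Submodule.smul_mem _ _ hξ
    have h1n : ‖η‖ = 1 := by rw [hη, norm_smul, norm_inv, norm_norm, inv_mul_cancel₀ hn]
    have hc := coeFn_wickSq hG ⟨η, hηG⟩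
    simp only [h1n, one_pow] at hc
    have he : wickSq hG ⟨ξ, hξ⟩ = ‖ξ‖ ^ 2 • wickSq hG ⟨η, hηG⟩ := by
      refine Lp.ext ?_
      filter_upwards [coeFn_wickSq hG ⟨ξ, hξ⟩, hc, Lp.coeFn_smul (‖ξ‖ ^ 2) (wickSq hG ⟨η, hηG⟩),
        Lp.coeFn_smul ‖ξ‖⁻¹ ξ] with ω h1 h2 h3 h4
      rw [h1, h3, Pi.smul_apply, h2, hη, h4, Pi.smul_apply, smul_eq_mul, smul_eq_mul]
      field_simp
    rw [he]
    exact Submodule.smul_mem _ _ (Submodule.le_topologicalClosure _ (Submodule.subset_span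
      ⟨η, hηG, h1n, hc⟩))

lemma tendsto_inner_self {E : Type*} [NormedAddCommGroup E] [InnerProductSpace ℝ E]
    {S : ℕ → E} {k : ℝ}
    (h : Tendsto (fun n : ℕ × ℕ => ⟪S n.1, S n.2⟫) (atTop ×ˢ atTop) (𝓝 k)) :
    Tendsto (fun N => ⟪S N, S N⟫) atTop (𝓝 k) :=
  h.comp (tendsto_id.prodMk tendsto_id)

/-- The squared distance ⟪S n, S n⟫ + ⟪S m, S m⟫ - 2⟪S n, S m⟫ tends to k + k - 2k = 0. -/
lemma cauchySeq_of_tendsto_inner {E : Type*} [NormedAddCommGroup E] [InnerProductSpace ℝ E]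
    {S : ℕ → E} {k : ℝ}
    (h : Tendsto (fun n : ℕ × ℕ => ⟪S n.1, S n.2⟫) (atTop ×ˢ atTop) (𝓝 k)) : CauchySeq S := by
  have hd := tendsto_inner_self h
  rw [cauchySeq_iff_tendsto_dist_atTop_0, ← prod_atTop_atTop_eq]
  have h2 : Tendsto (fun n : ℕ × ℕ => ⟪S n.1, S n.1⟫ + ⟪S n.2, S n.2⟫ - 2 * ⟪S n.1, S n.2⟫)
      (atTop ×ˢ atTop) (𝓝 (k + k - 2 * k)) :=
    ((hd.comp tendsto_fst).add (hd.comp tendsto_snd)).sub (h.const_mul 2)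
  have h3 := h2.sqrt
  rw [← two_mul, sub_self, Real.sqrt_zero] at h3
  refine h3.congr fun n => ?_
  rw [dist_eq_norm, norm_eq_sqrt_real_inner, inner_sub_left, inner_sub_right, inner_sub_right,
    real_inner_comm (S n.1) (S n.2)]
  congr 1
  ring

/-- The quadratic functional `N ∑ (Δ_i² - ‖Δ_i‖²)`. -/
noncomputable def quadSum (hG : IsGaussianSpace P G) (Δ : ∀ N : ℕ, Fin N → G) (N : ℕ) :
    Lp ℝ 2 P :=
  ∑ i, (N : ℝ) • wickSq hG (Δ N i)

lemma coeFn_quadSum (hG : IsGaussianSpace P G) (Δ : ∀ N : ℕ, Fin N → G) (N : ℕ) :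
    quadSum hG Δ N =ᵐ[P] fun ω =>
      N * ∑ i, ((Δ N i : Lp ℝ 2 P) ω ^ 2 - ‖(Δ N i : Lp ℝ 2 P)‖ ^ 2) := by
  have h2 : ∀ᵐ ω ∂P, ∀ i, wickSq hG (Δ N i) ω =
      (Δ N i : Lp ℝ 2 P) ω ^ 2 - ‖(Δ N i : Lp ℝ 2 P)‖ ^ 2 :=
    ae_all_iff.2 fun i => coeFn_wickSq hG (Δ N i)
  filter_upwards [IsGaussianSpace.coeFn_sum_smul Finset.univ (fun _ => (N : ℝ))
    fun i => wickSq hG (Δ N i), h2] with ω h1 h2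
  rw [quadSum, h1, Finset.mul_sum]
  simp_rw [h2]

/-- The limit in `L²` of the quadratic functionals `N ∑ (Δ_i² - ‖Δ_i‖²)`, and the cumulant
generating function of the limit. -/
theorem exists_tendsto_quadSum (hG : IsGaussianSpace P G) {H : ℝ} (hH : 3 / 4 < H) (hH1 : H < 1)
    {Δ : ∀ N : ℕ, Fin N → G}
    (hΔ : ∀ N M i j, ⟪(Δ N i : Lp ℝ 2 P), (Δ M j : Lp ℝ 2 P)⟫ = cellCov H N M i j) :
    ∃ ζ : Lp ℝ 2 P, Tendsto (quadSum hG Δ) atTop (𝓝 ζ) ∧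
      ‖ζ‖ ^ 2 = 2 * ∫ w, waveCov H w.1 w.2 ^ 2 ∂(unitMeasure.prod unitMeasure) ∧
      ∃ δ > 0, ∀ t, |t| < δ → Integrable (fun ω => Real.exp (t * ζ ω)) P ∧
        HasSum (fun n : ℕ => (2 * t) ^ (n + 2) / (2 * (n + 2)) *
          ∫ z, ∏ i, waveCov H (z i) (z (finRotate (n + 2) i))
            ∂(Measure.pi fun _ : Fin (n + 2) => unitMeasure)) (cgf ζ P t) := by
  obtain ⟨-, hint, hlim⟩ := tendsto_integral_avgCov_sq hH hH1
  have hinner : Tendsto (fun n : ℕ × ℕ => ⟪quadSum hG Δ n.1, quadSum hG Δ n.2⟫) (atTop ×ˢ atTop)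
      (𝓝 (2 * ∫ w, waveCov H w.1 w.2 ^ 2 ∂(unitMeasure.prod unitMeasure))) := by
    refine (hlim.const_mul 2).congr' ?_
    filter_upwards [(eventually_gt_atTop 0).prod_mk (eventually_gt_atTop 0)] with n hn
    rw [integral_avgCov_sq hn.1 hn.2 (hint _ _), quadSum, quadSum, sum_inner]
    simp_rw [inner_sum, inner_smul_left, inner_smul_right, inner_wickSq, hΔ, conj_trivial]
    rw [← Fin.sum_univ_eq_sum_range (fun i => ∑ j ∈ Finset.range n.2, cellCov H n.1 n.2 i j ^ 2)]
    simp_rw [← Fin.sum_univ_eq_sum_range (fun j => cellCov H n.1 n.2 _ j ^ 2), Finset.mul_sum]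
    refine Finset.sum_congr rfl fun i _ => Finset.sum_congr rfl fun j _ => ?_
    ring
  obtain ⟨ζ, hζ⟩ := cauchySeq_tendsto_of_complete (cauchySeq_of_tendsto_inner hinner)
  refine ⟨ζ, hζ, ?_, ?_⟩
  · rw [← real_inner_self_eq_norm_sq]
    exact tendsto_nhds_unique (hζ.inner hζ) (tendsto_inner_self hinner)
  have hdiag (N : ℕ) := exists_orthogonal_diagonalization
    (Matrix.of fun i j : Fin N => cellCov H N N i j) (by
      ext i j
      rw [Matrix.transpose_apply, Matrix.of_apply, Matrix.of_apply, ← hΔ, ← hΔ, real_inner_comm])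
  choose U l h1 h2 hA using hdiag
  set p : ℕ → ℝ := fun n => ∫ z, ∏ i, waveCov H (z i) (z (finRotate (n + 2) i))
    ∂(Measure.pi fun _ : Fin (n + 2) => unitMeasure) with hp
  have hpow (n : ℕ) : Tendsto (fun N : ℕ => ∑ a, (N * l N a) ^ (n + 2)) atTop (𝓝 (p n)) := by
    refine (tendsto_integral_cycle hH hH1 n).2.congr' ?_
    filter_upwards [eventually_gt_atTop 0] with N hN
    rw [sum_eigenvalues_pow hN (h1 N) (hA N) (n + 1)]
  -- Index 0 is the sum of squares of the scaled eigenvalues; being convergent it is bounded, which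
  -- gives ρ.
  obtain ⟨B, hB⟩ := (hpow 0).bddAbove_range
  have hB' (N : ℕ) : ∑ a, (N * l N a) ^ 2 ≤ √(max B 0) ^ 2 := by
    rw [Real.sq_sqrt (le_max_right _ _)]
    exact (hB ⟨N, rfl⟩).trans (le_max_left _ _)
  set ρ := √(max B 0) with hρ
  have hρ0 : 0 ≤ ρ := Real.sqrt_nonneg _
  refine ⟨1 / (8 * (ρ + 1)), by positivity, fun t ht => ?_⟩
  refine hasSum_cgf_of_tendsto_Lp hζ (l := fun N a => N * l N a) hρ0 ?_ hB' hpow ?_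
  · intro N t ht
    -- The factor N of the quadratic sum is absorbed into the argument, so the relevant eigenvalues
    -- are N · l N a.
    have h := hG.mgf_sum_sq (ξ := fun i => (Δ N i : Lp ℝ 2 P)) (fun i => (Δ N i).2) (h1 N) (h2 N)
      (by rw [← hA N]; ext i j; rw [Matrix.of_apply, Matrix.of_apply, ← hΔ])
      (t := N * t) (fun a => by have := ht a; linarith)
    have hc := coeFn_quadSum hG Δ N
    constructor
    · refine h.1.congr ?_
      filter_upwards [hc] with ω hω
      rw [hω]
      ring_nf
    · rw [mgf_congr hc, mgf_const_mul, h.2]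
      refine Finset.prod_congr rfl fun a _ => ?_
      ring_nf
  · rw [lt_div_iff₀ (by positivity)] at ht
    nlinarith [abs_nonneg t]

end Limit

end WaveQV

namespace WaveQV

/-! ### Positivity of the limiting integrals and the explicit constant -/

section Positivity

lemma ae_unitMeasure_mem_Ioo : ∀ᵐ x ∂unitMeasure, x ∈ Set.Ioo (0 : ℝ) 1 := by
  rw [unitMeasure, ← Measure.restrict_congr_set Ioo_ae_eq_Ico]
  exact ae_restrict_mem measurableSet_Ioo

lemma integral_pos_of_ae_pos {α : Type*} [MeasurableSpace α] {μ : Measure α} [NeZero μ]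
    {f : α → ℝ} (hf : Integrable f μ) (h : ∀ᵐ x ∂μ, 0 < f x) : 0 < ∫ x, f x ∂μ := by
  have h0 : 0 ≤ᵐ[μ] f := by filter_upwards [h] with x hx using hx.le
  refine lt_of_le_of_ne (integral_nonneg_of_ae h0) fun he => ?_
  have h1 := (integral_eq_zero_iff_of_nonneg_ae h0 hf).1 he.symm
  obtain ⟨x, hx, hx1⟩ := (h.and h1).exists
  exact hx.ne' hx1

lemma integral_waveCov_sq_pos {H : ℝ} (hH : 3 / 4 < H) (hH1 : H < 1) :
    0 < ∫ w, waveCov H w.1 w.2 ^ 2 ∂(unitMeasure.prod unitMeasure) := by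
  refine integral_pos_of_ae_pos (tendsto_integral_avgCov_sq hH hH1).1 ?_
  have h1 : ∀ᵐ w ∂(unitMeasure.prod unitMeasure), w.1 ∈ Set.Ioo (0 : ℝ) 1 :=
    Measure.quasiMeasurePreserving_fst.ae ae_unitMeasure_mem_Ioo
  have h2 : ∀ᵐ w ∂(unitMeasure.prod unitMeasure), w.2 ∈ Set.Ioo (0 : ℝ) 1 :=
    Measure.quasiMeasurePreserving_snd.ae ae_unitMeasure_mem_Ioo
  filter_upwards [ae_unitMeasure_prod, h1, h2] with w h1 h2 h3
  exact pow_pos (waveCov_pos (by linarith) h2.1 h3.1 h1.2.2) 2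

/-- The density is positive off the axes and the diagonal. For three vertices this makes the third
cumulant nonzero, which excludes a Gaussian limit. -/
lemma integral_cycle_pos {H : ℝ} (hH : 3 / 4 < H) (hH1 : H < 1) (n : ℕ) :
    0 < ∫ z, ∏ i, waveCov H (z i) (z (finRotate (n + 2) i))
      ∂(Measure.pi fun _ : Fin (n + 2) => unitMeasure) := by
  refine integral_pos_of_ae_pos (tendsto_integral_cycle hH hH1 n).1 ?_
  have h1 : ∀ᵐ z ∂(Measure.pi fun _ : Fin (n + 2) => unitMeasure), ∀ i, z i ∈ Set.Ioo (0 : ℝ) 1 :=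
    ae_all_iff.2 fun i =>
      (measurePreserving_eval (fun _ => unitMeasure) i).quasiMeasurePreserving.ae
        ae_unitMeasure_mem_Ioo
  have h2 : ∀ᵐ z ∂(Measure.pi fun _ : Fin (n + 2) => unitMeasure),
      ∀ i, z i ≠ z (finRotate (n + 2) i) := ae_all_iff.2 fun i =>
    ae_pi_unitMeasure_ne fun h => by
      rw [finRotate_apply] at h
      simp at h
  filter_upwards [h1, h2] with z h1 h2
  exact Finset.prod_pos fun i _ => waveCov_pos (by linarith) (h1 i).1 (h1 _).1 (h2 i)

lemma pi_unitMeasure_eq_restrict_Icc (m : ℕ) : Measure.pi (fun _ : Fin m => unitMeasure) =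
    volume.restrict (Set.Icc (0 : Fin m → ℝ) 1) := by
  rw [pi_unitMeasure]
  exact Measure.restrict_congr_set Measure.univ_pi_Ico_ae_eq_Icc

lemma prod_waveCov (H : ℝ) (m : ℕ) (z : Fin m → ℝ) :
    ∏ i, waveCov H (z i) (z (finRotate m i)) = (H * (2 * H - 1) / 2) ^ m * cyclicKernel H m z := by
  simp only [waveCov, Finset.prod_mul_distrib, Finset.prod_const, Finset.card_univ,
    Fintype.card_fin, cyclicKernel]

lemma integral_cycle_eq (H : ℝ) (m : ℕ) :
    ∫ z, ∏ i, waveCov H (z i) (z (finRotate m i)) ∂(Measure.pi fun _ : Fin m => unitMeasure) =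
      (H * (2 * H - 1) / 2) ^ m * ∫ z in Set.Icc (0 : Fin m → ℝ) 1, cyclicKernel H m z := by
  simp_rw [prod_waveCov]
  rw [integral_const_mul, pi_unitMeasure_eq_restrict_Icc]

lemma integrableOn_cyclicKernel {H : ℝ} (hH : 3 / 4 < H) (hH1 : H < 1) (n : ℕ) :
    IntegrableOn (cyclicKernel H (n + 2)) (Set.Icc 0 1) volume := by
  have h := (tendsto_integral_cycle hH hH1 n).1
  simp_rw [prod_waveCov] at h
  rw [pi_unitMeasure_eq_restrict_Icc] at h
  refine (integrable_const_mul_iff (IsUnit.mk0 _ (pow_ne_zero _ ?_)) _).1 h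
  have : 0 < H * (2 * H - 1) := mul_pos (by linarith) (by linarith)
  positivity

end Positivity

/-! ### The quadratic variation as a quadratic functional of increments -/

section Increments

variable {Ω : Type*} [MeasurableSpace Ω] {P : Measure Ω} {H T : ℝ} {W u : ℝ → ℝ → Ω → ℝ}

lemma grid_mem_Icc (hT : 1 ≤ T) {N : ℕ} (i : Fin N) :
    ((i : ℕ) : ℝ) / N ∈ Set.Icc 0 T ∧ (((i : ℕ) : ℝ) + 1) / N ∈ Set.Icc 0 T := by
  have hN : (0 : ℝ) < N := by exact_mod_cast i.pos
  have hi : ((i : ℕ) : ℝ) + 1 ≤ N := by exact_mod_cast i.2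
  refine ⟨⟨by positivity, ?_⟩, ⟨by positivity, ?_⟩⟩ <;> rw [div_le_iff₀ hN] <;> nlinarith

/-- The increment of the solution over the `i`-th cell of the grid of mesh `1/N`. -/
noncomputable def increment (hW : IsFractionalWhiteNoise P H T W) (hu : IsMildSolution P H T W u)
    (hT : 1 ≤ T) (x : ℝ) (N : ℕ) (i : Fin N) : firstChaos P T W :=
  ⟨(hu _ (grid_mem_Icc hT i).2 x).1.toLp _ - (hu _ (grid_mem_Icc hT i).1 x).1.toLp _,
    Submodule.sub_mem _ ((hu _ (grid_mem_Icc hT i).2 x).toLp_mem hW)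
      ((hu _ (grid_mem_Icc hT i).1 x).toLp_mem hW)⟩

lemma coeFn_increment (hW : IsFractionalWhiteNoise P H T W) (hu : IsMildSolution P H T W u)
    (hT : 1 ≤ T) (x : ℝ) {N : ℕ} (i : Fin N) :
    (increment hW hu hT x N i : Lp ℝ 2 P) =ᵐ[P]
      fun ω => u (((i : ℕ) + 1 : ℝ) / N) x ω - u ((i : ℕ) / N : ℝ) x ω := by
  have h := Lp.coeFn_sub ((hu _ (grid_mem_Icc hT i).2 x).1.toLp _)
    ((hu _ (grid_mem_Icc hT i).1 x).1.toLp _)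
  filter_upwards [h, (hu _ (grid_mem_Icc hT i).2 x).1.coeFn_toLp,
    (hu _ (grid_mem_Icc hT i).1 x).1.coeFn_toLp] with ω h1 h2 h3
  rw [increment, h1, Pi.sub_apply, h2, h3]

lemma inner_increment_increment (hH : 1 / 2 < H) (hH1 : H < 1)
    (hW : IsFractionalWhiteNoise P H T W) (hu : IsMildSolution P H T W u)
    (hT : 1 ≤ T) (x : ℝ) (N M : ℕ) (i : Fin N) (j : Fin M) :
    inner ℝ (increment hW hu hT x N i : Lp ℝ 2 P) (increment hW hu hT x M j : Lp ℝ 2 P) =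
      cellCov H N M i j :=
  inner_increment hH hH1 hW hu (grid_mem_Icc hT i).1 (grid_mem_Icc hT i).2 (grid_mem_Icc hT j).1
    (grid_mem_Icc hT j).2 (by gcongr; linarith) (by gcongr; linarith)

variable [IsProbabilityMeasure P]

/-- The weight 1/N of the quadratic variation is N⁻² times the weight N in `quadSum`; hence N⁴
E[V_N²] is the squared norm of the latter. -/
lemma quadVar_ae_eq (hW : IsFractionalWhiteNoise P H T W) (hu : IsMildSolution P H T W u)
    (hT : 1 ≤ T) (x : ℝ) (N : ℕ) :
    quadVar P u x N =ᵐ[P] fun ω => ((N : ℝ) ^ 2)⁻¹ *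
      quadSum (isGaussianSpace_firstChaos hW) (increment hW hu hT x) N ω := by
  have h2 : ∀ᵐ ω ∂P, ∀ i, (increment hW hu hT x N i : Lp ℝ 2 P) ω =
      u (((i : ℕ) + 1 : ℝ) / N) x ω - u ((i : ℕ) / N : ℝ) x ω :=
    ae_all_iff.2 fun i => coeFn_increment hW hu hT x i
  filter_upwards [coeFn_quadSum (isGaussianSpace_firstChaos hW) (increment hW hu hT x) N, h2]
    with ω h1 h2
  rw [h1, quadVar, ← Fin.sum_univ_eq_sum_range (fun i =>
    (u (((i : ℝ) + 1) / N) x ω - u ((i : ℝ) / N) x ω) ^ 2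
      - ∫ ω', (u (((i : ℝ) + 1) / N) x ω' - u ((i : ℝ) / N) x ω') ^ 2 ∂P), ← mul_assoc]
  congr 1
  · rcases eq_or_ne (N : ℝ) 0 with h | h
    · simp [h]
    · field_simp
  · refine Finset.sum_congr rfl fun i _ => ?_
    rw [h2, ← integral_sq_eq_norm_sq]
    congr 1
    refine integral_congr_ae ?_
    filter_upwards [coeFn_increment hW hu hT x i] with ω' h
    rw [h]

lemma integral_quadVar_sq (hW : IsFractionalWhiteNoise P H T W) (hu : IsMildSolution P H T W u)
    (hT : 1 ≤ T) (x : ℝ) (N : ℕ) :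
    ∫ ω, quadVar P u x N ω ^ 2 ∂P = (((N : ℝ) ^ 2)⁻¹ *
      ‖quadSum (isGaussianSpace_firstChaos hW) (increment hW hu hT x) N‖) ^ 2 := by
  rw [mul_pow, ← integral_sq_eq_norm_sq, ← integral_const_mul]
  refine integral_congr_ae ?_
  filter_upwards [quadVar_ae_eq hW hu hT x N] with ω h
  rw [h, mul_pow]

/-- The scale N⁻² cancels in the quotient, so the normalised variation is the quadratic functional
divided by its own norm. -/
lemma normalized_quadVar_ae_eq (hW : IsFractionalWhiteNoise P H T W)
    (hu : IsMildSolution P H T W u) (hT : 1 ≤ T) (x : ℝ) (N : ℕ) :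
    (‖quadSum (isGaussianSpace_firstChaos hW) (increment hW hu hT x) N‖⁻¹ •
      quadSum (isGaussianSpace_firstChaos hW) (increment hW hu hT x) N : Lp ℝ 2 P) =ᵐ[P]
      fun ω => quadVar P u x N ω / √(∫ ω', quadVar P u x N ω' ^ 2 ∂P) := by
  rw [integral_quadVar_sq hW hu hT, Real.sqrt_sq (by positivity)]
  filter_upwards [quadVar_ae_eq hW hu hT x N, Lp.coeFn_smul
    ‖quadSum (isGaussianSpace_firstChaos hW) (increment hW hu hT x) N‖⁻¹
    (quadSum (isGaussianSpace_firstChaos hW) (increment hW hu hT x) N)] with ω h1 h2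
  rw [h1, h2, Pi.smul_apply, smul_eq_mul]
  rcases Nat.eq_zero_or_pos N with rfl | hN
  · simp [quadSum]
  · have : (N : ℝ) ^ 2 ≠ 0 := by positivity
    rw [mul_div_mul_left _ _ (inv_ne_zero this), div_eq_inv_mul]

end Increments

end WaveQV

/-! ### The main theorem -/

theorem mainTheorem5 {Ω : Type*} [MeasurableSpace Ω] (P : Measure Ω) [IsProbabilityMeasure P]
    (H T : ℝ) (hH : 3 / 4 < H) (hH1 : H < 1) (hT : 1 ≤ T)
    (W u : ℝ → ℝ → Ω → ℝ) (hW : WaveQV.IsFractionalWhiteNoise P H T W)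
    (hu : WaveQV.IsMildSolution P H T W u) (x : ℝ) :
    ∃ k : ℝ, 0 < k ∧
      Tendsto (fun N : ℕ => (N : ℝ) ^ 4 * ∫ ω, WaveQV.quadVar P u x N ω ^ 2 ∂P) atTop (𝓝 k) ∧
      ∃ X : Lp ℝ 2 P, X ∈ WaveQV.secondChaos P T W ∧
        TendstoInDistribution
          (fun (N : ℕ) (ω : Ω) => WaveQV.quadVar P u x N ω /
            Real.sqrt (∫ ω', WaveQV.quadVar P u x N ω' ^ 2 ∂P))
          atTop (X : Ω → ℝ) (fun _ => P) P ∧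
        ¬ HasGaussianLaw (X : Ω → ℝ) P ∧
        (0 : ℝ) ∈ interior (integrableExpSet (X : Ω → ℝ) P) ∧
        ∀ m : ℕ, 3 ≤ m →
          IntegrableOn (WaveQV.cyclicKernel H m) (Set.Icc 0 1) volume ∧
          WaveQV.cumulant (X : Ω → ℝ) P m =
            2 ^ (2 * m - 1) * (H / 4) ^ m * (2 * H - 1) ^ m * k ^ (-(m : ℝ) / 2) *
              (Nat.factorial (m - 1) : ℝ) *
              ∫ z in Set.Icc (0 : Fin m → ℝ) 1, WaveQV.cyclicKernel H m z := by
  have hG := WaveQV.isGaussianSpace_firstChaos hW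
  obtain ⟨ζ, hζ, hnorm, δ, hδ, hcgf⟩ := WaveQV.exists_tendsto_quadSum hG hH hH1
    (WaveQV.inner_increment_increment (by linarith) hH1 hW hu hT x)
  have hk : 0 < ‖ζ‖ ^ 2 := by
    rw [hnorm]
    exact mul_pos two_pos (WaveQV.integral_waveCov_sq_pos hH hH1)
  have hζ0 : 0 < ‖ζ‖ := lt_of_le_of_ne (norm_nonneg _) fun h => by
    rw [← h] at hk
    norm_num at hk
  have hmem : ζ ∈ WaveQV.secondChaos P T W :=
    (Submodule.isClosed_topologicalClosure _).mem_of_tendsto hζ (Eventually.of_forall fun N =>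
      Submodule.sum_mem _ fun i _ => Submodule.smul_mem _ _ (WaveQV.wickSq_mem_secondChaos hG _))
  have hX : (‖ζ‖⁻¹ • ζ : Lp ℝ 2 P) =ᵐ[P] fun ω => ‖ζ‖⁻¹ * ζ ω := Lp.coeFn_smul _ _
  have hcum (n : ℕ) : WaveQV.cumulant (‖ζ‖⁻¹ • ζ : Lp ℝ 2 P) P (n + 2) = _ :=
    (WaveQV.cumulant_congr hX _).trans
      (WaveQV.cumulant_const_mul_eq hδ (fun t ht => (hcgf t ht).2) (inv_pos.2 hζ0) n)
  refine ⟨‖ζ‖ ^ 2, hk, ?_, ‖ζ‖⁻¹ • ζ, Submodule.smul_mem _ _ hmem, ?_, ?_, ?_, ?_⟩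
  · refine ((hζ.norm).pow 2).congr' ?_
    filter_upwards [eventually_gt_atTop 0] with N hN
    have : (N : ℝ) ≠ 0 := by positivity
    rw [WaveQV.integral_quadVar_sq hW hu hT]
    field_simp
  -- Since ‖ζ‖ > 0, the normalised functionals even converge in L².
  · exact (WaveQV.tendstoInDistribution_of_tendsto_Lp
      ((hζ.norm.inv₀ hζ0.ne').smul hζ)).congr
      (WaveQV.normalized_quadVar_ae_eq hW hu hT x) (ae_eq_refl _)
  · refine WaveQV.not_hasGaussianLaw_of_cumulant_ne_zero ?_
    rw [hcum 1]
    have := WaveQV.integral_cycle_pos hH hH1 1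
    positivity
  · refine WaveQV.zero_mem_interior_integrableExpSet (mul_pos hδ hζ0) fun t ht => ?_
    have h := (hcgf (t * ‖ζ‖⁻¹) (by
      rw [abs_mul, abs_of_pos (inv_pos.2 hζ0), ← div_eq_mul_inv]
      rwa [div_lt_iff₀ hζ0])).1
    refine h.congr ?_
    filter_upwards [hX] with ω hω
    rw [hω, mul_assoc]
  · intro m hm
    obtain ⟨n, rfl⟩ := Nat.exists_eq_add_of_le' (by omega : 2 ≤ m)
    refine ⟨WaveQV.integrableOn_cyclicKernel hH hH1 n, ?_⟩
    -- Here k = ‖ζ‖², so k^(-m/2) is the m-th power of the normalising factor of X.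
    have hpow : (‖ζ‖ ^ 2) ^ (-((n + 2 : ℕ) : ℝ) / 2) = ‖ζ‖⁻¹ ^ (n + 2) := by
      rw [← Real.rpow_natCast ‖ζ‖ 2, ← Real.rpow_mul hζ0.le, ← Real.rpow_natCast ‖ζ‖⁻¹,
        Real.inv_rpow hζ0.le, ← Real.rpow_neg hζ0.le]
      congr 1
      push_cast
      ring
    -- The exponent 2m - 1 splits as (m - 1) + m: 2^(m-1) comes from the cumulant, and 2^m from
    -- writing H/2 as 2 · H/4.
    rw [hcum n, WaveQV.integral_cycle_eq, hpow, (by omega : 2 * (n + 2) - 1 = (n + 1) + (n + 2)),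
      (by omega : n + 2 - 1 = n + 1), pow_add 2 (n + 1) (n + 2)]
    have e : (H * (2 * H - 1) / 2) ^ (n + 2) =
        2 ^ (n + 2) * (H / 4) ^ (n + 2) * (2 * H - 1) ^ (n + 2) := by
      rw [← mul_pow, ← mul_pow]
      congr 1
      ring
    rw [e]
    ring
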